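/- Let $\alpha\ge\beta\ge-\tfrac12$, $\alpha>-\tfrac12$, $\rho=\alpha+\beta+1$, and let \[ \varphi_\lambda(t)=F\Bigl(\tfrac{\rho+i\lambda}{2},\tfrac{\rho-i\lambda}{2};\alpha+1;-(\sinh t)^2\Bigr),\qquad \psi_\lambda(t)=\frac{\varphi_\lambda(t)}{\varphi_0(t)},\qquad \Delta(t)=2^{2\rho}(\sinh t)^{2\alpha+1}(\cosh t)^{2\beta+1}, \] where $F$ is the Gauss hypergeometric function ($\varphi_\lambda$ is the Jacobi function). For $t>0$ let $0<\lambda_1(t)<\lambda_2(t)<\cdots$ be the positive zeros of $\lambda\mapsto\varphi_\lambda(t)$ and $0<\lambda_1^*(t)<\lambda_2^*(t)<\cdots$ the positive zeros of $\lambda\mapsto\psi_\lambda'(t)$ (derivative in $t$), and let $t_k$, $t_k^*$ be the inverse functions of $\lambda_k$, $\lambda_k^*$ on $(0,\infty)$. For $\gamma>0$ let $\mathcal L^+_\gamma$ be the class of functions $g(t)=\int_{[0,\gamma]}\varphi_\lambda(t)\,d\nu(\lambda)$, $t\in\mathbb R$, with a finite nonnegative Borel measure $\nu$ and $g(0)>0$.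 Let $N_{[0,L]}(g)$ be the number of zeros of $g$ on $[0,L]$ counted with multiplicity, and, for $n\ge1$, $L(g,n)=\inf\{L>0: N_{[0,L]}(g)\ge n\}\in[0,\infty]$. An even continuous function $g$ is called positive definite if $\sum_{i,j=1}^N c_i\overline{c_j}\,T^{x_i}g(x_j)\ge0$ for all $N$, $c_i\in\mathbb C$, $x_i\ge0$, where $T^t$ is the generalized translation of the Jacobi transform, i.e. $T^tg(x)$ is the mean of $g(\operatorname{arcosh}|\cosh t\cosh x+re^{i\chi}\sinh t\sinh x|)$ with respect to the probability measure on $[0,1]\times[0,\pi]$ with density proportional to $(1-r^2)^{\alpha-\beta-1}r^{2\beta+1}(\sin\chi)^{2\beta}$ in $(r,\chi)$ (with $r=1$ if $\alpha=\beta$, and with $\chi\in\{0,\pi\}$, each of probability $\tfrac12$, if $\beta=-\tfrac12$). **Theorem.** For every $m\ge1$ the numbers $t_m(\gamma)$ and $t_m^*(\gamma)$ are well defined, and with \[ \theta_{n,\gamma}=\begin{cases}t_m(\gamma),&n=2m-1,\\ t_m^*(\gamma),&n=2m,\end{cases} \] one has $\inf_{g\in\mathcal L^+_\gamma}L(g,n)\le\theta_{n,\gamma}$.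 Moreover, there is a positive definite function $G_n\in\mathcal L^+_\gamma$ with $L(G_n,n)=\theta_{n,\gamma}$ whose only zero on $[0,\theta_{n,\gamma}]$ is $\theta_{n,\gamma}$, of multiplicity $n$. Explicitly, with $\tau=\theta_{n,\gamma}$, one can take \[ G_{2m-1}(t)=\sum_{i=1}^m B_i\,\varphi_{\lambda_i}(t),\qquad B_i=-\frac{A_i}{\Delta(\tau)\,\varphi_{\lambda_i}'(\tau)}>0,\qquad A_i=\frac{\prod_{j=1}^m\lambda_j^2}{\prod_{j\ne i}(\lambda_j^2-\lambda_i^2)},\qquad \lambda_i=\lambda_i(\tau), \] \[ G_{2m}(t)=\varphi_0(t)+\sum_{i=1}^m B_i^*\,\varphi_{\lambda_i^*}(t),\qquad B_i^*=-\frac{A_i^*}{\lambda_i^{*2}\,\psi_{\lambda_i^*}(\tau)}>0,\qquad A_i^*=\frac{\prod_{j=1}^m\lambda_j^{*2}}{\prod_{j\ne i}(\lambda_j^{*2}-\lambda_i^{*2})},\qquad \lambda_i^*=\lambda_i^*(\tau), \] where products over $j\neq i$ run over $1\le j\le m$. -/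

import Mathlib

open scoped ENNReal

noncomputable section

namespace JacobiZeros

/-- The Gauss hypergeometric function `F(a, b; c; z)` for real `z < 1/2`: the power series at `0`,
continued analytically by `F(a, b; c; z) = (1 - z)^(-a) F(a, c - b; c; z / (z - 1))`;
for `z < 1/2` the argument `z / (z - 1)` lies in the open unit disk, where the series converges. -/
def gaussF (a b c : ℂ) (z : ℝ) : ℂ :=
  (((1 - z : ℝ) : ℂ) ^ (-a)) * ordinaryHypergeometric a (c - b) c ((z / (z - 1) : ℝ) : ℂ)

/-- The Jacobi function
`φ_l(t) = F((ρ + i l)/2, (ρ - i l)/2; α + 1; -(sinh t)^2)`, `ρ = α + β + 1`.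
It is real for real `l` and `t`. -/
def jacobiPhi (α β l t : ℝ) : ℝ :=
  (gaussF ((((α + β + 1 : ℝ) : ℂ) + Complex.I * l) / 2)
    ((((α + β + 1 : ℝ) : ℂ) - Complex.I * l) / 2) ((α + 1 : ℝ) : ℂ) (-(Real.sinh t) ^ 2)).re

/-- `ψ_l(t) = φ_l(t) / φ_0(t)`. -/
def jacobiPsi (α β l t : ℝ) : ℝ := jacobiPhi α β l t / jacobiPhi α β 0 t

/-- `ψ_l'(t)`, the derivative being taken in `t`. -/
def jacobiPsiDeriv (α β l t : ℝ) : ℝ := deriv (jacobiPsi α β l) t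

/-- The weight `Δ(t) = 2^(2ρ) (sinh t)^(2α+1) (cosh t)^(2β+1)`. -/
def weight (α β t : ℝ) : ℝ :=
  (2 : ℝ) ^ (2 * (α + β + 1)) * Real.sinh t ^ (2 * α + 1) * Real.cosh t ^ (2 * β + 1)

/-! ### Positive zeros -/

/-- `x` is the `k`-th positive zero of `f` (counted from `k = 1`, in increasing order, without
multiplicity). -/
def IsNthPosZero (f : ℝ → ℝ) (k : ℕ) (x : ℝ) : Prop :=
  0 < x ∧ f x = 0 ∧ {y : ℝ | 0 < y ∧ y ≤ x ∧ f y = 0}.encard = k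

/-- The `k`-th positive zero of `f`. (The set below has at most one element.) -/
def nthPosZero (f : ℝ → ℝ) (k : ℕ) : ℝ := sInf {x | IsNthPosZero f k x}

/-- `λ_k(t)`: the `k`-th positive zero of `l ↦ φ_l(t)`. -/
def lam (α β : ℝ) (k : ℕ) (t : ℝ) : ℝ := nthPosZero (fun l => jacobiPhi α β l t) k

/-- `λ_k^*(t)`: the `k`-th positive zero of `l ↦ ψ_l'(t)`. -/
def lamStar (α β : ℝ) (k : ℕ) (t : ℝ) : ℝ := nthPosZero (fun l => jacobiPsiDeriv α β l t) k

/-- `t = t_k(l)`, i.e. `t > 0` and `l` is the `k`-th positive zero `λ_k(t)`. -/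
def IsT (α β : ℝ) (k : ℕ) (l t : ℝ) : Prop :=
  0 < t ∧ IsNthPosZero (fun μ => jacobiPhi α β μ t) k l

/-- `t = t_k^*(l)`, i.e. `t > 0` and `l` is the `k`-th positive zero `λ_k^*(t)`. -/
def IsTStar (α β : ℝ) (k : ℕ) (l t : ℝ) : Prop :=
  0 < t ∧ IsNthPosZero (fun μ => jacobiPsiDeriv α β μ t) k l

/-! ### The class of functions, number of zeros, shortest interval -/

/-- The class `𝓛⁺_γ` of functions `g(t) = ∫_{[0,γ]} φ_l(t) dν(l)`, `g(0) > 0`,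
with a finite nonnegative measure `ν`. -/
def classL (α β γ : ℝ) : Set (ℝ → ℝ) :=
  {g | (∃ ν : MeasureTheory.Measure ℝ, MeasureTheory.IsFiniteMeasure ν ∧
      ∀ t : ℝ, g t = ∫ l in Set.Icc 0 γ, jacobiPhi α β l t ∂ν) ∧ 0 < g 0}

/-- `N_I(g)`: the number of zeros of the (analytic) function `g` in `I`, with multiplicity. -/
def numZeros (g : ℝ → ℝ) (I : Set ℝ) : ℕ∞ :=
  ⨆ (s : Finset ℝ) (_ : (s : Set ℝ) ⊆ I), ∑ t ∈ s, analyticOrderAt g t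

/-- `L(g, n) = inf {L > 0 : N_{[0,L]}(g) ≥ n}`, with value `∞` if there is no such `L`. -/
def shortestLength (g : ℝ → ℝ) (n : ℕ) : ℝ≥0∞ :=
  ⨅ (L : ℝ) (_ : 0 < L ∧ (n : ℕ∞) ≤ numZeros g (Set.Icc 0 L)), ENNReal.ofReal L

/-! ### Generalized translation and positive definiteness -/

/-- Mean of `h` over `[0,1]` with respect to the probability density
`2 Γ(α+1) / (Γ(β+1) Γ(α-β)) (1 - r^2)^(α-β-1) r^(2β+1)`;
for `α = β` this is the unit mass at `1`. -/
def radialMean (α β : ℝ) (h : ℝ → ℝ) : ℝ :=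
  if α = β then h 1
  else 2 * Real.Gamma (α + 1) / (Real.Gamma (β + 1) * Real.Gamma (α - β)) *
    ∫ r in (0 : ℝ)..1, h r * ((1 - r ^ 2) ^ (α - β - 1) * r ^ (2 * β + 1))

/-- Mean of `h` over `[0,π]` with respect to the probability density
`Γ(β+1) / (Γ(1/2) Γ(β+1/2)) (sin χ)^(2β)`;
for `β = -1/2` these are masses `1/2` at `0` and at `π`. -/
def angularMean (β : ℝ) (h : ℝ → ℝ) : ℝ :=
  if β = -1 / 2 then (h 0 + h Real.pi) / 2
  else Real.Gamma (β + 1) / (Real.Gamma (1 / 2) * Real.Gamma (β + 1 / 2)) *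
    ∫ χ in (0 : ℝ)..Real.pi, h χ * Real.sin χ ^ (2 * β)

/-- The generalized translation `T^t g(x)` of the Jacobi transform:
the mean of `g (arcosh |cosh t cosh x + r e^{iχ} sinh t sinh x|)` over `r` and `χ`. -/
def translation (α β : ℝ) (t : ℝ) (g : ℝ → ℝ) (x : ℝ) : ℝ :=
  radialMean α β fun r => angularMean β fun χ =>
    g (Real.arcosh ‖((Real.cosh t * Real.cosh x : ℝ) : ℂ) +
      (r : ℂ) * Complex.exp (Complex.I * χ) * ((Real.sinh t * Real.sinh x : ℝ) : ℂ)‖)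

open scoped ComplexOrder in
/-- Positive definiteness with respect to the Jacobi transform. (In `ℂ`, `0 ≤ z` means that `z` is
a nonnegative real number.) -/
def IsPosDef (α β : ℝ) (g : ℝ → ℝ) : Prop :=
  Continuous g ∧ (∀ t, g (-t) = g t) ∧
    ∀ (N : ℕ) (c : Fin N → ℂ) (x : Fin N → ℝ), (∀ i, 0 ≤ x i) →
      0 ≤ ∑ i, ∑ j, c i * (starRingEnd ℂ) (c j) * ((translation α β (x i) g (x j) : ℝ) : ℂ)

/-! ### The extremal functions -/

/-- The coefficients in
`1 / ∏_{i=1}^m (1 - s^2 / z_i^2) = ∑_{i=1}^m A_i / (z_i^2 - s^2)`. -/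
def pfCoeff (z : ℕ → ℝ) (m i : ℕ) : ℝ :=
  (∏ j ∈ Finset.Icc 1 m, z j ^ 2) / ∏ j ∈ (Finset.Icc 1 m).erase i, (z j ^ 2 - z i ^ 2)

/-- `B_i(τ) = - A_i / (Δ(τ) φ_{λ_i(τ)}'(τ))`. -/
def coeffB (α β : ℝ) (m : ℕ) (τ : ℝ) (i : ℕ) : ℝ :=
  -pfCoeff (fun j => lam α β j τ) m i /
    (weight α β τ * deriv (jacobiPhi α β (lam α β i τ)) τ)

/-- `B_i^*(τ) = - A_i^* / (λ_i^*(τ)^2 ψ_{λ_i^*(τ)}(τ))`. -/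
def coeffBStar (α β : ℝ) (m : ℕ) (τ : ℝ) (i : ℕ) : ℝ :=
  -pfCoeff (fun j => lamStar α β j τ) m i /
    (lamStar α β i τ ^ 2 * jacobiPsi α β (lamStar α β i τ) τ)

/-- `∑_{i=1}^m B_i(τ) φ_{λ_i(τ)}(t)`. -/
def extremalOdd (α β : ℝ) (m : ℕ) (τ t : ℝ) : ℝ :=
  ∑ i ∈ Finset.Icc 1 m, coeffB α β m τ i * jacobiPhi α β (lam α β i τ) t

/-- `φ_0(t) + ∑_{i=1}^m B_i^*(τ) φ_{λ_i^*(τ)}(t)`. -/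
def extremalEven (α β : ℝ) (m : ℕ) (τ t : ℝ) : ℝ :=
  jacobiPhi α β 0 t +
    ∑ i ∈ Finset.Icc 1 m, coeffBStar α β m τ i * jacobiPhi α β (lamStar α β i τ) t

/-- `G ∈ 𝓛⁺_γ` is positive definite, satisfies `L(G, n) = θ`, and on `[0, θ]` it vanishes only at
`θ`, where it has a zero of multiplicity `n`. -/
def IsExtremal (α β γ : ℝ) (n : ℕ) (θ : ℝ) (G : ℝ → ℝ) : Prop :=
  G ∈ classL α β γ ∧ IsPosDef α β G ∧ shortestLength G n = ENNReal.ofReal θ ∧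
    (∀ t ∈ Set.Icc 0 θ, G t = 0 ↔ t = θ) ∧ analyticOrderAt G θ = n

end JacobiZeros

end

/-! Dividing by the positive function `φ_0` turns the Jacobi equation into `(w ψ')' + l² w ψ = 0`
with `w = Δ φ_0²`, a Sturm–Liouville equation, singular at 0, whose regular solution for `l = 0` is
the constant 1. Write `(ψ, -w ψ') = R (cos ϑ, sin ϑ)`. The Prüfer angle `ϑ` starts from 0 at `t = 0`
and at `l = 0`; for `l > 0` it increases strictly in `t` and is unbounded, since Jacobi functions
oscillate; by the Wronskian identity it also increases strictly in `l`. Hence `λ_k(t)` and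
`λ_k^*(t)` are the frequencies where `ϑ` equals `(k - 1/2)π` and `kπ`, the points `τ = t_m(γ)`,
`t_m^*(γ)` exist and are unique, and the first `m` frequencies at `τ` lie in `(0, γ]`.

Write `G = φ_0 h` and `L f = -(w f')' / w`. Then `h` combines eigenfunctions of `L` on `(0, τ)`
satisfying a Dirichlet (odd case) or Neumann (even case) condition at `τ`. The coefficients cancel
the boundary values of the eigenfunctions, so that the derivative (odd case) or value (even case) of
an iterate of `L` on `h` at `τ` becomes a power sum `∑ A_i λ_i^(2k)`. By Lagrange interpolation
these sums vanish for `k < m - 1` and not for `k = m - 1`. Each iterate with a double zero at `τ`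
accounts for two units of multiplicity, which gives the order `n`. The coefficients are positive
because the signs of `A_i` and of the boundary values both alternate.

That `h` has no zero inside is a Sturm–Hurwitz argument. Rolle's theorem applied twice, with `w 0 =
0` and the condition at `τ`, shows that `L` loses no zeros in `(0, τ)`, and gains one when value and
derivative both vanish at `τ`. One zero of `h` inside would give all high iterates one zero too
many: after rescaling they converge to the eigenfunction of largest frequency, whose zeros are
simple and are counted by its angle. See `combination_ne_zero_of_dirichlet`,
`combination_ne_zero_of_neumann` and `exists_zeros_of_forall_combination`.

Positive definiteness comes from the product formula (`integral_radialPhi_modSq`): the translate of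
`φ_l`, as a function of `x`, solves the Jacobi equation with the Cauchy data at 0 of a multiple of
`φ_l(t) φ_l(x)`. The quadratic form is then a nonnegative sum of squares. -/

open Filter Topology MeasureTheory

namespace JacobiZeros

/-! ### The hypergeometric equation -/

section Hypergeometric

variable {a b c : ℂ}

theorem ne_neg_nat_of_re_pos {z : ℂ} (hz : 0 < z.re) (n : ℕ) : (n : ℂ) ≠ -z := by
  intro h
  have := congrArg Complex.re h
  simp at this
  have h2 : (0 : ℝ) ≤ n := n.cast_nonneg
  linarith

theorem hasFPowerSeriesOnBall_hypergeometric (ha : 0 < a.re) (hb : 0 < b.re) (hc : 0 < c.re) :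
    HasFPowerSeriesOnBall (ordinaryHypergeometric a b c : ℂ → ℂ)
      (ordinaryHypergeometricSeries ℂ a b c) 0 1 := by
  have hr := ordinaryHypergeometricSeries_radius_eq_one ℂ a b c
    (fun n => ⟨ne_neg_nat_of_re_pos ha n, ne_neg_nat_of_re_pos hb n, ne_neg_nat_of_re_pos hc n⟩)
  have := (ordinaryHypergeometricSeries ℂ a b c).hasFPowerSeriesOnBall (by rw [hr]; norm_num)
  rwa [hr] at this

theorem differentiableOn_hypergeometric (ha : 0 < a.re) (hb : 0 < b.re) (hc : 0 < c.re) :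
    DifferentiableOn ℂ (ordinaryHypergeometric a b c : ℂ → ℂ) (Metric.ball 0 1) := by
  have := (hasFPowerSeriesOnBall_hypergeometric ha hb hc).differentiableOn
  rwa [← ENNReal.ofReal_one, Metric.eball_ofReal] at this

theorem iteratedDeriv_hypergeometric (ha : 0 < a.re) (hb : 0 < b.re) (hc : 0 < c.re) (n : ℕ) :
    iteratedDeriv n (ordinaryHypergeometric a b c : ℂ → ℂ) 0 =
      n.factorial * ordinaryHypergeometricCoefficient a b c n := by
  have h := (hasFPowerSeriesOnBall_hypergeometric ha hb hc).hasFPowerSeriesAt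
  have h2 := h.eq_formalMultilinearSeries
    (h.analyticAt.hasFPowerSeriesAt)
  have h3 := congrArg (fun p : FormalMultilinearSeries ℂ ℂ ℂ => p.coeff n) h2
  simp only [ordinaryHypergeometricSeries, FormalMultilinearSeries.coeff_ofScalars] at h3
  rw [h3, mul_div_cancel₀]
  exact_mod_cast n.factorial_ne_zero

theorem hypergeometricCoefficient_succ (hc : 0 < c.re) (n : ℕ) :
    (n + 1) * (n + c) * ordinaryHypergeometricCoefficient a b c (n + 1) =
      (n + a) * (n + b) * ordinaryHypergeometricCoefficient a b c n := by
  have h1 : (n : ℂ) + c ≠ 0 := by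
    intro h
    exact ne_neg_nat_of_re_pos hc n (eq_neg_of_add_eq_zero_left h)
  have h2 : (n : ℂ) + 1 ≠ 0 := Nat.cast_add_one_ne_zero n
  have h3 : (n.factorial : ℂ) ≠ 0 := by exact_mod_cast n.factorial_ne_zero
  have h4 : (ascPochhammer ℂ n).eval c ≠ 0 := by
    rw [Ne, ascPochhammer_eval_eq_zero_iff]
    rintro ⟨k, -, hk⟩
    exact ne_neg_nat_of_re_pos hc k hk
  have h5 : c + n ≠ 0 := by rwa [add_comm]
  simp only [ordinaryHypergeometricCoefficient, ascPochhammer_succ_eval, Nat.factorial_succ,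
    Nat.cast_mul, Nat.cast_succ]
  field_simp
  ring

theorem hasSum_mul_shift {u : ℕ → ℂ} {z s : ℂ} (h : HasSum (fun n => u n * z ^ n) s) :
    HasSum (fun n => (if n = 0 then 0 else u (n - 1)) * z ^ n) (z * s) := by
  rw [← hasSum_nat_add_iff' 1]
  simp only [Finset.range_one, Finset.sum_singleton, if_true, zero_mul, sub_zero, Nat.succ_ne_zero,
    if_false, Nat.add_sub_cancel]
  refine (h.mul_left z).congr_fun ?_
  intro n
  ring

/-- The hypergeometric differential equation. -/
theorem hypergeometric_ode (ha : 0 < a.re) (hb : 0 < b.re) (hc : 0 < c.re) {z : ℂ}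
    (hz : z ∈ Metric.ball (0 : ℂ) 1) :
    z * (1 - z) * deriv (deriv (ordinaryHypergeometric a b c)) z +
      (c - (a + b + 1) * z) * deriv (ordinaryHypergeometric a b c) z -
      a * b * ordinaryHypergeometric a b c z = 0 := by
  set f : ℂ → ℂ := ordinaryHypergeometric a b c with hf
  have hd := differentiableOn_hypergeometric ha hb hc
  have hd1 : DifferentiableOn ℂ (deriv f) (Metric.ball 0 1) := hd.deriv Metric.isOpen_ball
  have hd2 : DifferentiableOn ℂ (deriv (deriv f)) (Metric.ball 0 1) := hd1.deriv Metric.isOpen_ball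
  obtain ⟨u, hit, hrec⟩ : ∃ u : ℕ → ℂ, (∀ n : ℕ, iteratedDeriv n f 0 = n.factorial * u n) ∧
      ∀ n : ℕ, (n + 1) * (n + c) * u (n + 1) = (n + a) * (n + b) * u n :=
    ⟨_, iteratedDeriv_hypergeometric ha hb hc, hypergeometricCoefficient_succ hc⟩
  have hfac : ∀ n : ℕ, (n.factorial : ℂ) ≠ 0 := fun n => by exact_mod_cast n.factorial_ne_zero
  have s0 : HasSum (fun n => u n * z ^ n) (f z) := by
    have := Complex.hasSum_taylorSeries_on_ball hd hz
    refine this.congr_fun fun n => ?_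
    rw [hit n, sub_zero, smul_eq_mul, smul_eq_mul]
    field_simp [hfac n]
  have s1 : HasSum (fun n : ℕ => ((n + 1) * u (n + 1)) * z ^ n) (deriv f z) := by
    have := Complex.hasSum_taylorSeries_on_ball hd1 hz
    refine this.congr_fun fun n => ?_
    rw [← iteratedDeriv_succ', hit (n + 1), sub_zero, smul_eq_mul, smul_eq_mul, Nat.factorial_succ]
    push_cast
    field_simp [hfac n]
  have s2 : HasSum (fun n : ℕ => ((n + 1) * (n + 2) * u (n + 2)) * z ^ n) (deriv (deriv f) z) := by
    have := Complex.hasSum_taylorSeries_on_ball hd2 hz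
    refine this.congr_fun fun n => ?_
    rw [← iteratedDeriv_succ', ← iteratedDeriv_succ', hit (n + 2), sub_zero, smul_eq_mul,
      smul_eq_mul, Nat.factorial_succ, Nat.factorial_succ]
    push_cast
    field_simp [hfac n]
    ring
  have t2 := hasSum_mul_shift s2
  have t22 := hasSum_mul_shift t2
  have t1 := hasSum_mul_shift s1
  have tot := (((t2.sub t22).add (s1.mul_left c)).sub (t1.mul_left (a + b + 1))).sub
    (s0.mul_left (a * b))
  have hz0 : HasSum (fun _ : ℕ => (0 : ℂ)) 0 := hasSum_zero
  have key := tot.unique (hz0.congr_fun ?_)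
  · rw [← key]; ring
  intro n
  have hrec := hrec n
  -- The coefficient of `z ^ n` in the equation is the recurrence. The cases 0 and 1 stand apart
  -- because multiplication by `z` and `z²` fills the first places with zeros.
  rcases n with _ | _ | n
  · simp at hrec ⊢
    linear_combination hrec
  · simp at hrec ⊢
    linear_combination z * hrec
  · simp at hrec ⊢
    linear_combination z ^ (n + 2) * hrec

end Hypergeometric

/-! ### The Jacobi function in the variable `y = cosh² t` -/

section Continuation

variable {a b c : ℂ}

/-- The function `ζ ^ (-a) F(a, b; c; 1 - 1 / ζ)`, holomorphic for `Re ζ > 1/2`. -/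
noncomputable def eulerF (a b c ζ : ℂ) : ℂ := ζ ^ (-a) * ordinaryHypergeometric a b c (1 - ζ⁻¹)

theorem ne_zero_of_half_lt_re {ζ : ℂ} (h : 1 / 2 < ζ.re) : ζ ≠ 0 := by
  rintro rfl
  norm_num at h

/-- The half-plane consists of the points closer to 1 than to 0, so `|ζ - 1| < |ζ|` there. -/
theorem one_sub_inv_mem_ball {ζ : ℂ} (h : 1 / 2 < ζ.re) : 1 - ζ⁻¹ ∈ Metric.ball (0 : ℂ) 1 := by
  have h0 := ne_zero_of_half_lt_re h
  have e : 1 - ζ⁻¹ = (ζ - 1) / ζ := by field_simp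
  rw [mem_ball_zero_iff, e, norm_div, div_lt_one (norm_pos_iff.2 h0)]
  refine lt_of_pow_lt_pow_left₀ 2 (norm_nonneg _) ?_
  rw [← Complex.normSq_eq_norm_sq, ← Complex.normSq_eq_norm_sq, Complex.normSq_apply,
    Complex.normSq_apply]
  simp
  nlinarith

theorem hasDerivAt_one_sub_inv {ζ : ℂ} (h : ζ ≠ 0) :
    HasDerivAt (fun ζ : ℂ => 1 - ζ⁻¹) (ζ⁻¹ ^ 2) ζ := by
  have := (hasDerivAt_inv h).const_sub 1
  simpa using this

theorem hasDerivAt_eulerF (ha : 0 < a.re) (hb : 0 < b.re) (hc : 0 < c.re) {ζ : ℂ}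
    (h : 1 / 2 < ζ.re) :
    HasDerivAt (eulerF a b c) (ζ ^ (-a) * (-a * ζ⁻¹ * ordinaryHypergeometric a b c (1 - ζ⁻¹) +
      ζ⁻¹ ^ 2 * deriv (ordinaryHypergeometric a b c) (1 - ζ⁻¹))) ζ := by
  have h0 := ne_zero_of_half_lt_re h
  have hs : ζ ∈ Complex.slitPlane := Or.inl (by linarith)
  have hd := (differentiableOn_hypergeometric ha hb hc).differentiableAt
    (Metric.isOpen_ball.mem_nhds (one_sub_inv_mem_ball h))
  have h1 := hd.hasDerivAt.comp ζ (hasDerivAt_one_sub_inv h0)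
  have h2 : HasDerivAt (fun ζ : ℂ => ζ ^ (-a)) (-a * ζ ^ (-a - 1) * 1) ζ :=
    (hasDerivAt_id ζ).cpow_const hs
  have h3 := h2.mul h1
  refine (h3.congr_deriv ?_)
  rw [Complex.cpow_sub _ _ h0, Complex.cpow_one]
  simp only [Function.comp]
  field_simp

theorem hasDerivAt_deriv_eulerF (ha : 0 < a.re) (hb : 0 < b.re) (hc : 0 < c.re) {ζ : ℂ}
    (h : 1 / 2 < ζ.re) :
    HasDerivAt (deriv (eulerF a b c))
      (ζ ^ (-a) * (a * (a + 1) * ζ⁻¹ ^ 2 * ordinaryHypergeometric a b c (1 - ζ⁻¹)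
      - (2 * a + 2) * ζ⁻¹ ^ 3 * deriv (ordinaryHypergeometric a b c) (1 - ζ⁻¹)
      + ζ⁻¹ ^ 4 * deriv (deriv (ordinaryHypergeometric a b c)) (1 - ζ⁻¹))) ζ := by
  have h0 := ne_zero_of_half_lt_re h
  have hs : ζ ∈ Complex.slitPlane := Or.inl (by linarith)
  have ho : IsOpen {ζ : ℂ | 1 / 2 < ζ.re} := isOpen_lt continuous_const Complex.continuous_re
  have hev : deriv (eulerF a b c) =ᶠ[𝓝 ζ] fun ζ => ζ ^ (-a) *
      (-a * ζ⁻¹ * ordinaryHypergeometric a b c (1 - ζ⁻¹) +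
      ζ⁻¹ ^ 2 * deriv (ordinaryHypergeometric a b c) (1 - ζ⁻¹)) := by
    filter_upwards [ho.mem_nhds h] with x hx
    exact (hasDerivAt_eulerF ha hb hc hx).deriv
  refine HasDerivAt.congr_of_eventuallyEq ?_ hev
  have hdo := differentiableOn_hypergeometric ha hb hc
  have hn := Metric.isOpen_ball.mem_nhds (one_sub_inv_mem_ball h)
  have hd := (hdo.differentiableAt hn).hasDerivAt.comp ζ (hasDerivAt_one_sub_inv h0)
  have hd1 := ((hdo.deriv Metric.isOpen_ball).differentiableAt hn).hasDerivAt.comp ζ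
    (hasDerivAt_one_sub_inv h0)
  have h2 : HasDerivAt (fun ζ : ℂ => ζ ^ (-a)) (-a * ζ ^ (-a - 1) * 1) ζ :=
    (hasDerivAt_id ζ).cpow_const hs
  have hi := hasDerivAt_inv h0
  have h3 := h2.mul (((hi.const_mul (-a)).mul hd).add ((hi.pow 2).mul hd1))
  refine (h3.congr_deriv ?_)
  rw [Complex.cpow_sub _ _ h0, Complex.cpow_one]
  simp only [Function.comp, Pi.mul_apply, Pi.add_apply, Pi.pow_apply, Nat.cast_ofNat,
    Nat.add_one_sub_one, pow_one]
  field_simp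
  ring

/-- Pfaff's transformation at the level of equations: this is the hypergeometric equation with
parameters `a`, `c - b`, `c` in the variable `1 - ζ`. After substitution it is a multiple of the
equation of `F(a, b; c; ·)` at `1 - 1/ζ`. -/
theorem eulerF_ode (ha : 0 < a.re) (hb : 0 < b.re) (hc : 0 < c.re) {ζ : ℂ}
    (h : 1 / 2 < ζ.re) :
    ζ * (ζ - 1) * deriv (deriv (eulerF a b c)) ζ +
      ((a + (c - b) + 1) * ζ - (a - b + 1)) * deriv (eulerF a b c) ζ +
      a * (c - b) * eulerF a b c ζ = 0 := by
  have h0 := ne_zero_of_half_lt_re h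
  have hode := hypergeometric_ode ha hb hc (one_sub_inv_mem_ball h)
  rw [(hasDerivAt_deriv_eulerF ha hb hc h).deriv, (hasDerivAt_eulerF ha hb hc h).deriv, eulerF]
  generalize deriv (deriv (ordinaryHypergeometric a b c)) (1 - ζ⁻¹) = f2 at *
  generalize deriv (ordinaryHypergeometric a b c) (1 - ζ⁻¹) = f1 at *
  generalize ordinaryHypergeometric a b c (1 - ζ⁻¹) = f0 at *
  generalize ζ ^ (-a) = p
  field_simp at hode ⊢
  linear_combination p * hode

theorem analyticAt_eulerF (ha : 0 < a.re) (hb : 0 < b.re) (hc : 0 < c.re) {ζ : ℂ}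
    (h : 1 / 2 < ζ.re) : AnalyticAt ℂ (eulerF a b c) ζ := by
  have ho : IsOpen {ζ : ℂ | 1 / 2 < ζ.re} := isOpen_lt continuous_const Complex.continuous_re
  refine DifferentiableOn.analyticAt (s := {ζ : ℂ | 1 / 2 < ζ.re}) (fun x hx => ?_) (ho.mem_nhds h)
  exact (hasDerivAt_eulerF ha hb hc hx).differentiableAt.differentiableWithinAt

end Continuation

/-- The Jacobi function as a function of `y = cosh² t`. -/
noncomputable def radialPhi (α β l y : ℝ) : ℝ :=
  (eulerF ((((α + β + 1 : ℝ) : ℂ) + Complex.I * l) / 2)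
    (((α + 1 : ℝ) : ℂ) - (((α + β + 1 : ℝ) : ℂ) - Complex.I * l) / 2) ((α + 1 : ℝ) : ℂ) y).re

theorem jacobiPhi_eq_radialPhi (α β l t : ℝ) :
    jacobiPhi α β l t = radialPhi α β l (Real.cosh t ^ 2) := by
  have h1 : (1 : ℝ) - -(Real.sinh t) ^ 2 = Real.cosh t ^ 2 := by
    rw [Real.cosh_sq]; ring
  have hc : Real.cosh t ^ 2 ≠ 0 := by positivity
  have h2 : -(Real.sinh t) ^ 2 / (-(Real.sinh t) ^ 2 - 1) = 1 - (Real.cosh t ^ 2)⁻¹ := by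
    have : -(Real.sinh t) ^ 2 - 1 ≠ 0 := by nlinarith [sq_nonneg (Real.sinh t)]
    have hs : Real.sinh t ^ 2 = Real.cosh t ^ 2 - 1 := by rw [Real.cosh_sq]; ring
    rw [hs] at this ⊢
    field_simp
    ring
  rw [jacobiPhi, radialPhi, gaussF, eulerF, h1, h2]
  push_cast
  rfl

section Parameters

variable {α β : ℝ}

theorem analyticAt_radialPhi (hβ : -1 / 2 ≤ β) (hβα : β ≤ α) (hα : -1 / 2 < α) (l : ℝ) {y : ℝ}
    (hy : 1 / 2 < y) : AnalyticAt ℝ (radialPhi α β l) y := by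
  refine AnalyticAt.re_ofReal (analyticAt_eulerF ?_ ?_ ?_ ?_)
  · simp; linarith
  · simp; linarith
  · simp; linarith
  · simpa using hy

/-- The parameters `a` and `c - b` are the conjugate numbers `(ρ ± i l)/2`, so their sum and product
are real. The complex equation then has real coefficients and its real part can be taken. -/
theorem radialPhi_ode (hβ : -1 / 2 ≤ β) (hβα : β ≤ α) (hα : -1 / 2 < α) (l : ℝ) {y : ℝ}
    (hy : 1 / 2 < y) :
    y * (y - 1) * deriv (deriv (radialPhi α β l)) y +
      ((α + β + 2) * y - (β + 1)) * deriv (radialPhi α β l) y +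
      (l ^ 2 + (α + β + 1) ^ 2) / 4 * radialPhi α β l y = 0 := by
  set a : ℂ := (((α + β + 1 : ℝ) : ℂ) + Complex.I * l) / 2 with ha'
  set b : ℂ := ((α + 1 : ℝ) : ℂ) - (((α + β + 1 : ℝ) : ℂ) - Complex.I * l) / 2 with hb'
  set c : ℂ := ((α + 1 : ℝ) : ℂ) with hc'
  have ha : 0 < a.re := by simp [ha']; linarith
  have hb : 0 < b.re := by simp [hb', hc']; linarith
  have hc : 0 < c.re := by simp [hc']; linarith
  have hd1 : ∀ {y : ℝ}, 1 / 2 < y → HasDerivAt (radialPhi α β l) (deriv (eulerF a b c) y).re y := by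
    intro y hy
    exact (hasDerivAt_eulerF ha hb hc (by simpa using hy)).differentiableAt.hasDerivAt.real_of_complex
  have hev : deriv (radialPhi α β l) =ᶠ[𝓝 y] fun y => (deriv (eulerF a b c) y).re := by
    filter_upwards [lt_mem_nhds hy] with x hx
    exact (hd1 hx).deriv
  have hd2 : deriv (deriv (radialPhi α β l)) y = (deriv (deriv (eulerF a b c)) y).re := by
    rw [hev.deriv_eq]
    exact (hasDerivAt_deriv_eulerF ha hb hc
      (by simpa using hy)).differentiableAt.hasDerivAt.real_of_complex.deriv
  have hode := congrArg Complex.re (eulerF_ode ha hb hc (ζ := y) (by simpa using hy))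
  rw [hd2, (hd1 hy).deriv, radialPhi]
  have e1 : (y : ℂ) * (y - 1) = ((y * (y - 1) : ℝ) : ℂ) := by push_cast; ring
  have e2 : (a + (c - b) + 1) * (y : ℂ) - (a - b + 1) =
      (((α + β + 2) * y - (β + 1) : ℝ) : ℂ) := by
    simp only [ha', hb', hc']; push_cast; ring
  have e3 : a * (c - b) = (((l ^ 2 + (α + β + 1) ^ 2) / 4 : ℝ) : ℂ) := by
    simp only [ha', hb', hc']; push_cast; ring_nf; rw [Complex.I_sq]; ring
  rw [e1, e2, e3, Complex.add_re, Complex.add_re, Complex.re_ofReal_mul, Complex.re_ofReal_mul,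
    Complex.re_ofReal_mul] at hode
  exact hode.trans Complex.zero_re

theorem radialPhi_one (α β l : ℝ) : radialPhi α β l 1 = 1 := by
  simp [radialPhi, eulerF]

/-- For `l = 0` all three parameters are positive and `1 - 1/y` lies in `[0, 1)`, so the series has
nonnegative terms and begins with 1. -/
theorem radialPhi_zero_pos (hβ : -1 / 2 ≤ β) (hβα : β ≤ α) (hα : -1 / 2 < α) {y : ℝ}
    (hy : 1 ≤ y) : 0 < radialPhi α β 0 y := by
  set a : ℝ := (α + β + 1) / 2 with ha'
  set b : ℝ := α + 1 - (α + β + 1) / 2 with hb'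
  set c : ℝ := α + 1 with hc'
  have ha : 0 < a := by simp only [ha']; linarith
  have hb : 0 < b := by simp only [hb']; linarith
  have hc : 0 < c := by simp only [hc']; linarith
  have hx0 : 0 ≤ 1 - y⁻¹ := by
    have : y⁻¹ ≤ 1 := inv_le_one_of_one_le₀ hy
    linarith
  have hyc : (1 : ℝ) / 2 < (y : ℂ).re := by simp; linarith
  have hs := (hasFPowerSeriesOnBall_hypergeometric (a := a) (b := b) (c := c) (by simpa using ha)
    (by simpa using hb) (by simpa using hc)).hasSum (y := 1 - (y : ℂ)⁻¹) (by
      have := one_sub_inv_mem_ball hyc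
      rwa [← ENNReal.ofReal_one, Metric.eball_ofReal])
  simp only [ordinaryHypergeometricSeries_apply_eq, zero_add] at hs
  have hs2 := Complex.hasSum_re hs
  have hterm : ∀ n : ℕ, ((((n.factorial : ℂ)⁻¹ * (ascPochhammer ℂ n).eval (a : ℂ) *
      (ascPochhammer ℂ n).eval (b : ℂ) * ((ascPochhammer ℂ n).eval (c : ℂ))⁻¹) •
      (1 - (y : ℂ)⁻¹) ^ n)).re = ((n.factorial : ℝ)⁻¹ * (ascPochhammer ℝ n).eval a *
      (ascPochhammer ℝ n).eval b * ((ascPochhammer ℝ n).eval c)⁻¹) * (1 - y⁻¹) ^ n := by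
    intro n
    have hp : ∀ x : ℝ, (ascPochhammer ℂ n).eval (x : ℂ) = (((ascPochhammer ℝ n).eval x : ℝ) : ℂ) := by
      intro x
      rw [← ascPochhammer_map (algebraMap ℝ ℂ), Polynomial.eval_map_algebraMap,
        ← Complex.coe_algebraMap, Polynomial.aeval_algebraMap_apply]
      simp
    rw [hp, hp, hp, smul_eq_mul, ← Complex.ofReal_re (_ * _)]
    push_cast
    rfl
  simp only [hterm] at hs2
  have hpos : 0 < (ordinaryHypergeometric (a : ℂ) b c (1 - (y : ℂ)⁻¹)).re := by
    refine lt_of_lt_of_le ?_ (le_hasSum hs2 0 fun n _ => ?_)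
    · simp
    · have h1 := (ascPochhammer_pos n a ha).le
      have h2 := (ascPochhammer_pos n b hb).le
      have h3 := (ascPochhammer_pos n c hc).le
      positivity
  have hpow : (y : ℂ) ^ (-(a : ℂ)) = ((y ^ (-a) : ℝ) : ℂ) := by
    rw [Complex.ofReal_cpow (by linarith)]; push_cast; rfl
  have e : radialPhi α β 0 y = (eulerF a b c y).re := by
    simp [radialPhi, ha', hb', hc']
  rw [e, eulerF, hpow, Complex.re_ofReal_mul]
  exact mul_pos (Real.rpow_pos_of_pos (by linarith) _) hpos

end Parameters

/-! ### Energy estimates for second order equations -/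

theorem antitoneOn_of_hasDerivAt_nonpos {f f' : ℝ → ℝ} {a b : ℝ}
    (hc : ContinuousOn f (Set.Icc a b)) (hd : ∀ t ∈ Set.Ioo a b, HasDerivAt f (f' t) t)
    (hle : ∀ t ∈ Set.Ioo a b, f' t ≤ 0) : AntitoneOn f (Set.Icc a b) := by
  refine antitoneOn_of_deriv_nonpos (convex_Icc a b) hc ?_ ?_ <;> rw [interior_Icc]
  · exact fun t ht => (hd t ht).differentiableAt.differentiableWithinAt
  · intro t ht
    rw [(hd t ht).deriv]
    exact hle t ht

/-- Growth of the energy `u'² + κ u²` along solutions of `u'' + q u' + κ u = f`, `q ≥ 0`. -/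
theorem energy_le {q f u u' : ℝ → ℝ} {κ δ T : ℝ} (hκ : 0 ≤ κ)
    (hq : ∀ t ∈ Set.Ioo 0 T, 0 ≤ q t) (hf : ∀ t ∈ Set.Ioo 0 T, f t ^ 2 ≤ δ ^ 2)
    (hu : ContinuousOn u (Set.Icc 0 T)) (hu' : ContinuousOn u' (Set.Icc 0 T))
    (hd : ∀ t ∈ Set.Ioo 0 T, HasDerivAt u (u' t) t)
    (hd' : ∀ t ∈ Set.Ioo 0 T, HasDerivAt u' (-q t * u' t - κ * u t + f t) t)
    {t : ℝ} (ht : t ∈ Set.Icc 0 T) :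
    u' t ^ 2 + κ * u t ^ 2 + δ ^ 2 ≤ (u' 0 ^ 2 + κ * u 0 ^ 2 + δ ^ 2) * Real.exp t := by
  -- With `E = u'² + κ u²`, one has `E' = -2 q u'² + 2 u' f ≤ E + δ²`. The equation is needed only
  -- in the open interval, so a singularity of `q` at 0 does no harm.
  have hanti : AntitoneOn (fun t => (u' t ^ 2 + κ * u t ^ 2 + δ ^ 2) * Real.exp (-t))
      (Set.Icc 0 T) := by
    refine antitoneOn_of_hasDerivAt_nonpos (f' := fun t =>
      (2 * u' t * (-q t * u' t - κ * u t + f t) + κ * (2 * u t * u' t)) * Real.exp (-t) +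
      (u' t ^ 2 + κ * u t ^ 2 + δ ^ 2) * (Real.exp (-t) * -1)) ?_ ?_ ?_
    · fun_prop
    · intro s hs
      have h1 := ((((hd' s hs).pow 2).add (((hd s hs).pow 2).const_mul κ)).add_const (δ ^ 2)).mul
        ((hasDerivAt_neg s).exp)
      refine h1.congr_deriv ?_
      simp
    · intro s hs
      have h1 := hq s hs
      have h2 := hf s hs
      have h3 : (2 * u' s * (-q s * u' s - κ * u s + f s) + κ * (2 * u s * u' s)) ≤
          u' s ^ 2 + κ * u s ^ 2 + δ ^ 2 := by
        nlinarith [sq_nonneg (u' s - f s), mul_nonneg h1 (sq_nonneg (u' s)),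
          mul_nonneg hκ (sq_nonneg (u s))]
      nlinarith [Real.exp_pos (-s)]
  have h := hanti ⟨le_rfl, ht.1.trans ht.2⟩ ht ht.1
  simp only [neg_zero, Real.exp_zero, mul_one] at h
  have h2 := mul_le_mul_of_nonneg_right h (Real.exp_pos t).le
  rwa [mul_assoc, ← Real.exp_add, neg_add_cancel, Real.exp_zero, mul_one] at h2

/-- A solution of `u'' + q u' + κ u = 0` with vanishing Cauchy data at a regular point vanishes to
the left of it. -/
theorem eq_zero_of_cauchy_data_eq_zero {q u u' : ℝ → ℝ} {κ a b C : ℝ} (hκ : 0 < κ) (hab : a ≤ b)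
    (hC : 0 ≤ C) (hq : ∀ t ∈ Set.Ioo a b, q t ≤ C)
    (hu : ContinuousOn u (Set.Icc a b)) (hu' : ContinuousOn u' (Set.Icc a b))
    (hd : ∀ t ∈ Set.Ioo a b, HasDerivAt u (u' t) t)
    (hd' : ∀ t ∈ Set.Ioo a b, HasDerivAt u' (-q t * u' t - κ * u t) t)
    (h0 : u b = 0) (h0' : u' b = 0) : u a = 0 := by
  -- Here `E' ≥ -2 C E`, so `E e^(2Ct)` is nondecreasing, and it vanishes at `b`.
  have hanti : AntitoneOn (fun t => -((u' t ^ 2 + κ * u t ^ 2) * Real.exp (2 * C * t)))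
      (Set.Icc a b) := by
    refine antitoneOn_of_hasDerivAt_nonpos (f' := fun t =>
      -((2 * u' t * (-q t * u' t - κ * u t) + κ * (2 * u t * u' t)) * Real.exp (2 * C * t) +
      (u' t ^ 2 + κ * u t ^ 2) * (Real.exp (2 * C * t) * (2 * C)))) ?_ ?_ ?_
    · fun_prop
    · intro s hs
      have h1 := ((((hd' s hs).pow 2).add (((hd s hs).pow 2).const_mul κ)).mul
        (((hasDerivAt_id s).const_mul (2 * C)).exp)).neg
      refine h1.congr_deriv ?_
      simp
    · intro s hs
      have h1 := hq s hs
      have h3 : 0 ≤ (2 * u' s * (-q s * u' s - κ * u s) + κ * (2 * u s * u' s)) +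
          (u' s ^ 2 + κ * u s ^ 2) * (2 * C) := by
        nlinarith [mul_nonneg (sub_nonneg.2 h1) (sq_nonneg (u' s)),
          mul_nonneg hC (mul_nonneg hκ.le (sq_nonneg (u s)))]
      nlinarith [Real.exp_pos (2 * C * s)]
  have h := hanti ⟨le_rfl, hab⟩ ⟨hab, le_rfl⟩ hab
  simp only [h0, h0'] at h
  have h4 : (u' a ^ 2 + κ * u a ^ 2) ≤ 0 := by
    by_contra hc
    push Not at hc
    have := mul_pos hc (Real.exp_pos (2 * C * a))
    linarith
  have h5 : κ * u a ^ 2 ≤ 0 := by nlinarith [sq_nonneg (u' a)]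
  have h6 : u a ^ 2 = 0 := le_antisymm (by nlinarith [sq_nonneg (u a)]) (sq_nonneg _)
  exact pow_eq_zero_iff (two_ne_zero) |>.1 h6

/-! ### The differential equation of the Jacobi functions -/

/-- The first order coefficient `Δ' / Δ` of the Jacobi equation. -/
noncomputable def drift (α β t : ℝ) : ℝ :=
  (2 * α + 1) * (Real.cosh t / Real.sinh t) + (2 * β + 1) * (Real.sinh t / Real.cosh t)

theorem half_lt_cosh_sq (t : ℝ) : 1 / 2 < Real.cosh t ^ 2 := by
  nlinarith [Real.one_le_cosh t]

theorem jacobiPhi_zero_right (α β l : ℝ) : jacobiPhi α β l 0 = 1 := by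
  rw [jacobiPhi_eq_radialPhi]
  simpa using radialPhi_one α β l

theorem jacobiPhi_neg (α β l t : ℝ) : jacobiPhi α β l (-t) = jacobiPhi α β l t := by
  rw [jacobiPhi_eq_radialPhi, jacobiPhi_eq_radialPhi, Real.cosh_neg]

section Parameters

variable {α β : ℝ}

theorem drift_nonneg (hβ : -1 / 2 ≤ β) (hα : -1 / 2 < α) {t : ℝ} (ht : 0 < t) :
    0 ≤ drift α β t := by
  have h1 := Real.sinh_pos_iff.2 ht
  have h2 := Real.cosh_pos t
  have h3 : 0 ≤ 2 * α + 1 := by linarith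
  have h4 : 0 ≤ 2 * β + 1 := by linarith
  unfold drift
  positivity

theorem hasDerivAt_drift (α β : ℝ) {t : ℝ} (ht : 0 < t) :
    HasDerivAt (drift α β)
      (-(2 * α + 1) / Real.sinh t ^ 2 + (2 * β + 1) / Real.cosh t ^ 2) t := by
  have h1 := (Real.sinh_pos_iff.2 ht).ne'
  have h2 := (Real.cosh_pos t).ne'
  have h := (((Real.hasDerivAt_cosh t).div (Real.hasDerivAt_sinh t) h1).const_mul (2 * α + 1)).add
    (((Real.hasDerivAt_sinh t).div (Real.hasDerivAt_cosh t) h2).const_mul (2 * β + 1))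
  refine h.congr_deriv ?_
  have e1 : Real.sinh t * Real.sinh t - Real.cosh t * Real.cosh t = -1 := by
    nlinarith [Real.cosh_sq t]
  have e2 : Real.cosh t * Real.cosh t - Real.sinh t * Real.sinh t = 1 := by
    nlinarith [Real.cosh_sq t]
  rw [e1, e2]
  ring

variable (hβ : -1 / 2 ≤ β) (hβα : β ≤ α) (hα : -1 / 2 < α)
include hβ hβα hα

theorem analyticAt_jacobiPhi (l t : ℝ) : AnalyticAt ℝ (jacobiPhi α β l) t := by
  have h : jacobiPhi α β l = radialPhi α β l ∘ fun t => Real.cosh t ^ 2 :=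
    funext fun t => jacobiPhi_eq_radialPhi α β l t
  rw [h]
  refine (analyticAt_radialPhi hβ hβα hα l (half_lt_cosh_sq t)).comp_of_eq ?_ rfl
  have : AnalyticAt ℝ Real.cosh t := Real.contDiff_cosh.contDiffAt.analyticAt
  exact this.pow 2

theorem continuous_jacobiPhi (l : ℝ) : Continuous (jacobiPhi α β l) :=
  continuous_iff_continuousAt.2 fun t => (analyticAt_jacobiPhi hβ hβα hα l t).continuousAt

theorem hasDerivAt_jacobiPhi (l t : ℝ) :
    HasDerivAt (jacobiPhi α β l) (deriv (jacobiPhi α β l) t) t :=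
  (analyticAt_jacobiPhi hβ hβα hα l t).differentiableAt.hasDerivAt

theorem continuous_deriv_jacobiPhi (l : ℝ) : Continuous (deriv (jacobiPhi α β l)) :=
  continuous_iff_continuousAt.2 fun t => (analyticAt_jacobiPhi hβ hβα hα l t).deriv.continuousAt

theorem deriv_jacobiPhi (l t : ℝ) : deriv (jacobiPhi α β l) t =
    deriv (radialPhi α β l) (Real.cosh t ^ 2) * (2 * Real.cosh t * Real.sinh t) := by
  have h : jacobiPhi α β l = radialPhi α β l ∘ fun t => Real.cosh t ^ 2 :=
    funext fun t => jacobiPhi_eq_radialPhi α β l t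
  have h1 := (analyticAt_radialPhi hβ hβα hα l (half_lt_cosh_sq t)).differentiableAt.hasDerivAt
  have h2 := (Real.hasDerivAt_cosh t).pow 2
  have h3 := HasDerivAt.comp t (h₂ := radialPhi α β l) (h := fun t => Real.cosh t ^ 2) h1 h2
  rw [h, h3.deriv]
  simp

theorem deriv_jacobiPhi_zero_right (l : ℝ) : deriv (jacobiPhi α β l) 0 = 0 := by
  rw [deriv_jacobiPhi hβ hβα hα]
  simp

theorem deriv_jacobiPhi_neg (l t : ℝ) :
    deriv (jacobiPhi α β l) (-t) = -deriv (jacobiPhi α β l) t := by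
  rw [deriv_jacobiPhi hβ hβα hα, deriv_jacobiPhi hβ hβα hα, Real.cosh_neg, Real.sinh_neg]
  ring

theorem jacobiPhi_zero_pos (t : ℝ) : 0 < jacobiPhi α β 0 t := by
  rw [jacobiPhi_eq_radialPhi]
  exact radialPhi_zero_pos hβ hβα hα (by nlinarith [Real.one_le_cosh t])

/-- The Jacobi equation `φ'' + (Δ'/Δ) φ' + (l² + ρ²) φ = 0`. -/
theorem jacobiPhi_ode (l : ℝ) {t : ℝ} (ht : 0 < t) :
    HasDerivAt (deriv (jacobiPhi α β l)) (-drift α β t * deriv (jacobiPhi α β l) t -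
      (l ^ 2 + (α + β + 1) ^ 2) * jacobiPhi α β l t) t := by
  have hfun : deriv (jacobiPhi α β l) = fun t =>
      deriv (radialPhi α β l) (Real.cosh t ^ 2) * (2 * Real.cosh t * Real.sinh t) :=
    funext fun t => deriv_jacobiPhi hβ hβα hα l t
  have hs := (Real.sinh_pos_iff.2 ht).ne'
  have hc := (Real.cosh_pos t).ne'
  have h1 := (analyticAt_radialPhi hβ hβα hα l
    (half_lt_cosh_sq t)).deriv.differentiableAt.hasDerivAt
  have h2 := (Real.hasDerivAt_cosh t).pow 2
  have h3 := (HasDerivAt.comp t (h₂ := deriv (radialPhi α β l))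
    (h := fun t => Real.cosh t ^ 2) h1 h2).mul
    (((Real.hasDerivAt_cosh t).const_mul 2).mul (Real.hasDerivAt_sinh t))
  rw [hfun]
  refine h3.congr_deriv ?_
  have hode := radialPhi_ode hβ hβα hα l (half_lt_cosh_sq t)
  simp only [Function.comp, Pi.mul_apply, jacobiPhi_eq_radialPhi, drift, Nat.cast_ofNat,
    Nat.add_one_sub_one, pow_one]
  generalize deriv (deriv (radialPhi α β l)) (Real.cosh t ^ 2) = f2 at *
  generalize deriv (radialPhi α β l) (Real.cosh t ^ 2) = f1 at *
  generalize radialPhi α β l (Real.cosh t ^ 2) = f0 at *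
  have hss : Real.sinh t ^ 2 = Real.cosh t ^ 2 - 1 := by rw [Real.cosh_sq]; ring
  field_simp
  generalize Real.cosh t = C at *
  generalize Real.sinh t = S at *
  linear_combination 4 * hode + (4 * f2 * C ^ 2 + (4 * β + 4) * f1) * hss

end Parameters

/-! ### Joint continuity in the spectral parameter and in `t`; simplicity of zeros. -/

theorem continuous_uncurry_of_dist_le {F : ℝ → ℝ → ℝ} {g : ℝ → ℝ} (hg : Continuous g)
    (hc : ∀ l, Continuous (F l)) (hF : ∀ l μ t, |F l t - F μ t| ≤ |l ^ 2 - μ ^ 2| * g t) :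
    Continuous (Function.uncurry F) := by
  rw [continuous_iff_continuousAt]
  rintro ⟨μ, s⟩
  rw [ContinuousAt, tendsto_iff_dist_tendsto_zero]
  have h : Tendsto (fun p : ℝ × ℝ => |p.1 ^ 2 - μ ^ 2| * g p.2 + |F μ p.2 - F μ s|) (𝓝 (μ, s))
      (𝓝 0) := by
    have hcont : Continuous fun p : ℝ × ℝ =>
        |p.1 ^ 2 - μ ^ 2| * g p.2 + |F μ p.2 - F μ s| := by
      have := hc μ
      fun_prop
    have := hcont.tendsto (μ, s)
    simpa using this
  refine squeeze_zero (fun _ => dist_nonneg) (fun p => ?_) h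
  rw [Real.dist_eq]
  calc |Function.uncurry F p - Function.uncurry F (μ, s)|
      = |(F p.1 p.2 - F μ p.2) + (F μ p.2 - F μ s)| := by simp [Function.uncurry]
    _ ≤ _ := (abs_add_le _ _).trans (add_le_add (hF _ _ _) le_rfl)

section Parameters

variable {α β : ℝ} (hβ : -1 / 2 ≤ β) (hβα : β ≤ α) (hα : -1 / 2 < α)
include hβ hβα hα

theorem sq_jacobiPhi_le (l : ℝ) {t : ℝ} (ht : 0 ≤ t) : jacobiPhi α β l t ^ 2 ≤ Real.exp t := by
  have hκ : 0 < l ^ 2 + (α + β + 1) ^ 2 := by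
    have : 0 < α + β + 1 := by linarith
    positivity
  have h := energy_le (q := drift α β) (f := 0) (u := jacobiPhi α β l)
    (u' := deriv (jacobiPhi α β l)) (δ := 0) (T := t) hκ.le
    (fun s hs => drift_nonneg hβ hα hs.1) (by simp)
    (continuous_jacobiPhi hβ hβα hα l).continuousOn
    (continuous_deriv_jacobiPhi hβ hβα hα l).continuousOn
    (fun s _ => hasDerivAt_jacobiPhi hβ hβα hα l s)
    (fun s hs => by simpa using jacobiPhi_ode hβ hβα hα l hs.1) (t := t) ⟨ht, le_rfl⟩
  rw [deriv_jacobiPhi_zero_right hβ hβα hα, jacobiPhi_zero_right] at h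
  have h2 : (l ^ 2 + (α + β + 1) ^ 2) * jacobiPhi α β l t ^ 2 ≤
      (l ^ 2 + (α + β + 1) ^ 2) * Real.exp t := by nlinarith [sq_nonneg (deriv (jacobiPhi α β l) t)]
  exact le_of_mul_le_mul_left h2 hκ

/-- The difference has zero Cauchy data at 0 and solves the equation of `l` with the forcing term
`-(l² - μ²) φ_μ`, which `sq_jacobiPhi_le` controls. -/
theorem energy_sub_jacobiPhi_le (l μ : ℝ) {t : ℝ} (ht : 0 ≤ t) :
    (deriv (jacobiPhi α β l) t - deriv (jacobiPhi α β μ) t) ^ 2 +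
      (l ^ 2 + (α + β + 1) ^ 2) * (jacobiPhi α β l t - jacobiPhi α β μ t) ^ 2 ≤
      (|l ^ 2 - μ ^ 2| * Real.exp t) ^ 2 := by
  have hκ : 0 ≤ l ^ 2 + (α + β + 1) ^ 2 := by positivity
  have h := energy_le (q := drift α β) (f := fun s => -(l ^ 2 - μ ^ 2) * jacobiPhi α β μ s)
    (u := fun s => jacobiPhi α β l s - jacobiPhi α β μ s)
    (u' := fun s => deriv (jacobiPhi α β l) s - deriv (jacobiPhi α β μ) s)
    (δ := |l ^ 2 - μ ^ 2| * Real.exp (t / 2)) (T := t) hκ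
    (fun s hs => drift_nonneg hβ hα hs.1)
    (fun s hs => by
      rw [mul_pow, mul_pow, sq_abs, neg_sq, ← Real.exp_nat_mul]
      refine mul_le_mul_of_nonneg_left ?_ (sq_nonneg _)
      refine (sq_jacobiPhi_le hβ hβα hα μ hs.1.le).trans (Real.exp_le_exp.2 ?_)
      have := hs.2
      push_cast
      linarith)
    (((continuous_jacobiPhi hβ hβα hα l).sub (continuous_jacobiPhi hβ hβα hα μ)).continuousOn)
    (((continuous_deriv_jacobiPhi hβ hβα hα l).sub
      (continuous_deriv_jacobiPhi hβ hβα hα μ)).continuousOn)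
    (fun s _ => (hasDerivAt_jacobiPhi hβ hβα hα l s).sub (hasDerivAt_jacobiPhi hβ hβα hα μ s))
    (fun s hs => ((jacobiPhi_ode hβ hβα hα l hs.1).sub
      (jacobiPhi_ode hβ hβα hα μ hs.1)).congr_deriv (by ring)) (t := t) ⟨ht, le_rfl⟩
  simp only [deriv_jacobiPhi_zero_right hβ hβα hα, jacobiPhi_zero_right, sub_self] at h
  have e : (|l ^ 2 - μ ^ 2| * Real.exp (t / 2)) ^ 2 * Real.exp t =
      (|l ^ 2 - μ ^ 2| * Real.exp t) ^ 2 := by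
    rw [mul_pow, mul_pow, ← Real.exp_nat_mul, ← Real.exp_nat_mul, mul_assoc, ← Real.exp_add]
    congr 2
    push_cast
    ring
  nlinarith [sq_nonneg (|l ^ 2 - μ ^ 2| * Real.exp (t / 2))]

theorem continuous_uncurry_jacobiPhi :
    Continuous (Function.uncurry (jacobiPhi α β)) := by
  have hρ : 0 < α + β + 1 := by linarith
  refine continuous_uncurry_of_dist_le (g := fun t => Real.exp |t| * (α + β + 1)⁻¹) (by fun_prop)
    (continuous_jacobiPhi hβ hβα hα) fun l μ t => ?_
  have habs : ∀ l, jacobiPhi α β l t = jacobiPhi α β l |t| := by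
    intro l
    rcases abs_choice t with h | h <;> rw [h]
    rw [jacobiPhi_neg]
  rw [habs, habs, ← mul_assoc, ← div_eq_mul_inv, le_div_iff₀ hρ]
  have h := energy_sub_jacobiPhi_le hβ hβα hα l μ (abs_nonneg t)
  refine abs_le_of_sq_le_sq' ?_ (by positivity) |>.2
  rw [mul_pow, sq_abs]
  nlinarith [sq_nonneg (deriv (jacobiPhi α β l) |t| - deriv (jacobiPhi α β μ) |t|),
    mul_nonneg (sq_nonneg l) (sq_nonneg (jacobiPhi α β l |t| - jacobiPhi α β μ |t|))]

theorem continuous_uncurry_deriv_jacobiPhi :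
    Continuous (Function.uncurry fun l => deriv (jacobiPhi α β l)) := by
  refine continuous_uncurry_of_dist_le (g := fun t => Real.exp |t|) (by fun_prop)
    (continuous_deriv_jacobiPhi hβ hβα hα) fun l μ t => ?_
  have habs : |deriv (jacobiPhi α β l) t - deriv (jacobiPhi α β μ) t| =
      |deriv (jacobiPhi α β l) (|t|) - deriv (jacobiPhi α β μ) (|t|)| := by
    rcases abs_choice t with h | h <;> rw [h]
    rw [deriv_jacobiPhi_neg hβ hβα hα, deriv_jacobiPhi_neg hβ hβα hα, ← neg_sub', abs_neg]
  rw [habs]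
  have h := energy_sub_jacobiPhi_le hβ hβα hα l μ (abs_nonneg t)
  refine abs_le_of_sq_le_sq' ?_ (by positivity) |>.2
  rw [sq_abs]
  have : 0 ≤ (l ^ 2 + (α + β + 1) ^ 2) * (jacobiPhi α β l |t| - jacobiPhi α β μ |t|) ^ 2 := by
    positivity
  linarith

/-- Vanishing Cauchy data propagate to the left on each `[s, t]` with `s > 0`, where the drift is
bounded. Letting `s` tend to 0 contradicts `φ_l(0) = 1`. -/
theorem jacobiPhi_ne_zero_or_deriv_ne_zero (l : ℝ) {t : ℝ} (ht : 0 < t) :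
    jacobiPhi α β l t ≠ 0 ∨ deriv (jacobiPhi α β l) t ≠ 0 := by
  by_contra hcon
  push Not at hcon
  obtain ⟨h0, h0'⟩ := hcon
  have hκ : 0 < l ^ 2 + (α + β + 1) ^ 2 := by
    have : 0 < α + β + 1 := by linarith
    positivity
  have hz : ∀ s ∈ Set.Ioo 0 t, jacobiPhi α β l s = 0 := by
    intro s hs
    have hdc : ContinuousOn (drift α β) (Set.Icc s t) := fun x hx =>
      (hasDerivAt_drift α β (hs.1.trans_le hx.1)).continuousAt.continuousWithinAt
    obtain ⟨C, hC⟩ := isCompact_Icc.bddAbove_image hdc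
    have hC' : ∀ x ∈ Set.Icc s t, drift α β x ≤ C := fun x hx => hC ⟨x, hx, rfl⟩
    refine eq_zero_of_cauchy_data_eq_zero (q := drift α β) (u' := deriv (jacobiPhi α β l))
      (C := C) hκ hs.2.le ?_ (fun x hx => hC' x ⟨hx.1.le, hx.2.le⟩)
      (continuous_jacobiPhi hβ hβα hα l).continuousOn
      (continuous_deriv_jacobiPhi hβ hβα hα l).continuousOn
      (fun x _ => hasDerivAt_jacobiPhi hβ hβα hα l x)
      (fun x hx => jacobiPhi_ode hβ hβα hα l (hs.1.trans hx.1)) h0 h0'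
    exact (drift_nonneg hβ hα hs.1).trans (hC' s ⟨le_rfl, hs.2.le⟩)
  have h1 : Tendsto (jacobiPhi α β l) (𝓝[>] 0) (𝓝 (jacobiPhi α β l 0)) :=
    (continuous_jacobiPhi hβ hβα hα l).continuousAt.tendsto.mono_left nhdsWithin_le_nhds
  have h2 : Tendsto (jacobiPhi α β l) (𝓝[>] 0) (𝓝 0) := by
    refine tendsto_const_nhds.congr' ?_
    filter_upwards [Ioo_mem_nhdsGT ht] with s hs
    exact (hz s hs).symm
  have := tendsto_nhds_unique h1 h2
  rw [jacobiPhi_zero_right] at this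
  exact one_ne_zero this

end Parameters

/-! ### Oscillation -/

theorem tendsto_cosh_div_sinh : Tendsto (fun t => Real.cosh t / Real.sinh t) atTop (𝓝 1) := by
  have h : Tendsto (fun t : ℝ => Real.exp (-2 * t)) atTop (𝓝 0) :=
    Real.tendsto_exp_atBot.comp (tendsto_id.const_mul_atTop_of_neg (by norm_num))
  have h2 : Tendsto (fun t : ℝ => (1 + Real.exp (-2 * t)) / (1 - Real.exp (-2 * t))) atTop
      (𝓝 ((1 + 0) / (1 - 0))) := (h.const_add 1).div (h.const_sub 1) (by norm_num)
  simp only [add_zero, sub_zero, div_one] at h2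
  refine h2.congr' ?_
  filter_upwards [eventually_gt_atTop 0] with t ht
  have e : Real.exp (-2 * t) = Real.exp (-t) / Real.exp t := by
    rw [← Real.exp_sub]; congr 1; ring
  have hlt : Real.exp (-t) < Real.exp t := Real.exp_lt_exp.2 (by linarith)
  rw [Real.cosh_eq, Real.sinh_eq, e]
  have h1 : Real.exp t - Real.exp (-t) ≠ 0 := by linarith
  have h3 : Real.exp t ≠ 0 := (Real.exp_pos t).ne'
  field_simp

theorem tendsto_drift (α β : ℝ) : Tendsto (drift α β) atTop (𝓝 (2 * (α + β + 1))) := by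
  have h1 := tendsto_cosh_div_sinh
  have h2 : Tendsto (fun t => Real.sinh t / Real.cosh t) atTop (𝓝 1) := by
    have := h1.inv₀ one_ne_zero
    simpa using this
  have h3 := (h1.const_mul (2 * α + 1)).add (h2.const_mul (2 * β + 1))
  have e : 2 * (α + β + 1) = (2 * α + 1) * 1 + (2 * β + 1) * 1 := by ring
  rw [e]
  exact h3

theorem tendsto_sinh_atTop' : Tendsto Real.sinh atTop atTop :=
  tendsto_atTop_mono' _ ((eventually_ge_atTop 0).mono fun _ ht => Real.self_le_sinh_iff.2 ht)
    tendsto_id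

theorem tendsto_deriv_drift (α β : ℝ) :
    Tendsto (fun t => -(2 * α + 1) / Real.sinh t ^ 2 + (2 * β + 1) / Real.cosh t ^ 2) atTop
      (𝓝 0) := by
  have h1 : Tendsto (fun t => Real.sinh t ^ 2) atTop atTop :=
    (tendsto_pow_atTop two_ne_zero).comp tendsto_sinh_atTop'
  have h2 : Tendsto (fun t => Real.cosh t ^ 2) atTop atTop := by
    refine tendsto_atTop_mono (fun t => ?_) h1
    rw [Real.cosh_sq]; linarith
  have := (h1.const_div_atTop (-(2 * α + 1))).add (h2.const_div_atTop (2 * β + 1))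
  simpa using this

section Parameters

variable {α β : ℝ} (hβ : -1 / 2 ≤ β) (hβα : β ≤ α) (hα : -1 / 2 < α)
include hβ hβα hα

/-- Without zeros, `s = φ'/φ + q/2` (with `q` the drift) solves a Riccati equation `s' = -(s² + X)`.
Since `q → 2ρ` and `q' → 0`, `X` tends to `l²`, so finally `X > (l/2)²`. Then `arctan (s/a) + a t`,
`a = l/2`, decreases, which is impossible on a long interval because the arctangent is bounded. -/
theorem exists_jacobiPhi_eq_zero_gt {l : ℝ} (hl : 0 < l) (T : ℝ) :
    ∃ t > T, jacobiPhi α β l t = 0 := by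
  by_contra hcon
  push Not at hcon
  set a := l / 2 with ha
  have ha0 : 0 < a := by positivity
  have hlim : Tendsto (fun t => (l ^ 2 + (α + β + 1) ^ 2) - drift α β t ^ 2 / 4 -
      (-(2 * α + 1) / Real.sinh t ^ 2 + (2 * β + 1) / Real.cosh t ^ 2) / 2) atTop
      (𝓝 ((l ^ 2 + (α + β + 1) ^ 2) - (2 * (α + β + 1)) ^ 2 / 4 - 0 / 2)) :=
    ((((tendsto_drift α β).pow 2).div_const 4).const_sub _).sub
      ((tendsto_deriv_drift α β).div_const 2)
  have hev := hlim.eventually (lt_mem_nhds (show a ^ 2 < _ by rw [ha]; nlinarith))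
  obtain ⟨S, hS⟩ := eventually_atTop.1 hev
  set R := max (max S T) 0 + 1 with hR
  have hRS : S ≤ R := by rw [hR]; linarith [le_max_left (max S T) 0, le_max_left S T]
  have hRT : T < R := by rw [hR]; linarith [le_max_left (max S T) 0, le_max_right S T]
  have hR0 : 0 < R := by rw [hR]; linarith [le_max_right (max S T) 0]
  set s : ℝ → ℝ := fun t => deriv (jacobiPhi α β l) t / jacobiPhi α β l t + drift α β t / 2 with hs
  have hsd : ∀ t, R ≤ t → HasDerivAt s (-(s t ^ 2 + ((l ^ 2 + (α + β + 1) ^ 2) -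
      drift α β t ^ 2 / 4 -
      (-(2 * α + 1) / Real.sinh t ^ 2 + (2 * β + 1) / Real.cosh t ^ 2) / 2))) t := by
    intro t ht
    have ht0 : 0 < t := hR0.trans_le ht
    have hφ := hcon t (hRT.trans_le ht)
    have h1 := ((jacobiPhi_ode hβ hβα hα l ht0).div (hasDerivAt_jacobiPhi hβ hβα hα l t) hφ).add
      ((hasDerivAt_drift α β ht0).div_const 2)
    refine h1.congr_deriv ?_
    simp only [hs]
    field_simp
    ring
  -- Over this length `a t` grows by `π + 1`, more than the arctangent can fall.
  set b := R + (Real.pi + 1) / a with hb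
  have hRb : R < b := by
    have hpi := Real.pi_pos
    rw [hb]
    exact lt_add_of_pos_right _ (by positivity)
  have hgd : ∀ t, R ≤ t → HasDerivAt (fun t => Real.arctan (s t / a) + a * t) _ t := fun t ht =>
    (((hsd t ht).div_const a).arctan).add ((hasDerivAt_id t).const_mul a)
  have hanti := antitoneOn_of_hasDerivAt_nonpos (a := R) (b := b)
    (fun t ht => (hgd t ht.1).continuousAt.continuousWithinAt) (fun t ht => hgd t ht.1.le)
    (fun t ht => by
      have h1 := hS t (hRS.trans ht.1.le)
      generalize ((l ^ 2 + (α + β + 1) ^ 2) - drift α β t ^ 2 / 4 -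
        (-(2 * α + 1) / Real.sinh t ^ 2 + (2 * β + 1) / Real.cosh t ^ 2) / 2) = X at *
      have h2 : 1 / (1 + (s t / a) ^ 2) * (-(s t ^ 2 + X) / a) + a * 1 =
          a * (a ^ 2 - X) / (a ^ 2 + s t ^ 2) := by
        field_simp
        ring
      rw [h2]
      refine div_nonpos_of_nonpos_of_nonneg ?_ (by positivity)
      nlinarith)
  have hle := hanti ⟨le_rfl, hRb.le⟩ ⟨hRb.le, le_rfl⟩ hRb.le
  have h1 := Real.neg_pi_div_two_lt_arctan (s b / a)
  have h2 := Real.arctan_lt_pi_div_two (s R / a)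
  have h3 : a * b = a * R + (Real.pi + 1) := by rw [hb]; field_simp
  simp only [h3] at hle
  linarith

end Parameters

/-! ### Sturm–Liouville families and the Prüfer angle -/

/-- A family `ψ l` of regular solutions of `(w ψ')' + l² w ψ = 0`, `ψ l 0 = 1`, on the half-line,
with a weight `w` that vanishes at the origin. -/
structure SturmFamily (w : ℝ → ℝ) (ψ : ℝ → ℝ → ℝ) : Prop where
  continuous_weight : Continuous w
  weight_zero : w 0 = 0
  weight_pos : ∀ t, 0 < t → 0 < w t
  analyticAt_weight : ∀ t, 0 < t → AnalyticAt ℝ w t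
  analyticAt : ∀ l t, AnalyticAt ℝ (ψ l) t
  continuous_uncurry : Continuous (Function.uncurry ψ)
  continuous_uncurry_deriv : Continuous (Function.uncurry fun l => deriv (ψ l))
  ode : ∀ l t, 0 < t → HasDerivAt (fun s => w s * deriv (ψ l) s) (-(l ^ 2) * w t * ψ l t) t
  zero_right : ∀ l, ψ l 0 = 1
  zero_left : ∀ t, ψ 0 t = 1
  ne_zero_or : ∀ l t, 0 < t → ψ l t ≠ 0 ∨ deriv (ψ l) t ≠ 0
  exists_zero_gt : ∀ l, 0 < l → ∀ T, ∃ t > T, ψ l t = 0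

/-- The derivative in `s > 0` of the Prüfer angle. -/
noncomputable def pruferRate (w : ℝ → ℝ) (ψ : ℝ → ℝ → ℝ) (l s : ℝ) : ℝ :=
  w |s| * (l ^ 2 * ψ l |s| ^ 2 + deriv (ψ l) |s| ^ 2) /
    (ψ l |s| ^ 2 + (w |s| * deriv (ψ l) |s|) ^ 2)

/-- The Prüfer angle of `ψ l` at `t`. -/
noncomputable def prufer (w : ℝ → ℝ) (ψ : ℝ → ℝ → ℝ) (l t : ℝ) : ℝ :=
  ∫ s in (0 : ℝ)..t, pruferRate w ψ l s

theorem eq_of_hasDerivAt_zero {f : ℝ → ℝ} {t : ℝ} (ht : 0 ≤ t) (hc : ContinuousOn f (Set.Icc 0 t))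
    (hd : ∀ s ∈ Set.Ioo 0 t, HasDerivAt f 0 s) : f t = f 0 := by
  rcases ht.eq_or_lt with rfl | ht
  · rfl
  obtain ⟨s, -, hs⟩ := exists_hasDerivAt_eq_slope f (fun _ => 0) ht hc hd
  have h2 : t - 0 ≠ 0 := by linarith
  have h3 := (eq_div_iff h2).1 hs
  linarith

/-- A continuous function that exceeds each of its values immediately to the right is strictly
increasing. -/
theorem strictMonoOn_Ici_of_eventually_lt {f : ℝ → ℝ} {a : ℝ} (hc : ContinuousOn f (Set.Ici a))
    (h : ∀ x ≥ a, ∀ᶠ y in 𝓝[>] x, f x < f y) : StrictMonoOn f (Set.Ici a) := by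
  intro x hx y _ hxy
  -- The maximum on `[x, y]` can be attained only at `y`, since every earlier value is exceeded a
  -- little further on.
  obtain ⟨z, hz, hmax⟩ := isCompact_Icc.exists_isMaxOn (Set.nonempty_Icc.2 hxy.le)
    (hc.mono (fun s hs => le_trans hx hs.1 : Set.Icc x y ⊆ Set.Ici a))
  have key : ∀ s ∈ Set.Ico x y, ∃ u ∈ Set.Icc x y, f s < f u := by
    intro s hs
    obtain ⟨u, hu, hlt⟩ := ((h s (le_trans hx hs.1)).and (Ioo_mem_nhdsGT hs.2)).exists
    exact ⟨u, ⟨hs.1.trans hlt.1.le, hlt.2.le⟩, hu⟩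
  have hzy : z = y := by
    by_contra hne
    obtain ⟨u, hu, hlt⟩ := key z ⟨hz.1, lt_of_le_of_ne hz.2 hne⟩
    exact absurd (hmax hu) (not_le.2 hlt)
  obtain ⟨u, hu, hlt⟩ := key x ⟨le_rfl, hxy⟩
  have := hmax hu
  rw [hzy] at this
  exact hlt.trans_le this

namespace SturmFamily

variable {w : ℝ → ℝ} {ψ : ℝ → ℝ → ℝ} (S : SturmFamily w ψ)
include S

theorem weight_nonneg {t : ℝ} (ht : 0 ≤ t) : 0 ≤ w t := by
  rcases ht.eq_or_lt with rfl | h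
  · exact S.weight_zero.ge
  · exact (S.weight_pos t h).le

theorem hasDerivAt (l t : ℝ) : HasDerivAt (ψ l) (deriv (ψ l) t) t :=
  (S.analyticAt l t).differentiableAt.hasDerivAt

theorem continuous (l : ℝ) : Continuous (ψ l) :=
  S.continuous_uncurry.comp (by fun_prop : Continuous fun t : ℝ => (l, t))

theorem continuous_deriv (l : ℝ) : Continuous (deriv (ψ l)) :=
  S.continuous_uncurry_deriv.comp (by fun_prop : Continuous fun t : ℝ => (l, t))

theorem modulus_pos (l : ℝ) {t : ℝ} (ht : 0 ≤ t) :
    0 < ψ l t ^ 2 + (w t * deriv (ψ l) t) ^ 2 := by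
  rcases ht.eq_or_lt with rfl | h
  · rw [S.zero_right]; positivity
  · have hw := S.weight_pos t h
    rcases S.ne_zero_or l t h with h1 | h1 <;> positivity

theorem continuous_pruferRate : Continuous (Function.uncurry (pruferRate w ψ)) := by
  have h1 := S.continuous_uncurry
  have h2 := S.continuous_uncurry_deriv
  have hw := S.continuous_weight
  have e : Continuous fun p : ℝ × ℝ => (p.1, |p.2|) := by fun_prop
  have h1' := h1.comp e
  have h2' := h2.comp e
  simp only [Function.comp_def, Function.uncurry] at h1' h2'
  simp only [Function.uncurry_def, pruferRate]
  -- The absolute values in the rate extend it evenly, so the denominator is positive on the whole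
  -- line.
  refine Continuous.div ?_ ?_ fun p => (S.modulus_pos p.1 (abs_nonneg p.2)).ne'
  · fun_prop
  · fun_prop

theorem continuous_prufer_right (l : ℝ) : Continuous (prufer w ψ l) := by
  have h : Continuous (pruferRate w ψ l) :=
    S.continuous_pruferRate.comp (by fun_prop : Continuous fun t : ℝ => (l, t))
  exact intervalIntegral.continuous_primitive (fun a b => h.intervalIntegrable a b) 0

theorem continuous_prufer_left (t : ℝ) : Continuous fun l => prufer w ψ l t :=
  intervalIntegral.continuous_parametric_intervalIntegral_of_continuous' S.continuous_pruferRate 0 t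

theorem hasDerivAt_prufer (l t : ℝ) : HasDerivAt (prufer w ψ l) (pruferRate w ψ l t) t := by
  have h : Continuous (pruferRate w ψ l) :=
    S.continuous_pruferRate.comp (by fun_prop : Continuous fun t : ℝ => (l, t))
  exact intervalIntegral.integral_hasDerivAt_right (h.intervalIntegrable 0 t)
    (h.stronglyMeasurableAtFilter _ _) h.continuousAt

omit S in
theorem prufer_zero_right (l : ℝ) : prufer w ψ l 0 = 0 := intervalIntegral.integral_same

theorem prufer_zero_left (t : ℝ) : prufer w ψ 0 t = 0 := by
  have h : ψ 0 = fun _ => 1 := funext S.zero_left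
  simp [prufer, pruferRate, h]

theorem strictMonoOn_prufer_right {l : ℝ} (hl : 0 < l) :
    StrictMonoOn (prufer w ψ l) (Set.Ici 0) := by
  refine strictMonoOn_of_deriv_pos (convex_Ici 0) (S.continuous_prufer_right l).continuousOn ?_
  intro t ht
  rw [interior_Ici] at ht
  have ht' : 0 < t := ht
  rw [(S.hasDerivAt_prufer l t).deriv, pruferRate, abs_of_pos ht']
  refine div_pos (mul_pos (S.weight_pos t ht') ?_) (S.modulus_pos l ht'.le)
  rcases S.ne_zero_or l t ht' with h | h <;> positivity

/-- Polar coordinates: `(ψ, -w ψ') = R (cos ϑ, sin ϑ)` with `R > 0`. -/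
theorem polar (l : ℝ) {t : ℝ} (ht : 0 ≤ t) : ∃ R > 0, ψ l t = R * Real.cos (prufer w ψ l t) ∧
    w t * deriv (ψ l) t = -(R * Real.sin (prufer w ψ l t)) := by
  set θ := prufer w ψ l with hθ
  set v : ℝ → ℝ := fun s => w s * deriv (ψ l) s with hv
  have hψc := S.continuous l
  have hvc : Continuous v := S.continuous_weight.mul (S.continuous_deriv l)
  have hθc : Continuous θ := S.continuous_prufer_right l
  have hmod : ∀ s, 0 ≤ s → 0 < ψ l s ^ 2 + v s ^ 2 := fun s hs => S.modulus_pos l hs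
  -- This quotient is the squared sine of the difference between `θ` and the true polar angle of
  -- `(ψ, -w ψ')`. The rate is made for its derivative to vanish, and it is 0 at the origin.
  have hSd : ∀ s, 0 < s → HasDerivAt
      (fun s => (ψ l s * Real.sin (θ s) + v s * Real.cos (θ s)) ^ 2 / (ψ l s ^ 2 + v s ^ 2)) 0 s := by
    intro s hs
    have h1 := S.hasDerivAt l s
    have h2 : HasDerivAt v _ s := S.ode l s hs
    have h3 := S.hasDerivAt_prufer l s
    have hm := (hmod s hs.le).ne'
    have h4 := (((h1.mul h3.sin).add (h2.mul h3.cos)).pow 2).div ((h1.pow 2).add (h2.pow 2)) hm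
    refine h4.congr_deriv ?_
    have hw := (S.weight_pos s hs).ne'
    have hr : pruferRate w ψ l s = w s * (l ^ 2 * ψ l s ^ 2 + deriv (ψ l) s ^ 2) /
        (ψ l s ^ 2 + v s ^ 2) := by
      simp only [pruferRate, abs_of_pos hs, hv]
    have hvs : deriv (ψ l) s = v s / w s := by simp only [hv]; field_simp
    simp only [Pi.add_apply, Pi.mul_apply, Pi.pow_apply, hr, ← hθ]
    rw [hvs]
    generalize v s = V at *
    generalize ψ l s = P at *
    generalize w s = W at *
    have hcs := Real.sin_sq_add_cos_sq (θ s)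
    generalize Real.sin (θ s) = sn at *
    generalize Real.cos (θ s) = cs at *
    field_simp
    push_cast
    ring
  have hv0 : v 0 = 0 := by simp [hv, S.weight_zero]
  have hθ0 : θ 0 = 0 := prufer_zero_right l
  have hzero : ∀ s, 0 ≤ s → ψ l s * Real.sin (θ s) + v s * Real.cos (θ s) = 0 := by
    intro s hs
    have hconst := eq_of_hasDerivAt_zero (f := fun s =>
        (ψ l s * Real.sin (θ s) + v s * Real.cos (θ s)) ^ 2 / (ψ l s ^ 2 + v s ^ 2)) hs
      (ContinuousOn.div (by fun_prop) (by fun_prop) fun s hs => (hmod s hs.1).ne')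
      (fun s hs => hSd s hs.1)
    simp only [hv0, hθ0, Real.sin_zero, mul_zero, zero_mul, add_zero, ne_eq, OfNat.ofNat_ne_zero,
      not_false_eq_true, zero_pow, zero_div] at hconst
    have h5 := (div_eq_iff (hmod s hs).ne').1 hconst
    simpa using h5
  -- So far the vector is only parallel to `(cos θ, sin θ)`. Its signed length `C` has no zeros and
  -- is 1 at the origin, which excludes the opposite direction.
  set C : ℝ → ℝ := fun s => ψ l s * Real.cos (θ s) - v s * Real.sin (θ s) with hC
  have hCc : Continuous C := by simp only [hC]; fun_prop
  have hCne : ∀ s, 0 ≤ s → C s ≠ 0 := by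
    intro s hs h0
    have h1 := hzero s hs
    have h2 := hmod s hs
    have h3 : ψ l s ^ 2 + v s ^ 2 = C s ^ 2 +
        (ψ l s * Real.sin (θ s) + v s * Real.cos (θ s)) ^ 2 := by
      have := Real.sin_sq_add_cos_sq (θ s)
      simp only [hC]
      linear_combination (-(ψ l s ^ 2) - v s ^ 2) * this
    rw [h1, h0] at h3
    simp at h3
    linarith
  have hCpos : 0 < C t := by
    by_contra hneg
    push Not at hneg
    have hC0 : C 0 = 1 := by simp [hC, hv0, hθ0, S.zero_right]
    obtain ⟨s, hs, hs0⟩ := intermediate_value_Icc' ht hCc.continuousOn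
      (show (0 : ℝ) ∈ Set.Icc (C t) (C 0) from ⟨hneg, by rw [hC0]; norm_num⟩)
    exact hCne s hs.1 hs0
  have h1 := hzero t ht
  have h2 := Real.sin_sq_add_cos_sq (θ t)
  refine ⟨C t, hCpos, ?_, ?_⟩
  · simp only [hC]
    linear_combination (-(ψ l t)) * h2 + Real.sin (θ t) * h1
  · change v t = _
    simp only [hC]
    linear_combination (-(v t)) * h2 + Real.cos (θ t) * h1

/-- The Wronskian identity. -/
theorem wronskian (l μ : ℝ) {t : ℝ} (ht : 0 ≤ t) :
    w t * deriv (ψ l) t * ψ μ t - ψ l t * (w t * deriv (ψ μ) t) =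
      (μ ^ 2 - l ^ 2) * ∫ s in (0 : ℝ)..t, w s * (ψ l s * ψ μ s) := by
  have hc : Continuous fun s => w s * (ψ l s * ψ μ s) :=
    S.continuous_weight.mul ((S.continuous l).mul (S.continuous μ))
  have hw := S.continuous_weight
  have h1 := S.continuous l
  have h2 := S.continuous μ
  have h3 := S.continuous_deriv l
  have h4 := S.continuous_deriv μ
  have h := intervalIntegral.integral_eq_sub_of_hasDerivAt_of_le ht
    (f := fun t => w t * deriv (ψ l) t * ψ μ t - ψ l t * (w t * deriv (ψ μ) t))
    (f' := fun s => (μ ^ 2 - l ^ 2) * (w s * (ψ l s * ψ μ s))) (by fun_prop)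
    (fun s hs => (((S.ode l s hs.1).mul (S.hasDerivAt μ s)).sub
      ((S.hasDerivAt l s).mul (S.ode μ s hs.1))).congr_deriv (by ring))
    ((hc.const_mul _).intervalIntegrable _ _)
  rw [intervalIntegral.integral_const_mul] at h
  rw [h]
  simp [S.weight_zero]

/-- In polar form the Wronskian of `ψ μ` and `ψ l` is a positive multiple of `sin (ϑ_l - ϑ_μ)`. For
`μ > l` near `l` it is negative, because the integral is close to that of `w ψ_l²`. By continuity
`ϑ_μ > ϑ_l - π`, so `ϑ_μ ≤ ϑ_l` would make the sine nonnegative. -/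
theorem eventually_prufer_lt (l : ℝ) (hl : 0 ≤ l) {t : ℝ} (ht : 0 < t) :
    ∀ᶠ μ in 𝓝[>] l, prufer w ψ l t < prufer w ψ μ t := by
  have hw := S.continuous_weight
  have hψ := S.continuous_uncurry
  have hc : Continuous (Function.uncurry fun μ s => w s * (ψ μ s * ψ l s)) := by
    have h1 := hψ
    have h2 : Continuous fun p : ℝ × ℝ => ψ l p.2 := (S.continuous l).comp continuous_snd
    simp only [Function.uncurry_def] at h1 ⊢
    fun_prop
  have hI : Continuous fun μ => ∫ s in (0 : ℝ)..t, w s * (ψ μ s * ψ l s) :=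
    intervalIntegral.continuous_parametric_intervalIntegral_of_continuous' hc 0 t
  have hpos : 0 < ∫ s in (0 : ℝ)..t, w s * (ψ l s * ψ l s) := by
    have h1 := S.continuous l
    refine intervalIntegral.integral_pos ht (by fun_prop)
      (fun s hs => mul_nonneg (S.weight_nonneg hs.1.le) (mul_self_nonneg _)) ?_
    have hev : ∀ᶠ s in 𝓝[>] (0 : ℝ), 0 < ψ l s :=
      nhdsWithin_le_nhds (h1.continuousAt.eventually (lt_mem_nhds (by rw [S.zero_right]; norm_num)))
    obtain ⟨s, hs, hs'⟩ := (hev.and (Ioo_mem_nhdsGT ht)).exists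
    exact ⟨s, ⟨hs'.1.le, hs'.2.le⟩, mul_pos (S.weight_pos s hs'.1) (mul_pos hs hs)⟩
  have e1 := nhdsWithin_le_nhds (s := Set.Ioi l) (hI.continuousAt.eventually (lt_mem_nhds hpos))
  have e2 := nhdsWithin_le_nhds (s := Set.Ioi l) ((S.continuous_prufer_left t).continuousAt.eventually
    (lt_mem_nhds (show prufer w ψ l t - Real.pi < _ by linarith [Real.pi_pos])))
  filter_upwards [e1, e2, self_mem_nhdsWithin] with μ h1 h2 hμ
  by_contra hle
  push Not at hle
  obtain ⟨R, hR, a1, a2⟩ := S.polar l ht.le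
  obtain ⟨Q, hQ, b1, b2⟩ := S.polar μ ht.le
  have hW := S.wronskian μ l ht.le
  rw [a1, a2, b1, b2] at hW
  have hs : 0 ≤ Real.sin (prufer w ψ l t - prufer w ψ μ t) :=
    Real.sin_nonneg_of_nonneg_of_le_pi (by linarith) (by linarith)
  rw [Real.sin_sub] at hs
  have hlμ : l < μ := hμ
  have h3 : (l ^ 2 - μ ^ 2) * ∫ s in (0 : ℝ)..t, w s * (ψ μ s * ψ l s) < 0 :=
    mul_neg_of_neg_of_pos (by nlinarith) h1
  rw [← hW] at h3
  have h4 := mul_nonneg (mul_pos hR hQ).le hs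
  linarith

theorem strictMonoOn_prufer_left {t : ℝ} (ht : 0 < t) :
    StrictMonoOn (fun l => prufer w ψ l t) (Set.Ici 0) :=
  strictMonoOn_Ici_of_eventually_lt (S.continuous_prufer_left t).continuousOn
    fun l hl => S.eventually_prufer_lt l hl ht

theorem prufer_pos {l t : ℝ} (hl : 0 < l) (ht : 0 < t) : 0 < prufer w ψ l t := by
  have := S.strictMonoOn_prufer_right hl (Set.mem_Ici.2 le_rfl) (Set.mem_Ici.2 ht.le) ht
  rwa [prufer_zero_right] at this

theorem eq_zero_iff_cos (l : ℝ) {t : ℝ} (ht : 0 ≤ t) :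
    ψ l t = 0 ↔ Real.cos (prufer w ψ l t) = 0 := by
  obtain ⟨R, hR, h1, -⟩ := S.polar l ht
  rw [h1]
  simp [hR.ne']

theorem deriv_eq_zero_iff_sin (l : ℝ) {t : ℝ} (ht : 0 < t) :
    deriv (ψ l) t = 0 ↔ Real.sin (prufer w ψ l t) = 0 := by
  obtain ⟨R, hR, -, h1⟩ := S.polar l ht.le
  have hw := (S.weight_pos t ht).ne'
  constructor
  · intro h
    rw [h] at h1
    simpa [hR.ne'] using h1
  · intro h
    rw [h] at h1
    simpa [hw] using h1

end SturmFamily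

/-! ### Counting zeros -/

/-- The zeros of `g` are the points where the increasing function `f` meets a level. Since `f`
starts below the lowest level and is continuous, no level below its current value is skipped, so
counting zeros is counting levels. -/
theorem isNthPosZero_iff {f g : ℝ → ℝ} {u : ℕ → ℝ} (hf : ContinuousOn f (Set.Ici 0))
    (hmono : StrictMonoOn f (Set.Ici 0)) (hu : StrictMono u)
    (hg : ∀ y, 0 < y → (g y = 0 ↔ ∃ k, f y = u k)) (h0 : f 0 < u 0) (k : ℕ) (x : ℝ) :
    IsNthPosZero g (k + 1) x ↔ 0 < x ∧ f x = u k := by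
  have count : ∀ (x : ℝ) (k : ℕ), 0 < x → f x = u k →
      {y : ℝ | 0 < y ∧ y ≤ x ∧ g y = 0}.encard = (k + 1 : ℕ) := by
    intro x k hx hfx
    have hex : ∀ j : ℕ, ∃ y, j ≤ k → 0 < y ∧ y ≤ x ∧ f y = u j := by
      intro j
      by_cases hj : j ≤ k
      · have hle : u j ≤ f x := by rw [hfx]; exact hu.monotone hj
        have hge : f 0 < u j := h0.trans_le (hu.monotone (Nat.zero_le j))
        obtain ⟨y, hy, hfy⟩ := intermediate_value_Icc hx.le (hf.mono Set.Icc_subset_Ici_self)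
          ⟨hge.le, hle⟩
        refine ⟨y, fun _ => ⟨lt_of_le_of_ne hy.1 ?_, hy.2, hfy⟩⟩
        rintro rfl
        exact hge.ne hfy
      · exact ⟨0, fun h => absurd h hj⟩
    choose y hy using hex
    have hset : {z : ℝ | 0 < z ∧ z ≤ x ∧ g z = 0} = y '' (Finset.range (k + 1) : Set ℕ) := by
      ext z
      constructor
      · rintro ⟨hz, hzx, hgz⟩
        obtain ⟨j, hj⟩ := (hg z hz).1 hgz
        have hjk : j ≤ k := by
          rw [← hu.le_iff_le, ← hj, ← hfx]
          exact hmono.monotoneOn hz.le hx.le hzx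
        refine ⟨j, by simpa using Nat.lt_succ_of_le hjk, ?_⟩
        obtain ⟨h1, -, h3⟩ := hy j hjk
        exact hmono.injOn h1.le hz.le (h3.trans hj.symm)
      · rintro ⟨j, hj, rfl⟩
        obtain ⟨h1, h2, h3⟩ := hy j (Nat.lt_succ_iff.1 (by simpa using hj))
        exact ⟨h1, h2, (hg _ h1).2 ⟨j, h3⟩⟩
    have hinj : Set.InjOn y (Finset.range (k + 1) : Set ℕ) := by
      intro i hi j hj hij
      have h1 := (hy i (Nat.lt_succ_iff.1 (by simpa using hi))).2.2
      have h2 := (hy j (Nat.lt_succ_iff.1 (by simpa using hj))).2.2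
      rw [hij] at h1
      exact hu.injective (h1.symm.trans h2)
    rw [hset, hinj.encard_image, Set.encard_coe_eq_coe_finsetCard, Finset.card_range]
  constructor
  · rintro ⟨hx, hgx, hcard⟩
    obtain ⟨j, hj⟩ := (hg x hx).1 hgx
    have h1 := count x j hx hj
    rw [h1] at hcard
    have h2 : j + 1 = k + 1 := by exact_mod_cast hcard
    have h3 : j = k := by omega
    exact ⟨hx, h3 ▸ hj⟩
  · rintro ⟨hx, hfx⟩
    exact ⟨hx, (hg x hx).2 ⟨k, hfx⟩, count x k hx hfx⟩

theorem nthPosZero_eq {f : ℝ → ℝ} {k : ℕ} {x : ℝ} (h : ∀ y, IsNthPosZero f k y ↔ y = x) :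
    nthPosZero f k = x := by
  have : {y | IsNthPosZero f k y} = {x} := Set.ext h
  rw [nthPosZero, this, csInf_singleton]

theorem cos_eq_zero_iff_of_nonneg {x : ℝ} (hx : 0 ≤ x) :
    Real.cos x = 0 ↔ ∃ k : ℕ, x = (k + 1 / 2) * Real.pi := by
  rw [Real.cos_eq_zero_iff]
  constructor
  · rintro ⟨k, hk⟩
    have hk0 : 0 ≤ k := by
      by_contra hneg
      push Not at hneg
      have : (k : ℝ) ≤ -1 := by exact_mod_cast Int.le_sub_one_of_lt hneg
      nlinarith [Real.pi_pos]
    lift k to ℕ using hk0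
    exact ⟨k, by rw [hk]; push_cast; ring⟩
  · rintro ⟨k, hk⟩
    exact ⟨k, by rw [hk]; push_cast; ring⟩

theorem sin_eq_zero_iff_of_pos {x : ℝ} (hx : 0 < x) :
    Real.sin x = 0 ↔ ∃ k : ℕ, x = (k + 1) * Real.pi := by
  rw [Real.sin_eq_zero_iff]
  constructor
  · rintro ⟨k, hk⟩
    have hk0 : 0 < k := by
      by_contra hneg
      push Not at hneg
      have : (k : ℝ) ≤ 0 := by exact_mod_cast hneg
      nlinarith [Real.pi_pos]
    obtain ⟨n, rfl⟩ := Int.eq_succ_of_zero_lt hk0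
    exact ⟨n, by rw [← hk]; push_cast; ring⟩
  · rintro ⟨k, hk⟩
    exact ⟨k + 1, by rw [hk]; push_cast; ring⟩

theorem strictMono_nat_add_mul_pi (c : ℝ) : StrictMono fun k : ℕ => (k + c) * Real.pi := by
  intro i j hij
  have : (i : ℝ) < j := by exact_mod_cast hij
  exact mul_lt_mul_of_pos_right (by linarith) Real.pi_pos

namespace SturmFamily

variable {w : ℝ → ℝ} {ψ : ℝ → ℝ → ℝ} (S : SturmFamily w ψ)
include S

theorem prufer_nonneg {l t : ℝ} (hl : 0 < l) (ht : 0 ≤ t) : 0 ≤ prufer w ψ l t := by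
  rcases ht.eq_or_lt with rfl | h
  · rw [prufer_zero_right]
  · exact (S.prufer_pos hl h).le

theorem isNthPosZero_left {t : ℝ} (ht : 0 < t) (k : ℕ) (l : ℝ) :
    IsNthPosZero (fun μ => ψ μ t) (k + 1) l ↔ 0 < l ∧ prufer w ψ l t = (k + 1 / 2) * Real.pi := by
  refine isNthPosZero_iff (S.continuous_prufer_left t).continuousOn
    (S.strictMonoOn_prufer_left ht) (strictMono_nat_add_mul_pi (1 / 2)) (fun l hl => ?_) ?_ k l
  · rw [S.eq_zero_iff_cos l ht.le, cos_eq_zero_iff_of_nonneg (S.prufer_nonneg hl ht.le)]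
  · rw [S.prufer_zero_left]
    have := Real.pi_pos
    positivity

/-- The level 0 is attained at `l = 0`, which is not a positive zero, so the levels begin at `π`. -/
theorem isNthPosZero_deriv_left {t : ℝ} (ht : 0 < t) (k : ℕ) (l : ℝ) :
    IsNthPosZero (fun μ => deriv (ψ μ) t) (k + 1) l ↔
      0 < l ∧ prufer w ψ l t = (k + 1) * Real.pi := by
  refine isNthPosZero_iff (S.continuous_prufer_left t).continuousOn
    (S.strictMonoOn_prufer_left ht) (strictMono_nat_add_mul_pi 1) (fun l hl => ?_) ?_ k l
  · rw [S.deriv_eq_zero_iff_sin l ht, sin_eq_zero_iff_of_pos (S.prufer_pos hl ht)]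
  · rw [S.prufer_zero_left]
    have := Real.pi_pos
    positivity

/-- A set of zeros of `ψ l` in `(0, τ]` has at most `m` elements if the angle at `τ` is less than
`(m + 1/2) π`. -/
theorem card_zeros_le {l τ : ℝ} (hl : 0 < l) {m : ℕ}
    (hτ : prufer w ψ l τ < (m + 1 / 2) * Real.pi) {s : Finset ℝ}
    (hs : ∀ t ∈ s, 0 < t ∧ t ≤ τ ∧ ψ l t = 0) : s.card ≤ m := by
  have hex : ∀ t : ℝ, ∃ k : ℕ, t ∈ s → prufer w ψ l t = (k + 1 / 2) * Real.pi := by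
    intro t
    by_cases ht : t ∈ s
    · obtain ⟨h1, -, h3⟩ := hs t ht
      rw [S.eq_zero_iff_cos l h1.le, cos_eq_zero_iff_of_nonneg (S.prufer_nonneg hl h1.le)] at h3
      exact h3.imp fun k hk _ => hk
    · exact ⟨0, fun h => absurd h ht⟩
  choose k hk using hex
  have hmaps : ∀ t ∈ s, k t ∈ Finset.range m := by
    intro t ht
    obtain ⟨h1, h2, -⟩ := hs t ht
    have h4 := (S.strictMonoOn_prufer_right hl).monotoneOn h1.le (h1.le.trans h2) h2
    rw [hk t ht] at h4
    have h5 := lt_of_mul_lt_mul_right (h4.trans_lt hτ) Real.pi_pos.le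
    have h6 : (k t : ℝ) < m := by linarith
    simpa using h6
  have hinj : Set.InjOn k s := by
    intro x hx y hy hxy
    have h1 := hk x hx
    have h2 := hk y hy
    rw [hxy] at h1
    exact (S.strictMonoOn_prufer_right hl).injOn (hs x hx).1.le (hs y hy).1.le (h1.trans h2.symm)
  simpa using Finset.card_le_card_of_injOn k hmaps hinj

/-- At zeros of `ψ l` the angle is an odd multiple of `π/2`, so it rises by at least `π` from one
zero to a later one. -/
theorem exists_prufer_ge {l : ℝ} (hl : 0 < l) (n : ℕ) : ∃ t > 0, n * Real.pi ≤ prufer w ψ l t := by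
  induction n with
  | zero => exact ⟨1, one_pos, by simpa using S.prufer_nonneg hl zero_le_one⟩
  | succ n ih =>
    obtain ⟨t, ht, hn⟩ := ih
    obtain ⟨t₁, h1, z1⟩ := S.exists_zero_gt l hl t
    obtain ⟨t₂, h2, z2⟩ := S.exists_zero_gt l hl t₁
    have p1 : 0 < t₁ := ht.trans h1
    have p2 : 0 < t₂ := p1.trans h2
    have hm := S.strictMonoOn_prufer_right hl
    have m1 := hm ht.le p1.le h1
    have m2 := hm p1.le p2.le h2
    rw [S.eq_zero_iff_cos l p1.le, cos_eq_zero_iff_of_nonneg (S.prufer_nonneg hl p1.le)] at z1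
    rw [S.eq_zero_iff_cos l p2.le, cos_eq_zero_iff_of_nonneg (S.prufer_nonneg hl p2.le)] at z2
    obtain ⟨k1, e1⟩ := z1
    obtain ⟨k2, e2⟩ := z2
    have hk : (k1 : ℝ) + 1 ≤ k2 := by
      rw [e1, e2] at m2
      have := lt_of_mul_lt_mul_right m2 Real.pi_pos.le
      have h3 : (k1 : ℝ) < k2 := by linarith
      exact_mod_cast h3
    refine ⟨t₂, p2, ?_⟩
    rw [e2]
    rw [e1] at m1
    push_cast
    nlinarith [Real.pi_pos]

theorem exists_prufer_eq {l x : ℝ} (hl : 0 < l) (hx : 0 < x) : ∃ t > 0, prufer w ψ l t = x := by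
  obtain ⟨n, hn⟩ := exists_nat_ge (x / Real.pi)
  obtain ⟨T, hT, hTn⟩ := S.exists_prufer_ge hl n
  have hxT : x ≤ prufer w ψ l T := by
    refine le_trans ?_ hTn
    rwa [← div_le_iff₀ Real.pi_pos]
  obtain ⟨t, ht, hte⟩ := intermediate_value_Icc hT.le (S.continuous_prufer_right l).continuousOn
    (show x ∈ Set.Icc (prufer w ψ l 0) (prufer w ψ l T) from ⟨by rw [prufer_zero_right]; exact hx.le, hxT⟩)
  refine ⟨t, lt_of_le_of_ne ht.1 ?_, hte⟩
  rintro rfl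
  rw [prufer_zero_right] at hte
  exact hx.ne hte

theorem exists_prufer_left_eq {l t x : ℝ} (hl : 0 < l) (hx : 0 < x)
    (hxl : x ≤ prufer w ψ l t) : ∃ μ > 0, μ ≤ l ∧ prufer w ψ μ t = x := by
  obtain ⟨μ, hμ, he⟩ := intermediate_value_Icc hl.le (S.continuous_prufer_left t).continuousOn
    (show x ∈ Set.Icc (prufer w ψ 0 t) (prufer w ψ l t) from
      ⟨by rw [S.prufer_zero_left]; exact hx.le, hxl⟩)
  refine ⟨μ, lt_of_le_of_ne hμ.1 ?_, hμ.2, he⟩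
  rintro rfl
  exact hx.ne ((S.prufer_zero_left t).symm.trans he)

end SturmFamily

/-! ### Rolle's theorem along sequences of zeros -/

/-- `f` has at least `q` distinct zeros in `(0, τ)`. -/
def HasZerosIoo (f : ℝ → ℝ) (τ : ℝ) (q : ℕ) : Prop :=
  ∃ x : ℕ → ℝ, (∀ i, i + 1 < q → x i < x (i + 1)) ∧ ∀ i < q, 0 < x i ∧ x i < τ ∧ f (x i) = 0

/-- `f` has at least `q` distinct zeros in `(0, τ]`. -/
def HasZerosIoc (f : ℝ → ℝ) (τ : ℝ) (q : ℕ) : Prop :=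
  ∃ x : ℕ → ℝ, (∀ i, i + 1 < q → x i < x (i + 1)) ∧ ∀ i < q, 0 < x i ∧ x i ≤ τ ∧ f (x i) = 0

theorem HasZerosIoo.hasZerosIoc {f : ℝ → ℝ} {τ : ℝ} {q : ℕ} (h : HasZerosIoo f τ q) :
    HasZerosIoc f τ q := by
  obtain ⟨x, h1, h2⟩ := h
  exact ⟨x, h1, fun i hi => ⟨(h2 i hi).1, (h2 i hi).2.1.le, (h2 i hi).2.2⟩⟩

theorem HasZerosIoo.append {f : ℝ → ℝ} {τ : ℝ} {q : ℕ} (hτ : 0 < τ) (h : HasZerosIoo f τ q)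
    (h0 : f τ = 0) : HasZerosIoc f τ (q + 1) := by
  obtain ⟨x, h1, h2⟩ := h
  refine ⟨fun i => if i < q then x i else τ, fun i hi => ?_, fun i hi => ?_⟩
  · have hiq : i < q := by omega
    simp only [hiq, if_true]
    split_ifs with h3
    · exact h1 i h3
    · exact (h2 i hiq).2.1
  · by_cases hiq : i < q
    · simp only [hiq, if_true]
      exact ⟨(h2 i hiq).1, (h2 i hiq).2.1.le, (h2 i hiq).2.2⟩
    · simp only [hiq, if_false]
      exact ⟨hτ, le_rfl, h0⟩

theorem exists_rolle_sequence {f f' : ℝ → ℝ} (hf : Continuous f)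
    (hd : ∀ t, 0 < t → HasDerivAt f (f' t) t) {y : ℕ → ℝ} {q : ℕ} (hy0 : ∀ i ≤ q, 0 ≤ y i)
    (hy : ∀ i < q, y i < y (i + 1)) (hz : ∀ i ≤ q, f (y i) = 0) :
    ∃ z : ℕ → ℝ, ∀ i < q, y i < z i ∧ z i < y (i + 1) ∧ f' (z i) = 0 := by
  have hex : ∀ i, ∃ z, i < q → y i < z ∧ z < y (i + 1) ∧ f' z = 0 := by
    intro i
    by_cases hi : i < q
    · obtain ⟨z, hz1, hz2⟩ := exists_hasDerivAt_eq_zero (hy i hi) hf.continuousOn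
        ((hz i hi.le).trans (hz (i + 1) hi).symm)
        (fun t ht => hd t ((hy0 i hi.le).trans_lt ht.1))
      exact ⟨z, fun _ => ⟨hz1.1, hz1.2, hz2⟩⟩
    · exact ⟨0, fun h => absurd h hi⟩
  choose z hz using hex
  exact ⟨z, hz⟩

section Rolle

variable {w h h' g : ℝ → ℝ} {τ : ℝ} {q : ℕ} (hwc : Continuous w) (hw0 : w 0 = 0)
  (hw : ∀ t, 0 < t → 0 < w t) (hhc : Continuous h) (hh'c : Continuous h')
  (hd : ∀ t, 0 < t → HasDerivAt h (h' t) t)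
  (hv : ∀ t, 0 < t → HasDerivAt (fun s => w s * h' s) (-(w t * g t)) t)
include hwc hw0 hw hhc hh'c hd hv

/-- The step from `h` to `h'` costs one zero. The origin is a further zero of `w h'`, as `w 0 = 0`,
and pays for the second application of Rolle's theorem; it is entry 0 of the sequence `y`. -/
theorem HasZerosIoc.rolle (hz : HasZerosIoc h τ (q + 1)) : HasZerosIoo g τ q := by
  obtain ⟨x, hx1, hx2⟩ := hz
  obtain ⟨z, hz⟩ := exists_rolle_sequence hhc hd (y := x) (q := q)
    (fun i hi => (hx2 i (by omega)).1.le) (fun i hi => hx1 i (by omega))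
    (fun i hi => (hx2 i (by omega)).2.2)
  have hz0 : ∀ i < q, 0 < z i := fun i hi => (hx2 i (by omega)).1.trans (hz i hi).1
  have hzτ : ∀ i < q, z i < τ := fun i hi => (hz i hi).2.1.trans_le (hx2 (i + 1) (by omega)).2.1
  have hzs : ∀ i, i + 1 < q → z i < z (i + 1) := fun i hi =>
    (hz i (by omega)).2.1.trans (hz (i + 1) hi).1
  obtain ⟨u, hu⟩ := exists_rolle_sequence (hwc.mul hh'c) hv (q := q)
    (y := fun i => Nat.casesOn i 0 z)
    (fun i hi => by
      rcases i with _ | i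
      · exact le_rfl
      · exact (hz0 i (by omega)).le)
    (fun i hi => by
      rcases i with _ | i
      · exact hz0 0 hi
      · exact hzs i hi)
    (fun i hi => by
      rcases i with _ | i
      · simp [hw0]
      · simp [(hz i (by omega)).2.2])
  have hpos : ∀ i < q, 0 < u i := by
    intro i hi
    have := (hu i hi).1
    rcases i with _ | i
    · exact this
    · exact (hz0 i (by omega)).trans this
  refine ⟨u, fun i hi => (hu i (by omega)).2.1.trans (hu (i + 1) hi).1, fun i hi =>
    ⟨hpos i hi, (hu i hi).2.1.trans (hzτ i hi), ?_⟩⟩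
  have h1 := (hu i hi).2.2
  have h2 := hw _ (hpos i hi)
  simpa [h2.ne'] using h1

/-- Compared with `HasZerosIoc.rolle`, the endpoint `τ` is one more zero of `w h'`, so no zero is
lost. When `τ` is itself one of the zeros of `h`, the number of interior zeros grows by one. -/
theorem HasZerosIoc.rolle_of_deriv_eq_zero (hτ : 0 < τ) (h'τ : h' τ = 0)
    (hz : HasZerosIoc h τ (q + 1)) :
    HasZerosIoo g τ (q + 1) := by
  obtain ⟨x, hx1, hx2⟩ := hz
  obtain ⟨z, hz⟩ := exists_rolle_sequence hhc hd (y := x) (q := q)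
    (fun i hi => (hx2 i (by omega)).1.le) (fun i hi => hx1 i (by omega))
    (fun i hi => (hx2 i (by omega)).2.2)
  have hz0 : ∀ i < q, 0 < z i := fun i hi => (hx2 i (by omega)).1.trans (hz i hi).1
  have hzτ : ∀ i < q, z i < τ := fun i hi => (hz i hi).2.1.trans_le (hx2 (i + 1) (by omega)).2.1
  have hzs : ∀ i, i + 1 < q → z i < z (i + 1) := fun i hi =>
    (hz i (by omega)).2.1.trans (hz (i + 1) hi).1
  set y : ℕ → ℝ := fun i => Nat.casesOn i 0 fun i => if i < q then z i else τ with hy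
  have hyS : ∀ i, y (i + 1) = if i < q then z i else τ := fun i => rfl
  have hy0 : y 0 = 0 := rfl
  have hySpos : ∀ i, 0 < y (i + 1) := by
    intro i
    rw [hyS]
    split_ifs with h
    · exact hz0 i h
    · exact hτ
  have hySle : ∀ i, y (i + 1) ≤ τ := by
    intro i
    rw [hyS]
    split_ifs with h
    · exact (hzτ i h).le
    · exact le_rfl
  obtain ⟨u, hu⟩ := exists_rolle_sequence (hwc.mul hh'c) hv (q := q + 1) (y := y)
    (fun i hi => by
      rcases i with _ | i
      · exact le_rfl
      · exact (hySpos i).le)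
    (fun i hi => by
      rcases i with _ | i
      · exact hySpos 0
      · have hiq : i < q := by omega
        rw [hyS, hyS, if_pos hiq]
        split_ifs with h
        · exact hzs i h
        · exact hzτ i hiq)
    (fun i hi => by
      rcases i with _ | i
      · simp [hy0, hw0]
      · simp only [Pi.mul_apply]
        rw [hyS]
        split_ifs with h
        · rw [(hz i h).2.2, mul_zero]
        · rw [h'τ, mul_zero])
  have hpos : ∀ i < q + 1, 0 < u i := by
    intro i hi
    have := (hu i hi).1
    rcases i with _ | i
    · exact this
    · exact (hySpos i).trans this
  refine ⟨u, fun i hi => (hu i (by omega)).2.1.trans (hu (i + 1) hi).1, fun i hi =>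
    ⟨hpos i hi, (hu i hi).2.1.trans_le (hySle i), ?_⟩⟩
  have h1 := (hu i hi).2.2
  have h2 := hw _ (hpos i hi)
  simpa [h2.ne'] using h1

end Rolle

/-! ### Linear combinations of a Sturm–Liouville family -/

/-- The image under the `k`-th power of `f ↦ -(w f')' / w` of the combination `∑ cᵢ ψ_{μᵢ}`. -/
noncomputable def combination (ψ : ℝ → ℝ → ℝ) (s : Finset ℕ) (c μ : ℕ → ℝ) (k : ℕ) (t : ℝ) : ℝ :=
  ∑ i ∈ s, c i * (μ i ^ 2) ^ k * ψ (μ i) t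

namespace SturmFamily

variable {w : ℝ → ℝ} {ψ : ℝ → ℝ → ℝ} (S : SturmFamily w ψ) (s : Finset ℕ) (c μ : ℕ → ℝ)
include S

theorem analyticAt_combination (k : ℕ) (t : ℝ) : AnalyticAt ℝ (combination ψ s c μ k) t := by
  have h : combination ψ s c μ k = fun t => ∑ i ∈ s, c i * (μ i ^ 2) ^ k * ψ (μ i) t := rfl
  rw [h]
  exact Finset.analyticAt_fun_sum s fun i _ => analyticAt_const.mul (S.analyticAt _ _)

theorem deriv_combination (k : ℕ) (t : ℝ) : deriv (combination ψ s c μ k) t =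
    ∑ i ∈ s, c i * (μ i ^ 2) ^ k * deriv (ψ (μ i)) t :=
  (HasDerivAt.fun_sum fun i _ => (S.hasDerivAt (μ i) t).const_mul _).deriv

theorem continuous_combination (k : ℕ) : Continuous (combination ψ s c μ k) :=
  continuous_iff_continuousAt.2 fun t => (S.analyticAt_combination s c μ k t).continuousAt

theorem continuous_deriv_combination (k : ℕ) : Continuous (deriv (combination ψ s c μ k)) :=
  continuous_iff_continuousAt.2 fun t => (S.analyticAt_combination s c μ k t).deriv.continuousAt

theorem hasDerivAt_combination (k : ℕ) (t : ℝ) :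
    HasDerivAt (combination ψ s c μ k) (deriv (combination ψ s c μ k) t) t :=
  (S.analyticAt_combination s c μ k t).differentiableAt.hasDerivAt

theorem ode_combination (k : ℕ) (t : ℝ) (ht : 0 < t) :
    HasDerivAt (fun x => w x * deriv (combination ψ s c μ k) x)
      (-(w t * combination ψ s c μ (k + 1) t)) t := by
  have h := HasDerivAt.fun_sum fun i (_ : i ∈ s) =>
    (S.ode (μ i) t ht).const_mul (c i * (μ i ^ 2) ^ k)
  have e : (fun x => w x * deriv (combination ψ s c μ k) x) =
      fun x => ∑ i ∈ s, c i * (μ i ^ 2) ^ k * (w x * deriv (ψ (μ i)) x) := by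
    funext x
    rw [S.deriv_combination, Finset.mul_sum]
    exact Finset.sum_congr rfl fun i _ => by ring
  rw [e]
  refine h.congr_deriv ?_
  rw [combination, Finset.mul_sum, ← Finset.sum_neg_distrib]
  exact Finset.sum_congr rfl fun i _ => by ring

/-- The zero at `τ` makes up for the one that Rolle's theorem loses. -/
theorem hasZerosIoo_combination_succ {τ : ℝ} {q k : ℕ} (hτ : 0 < τ)
    (h0 : combination ψ s c μ k τ = 0) (hz : HasZerosIoo (combination ψ s c μ k) τ q) :
    HasZerosIoo (combination ψ s c μ (k + 1)) τ q :=
  (hz.append hτ h0).rolle S.continuous_weight S.weight_zero S.weight_pos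
    (S.continuous_combination s c μ k) (S.continuous_deriv_combination s c μ k)
    (fun t _ => S.hasDerivAt_combination s c μ k t) (S.ode_combination s c μ k)

theorem hasZerosIoo_combination_succ_of_deriv {τ : ℝ} {q k : ℕ} (hτ : 0 < τ)
    (h0' : deriv (combination ψ s c μ k) τ = 0)
    (hz : HasZerosIoc (combination ψ s c μ k) τ (q + 1)) :
    HasZerosIoo (combination ψ s c μ (k + 1)) τ (q + 1) :=
  hz.rolle_of_deriv_eq_zero S.continuous_weight S.weight_zero S.weight_pos
    (S.continuous_combination s c μ k) (S.continuous_deriv_combination s c μ k)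
    (fun t _ => S.hasDerivAt_combination s c μ k t) (S.ode_combination s c μ k) hτ h0'

/-- A double zero of a combination reduces its order by two under `f ↦ -(w f')' / w`. -/
theorem analyticOrderAt_combination {τ : ℝ} {k : ℕ} (hτ : 0 < τ)
    (h0 : combination ψ s c μ k τ = 0) (h0' : deriv (combination ψ s c μ k) τ = 0) :
    analyticOrderAt (combination ψ s c μ k) τ =
      analyticOrderAt (combination ψ s c μ (k + 1)) τ + 2 := by
  have hw := S.analyticAt_weight τ hτ
  have hworder : analyticOrderAt w τ = 0 :=
    hw.analyticOrderAt_eq_zero.2 (S.weight_pos τ hτ).ne'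
  have hA := S.analyticAt_combination s c μ k τ
  have hA1 := S.analyticAt_combination s c μ (k + 1) τ
  have e1 := hA.analyticOrderAt_deriv_add_one
  have e2 := (hw.mul hA.deriv).analyticOrderAt_deriv_add_one
  simp only [h0, sub_zero] at e1
  simp only [Pi.mul_apply, h0', mul_zero, sub_zero] at e2
  have e3 : analyticOrderAt (deriv (w * deriv (combination ψ s c μ k))) τ =
      analyticOrderAt (-(w * combination ψ s c μ (k + 1))) τ := by
    refine analyticOrderAt_congr ?_
    filter_upwards [lt_mem_nhds hτ] with t ht
    exact (S.ode_combination s c μ k t ht).deriv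
  have e4 : analyticOrderAt (fun x => w x * deriv (combination ψ s c μ k) x) τ =
      analyticOrderAt (deriv (combination ψ s c μ k)) τ := by
    have := analyticOrderAt_mul hw hA.deriv
    rw [hworder, zero_add] at this
    exact this
  rw [analyticOrderAt_neg, analyticOrderAt_mul hw hA1, hworder, zero_add] at e3
  rw [e3, e4] at e2
  rw [← e1, ← e2, add_assoc]
  rfl

end SturmFamily

/-! ### Rescaled iterates and the dominant eigenfunction. -/

theorem tendsto_sum_mul_pow {F : ℕ → ℝ → ℝ} (hF : ∀ i, Continuous (F i)) {s : Finset ℕ}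
    {a r : ℕ → ℝ} {M : ℕ} (hM : M ∈ s) (haM : a M = 1) (hrM : r M = 1)
    (hr : ∀ i ∈ s, i ≠ M → |r i| < 1) {φ : ℕ → ℕ} (hφ : Tendsto φ atTop atTop) {x : ℕ → ℝ} {y : ℝ}
    (hx : Tendsto x atTop (𝓝 y)) :
    Tendsto (fun n => ∑ i ∈ s, a i * r i ^ φ n * F i (x n)) atTop (𝓝 (F M y)) := by
  have h : Tendsto (fun n => ∑ i ∈ s, a i * r i ^ φ n * F i (x n)) atTop
      (𝓝 (∑ i ∈ s, if i = M then F i y else 0)) := by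
    refine tendsto_finsetSum s fun i hi => ?_
    have h1 := ((hF i).tendsto y).comp hx
    -- Only the term `M` survives: the other powers tend to 0, while the values at the moving points
    -- `x n` converge.
    by_cases him : i = M
    · subst him
      simpa [haM, hrM, Function.comp_def] using h1
    · have h2 := ((tendsto_pow_atTop_nhds_zero_of_abs_lt_one (hr i hi him)).comp hφ).const_mul (a i)
      have h3 := h2.mul h1
      simpa [him] using h3
  simpa [hM] using h

namespace SturmFamily

variable {w : ℝ → ℝ} {ψ : ℝ → ℝ → ℝ} (S : SturmFamily w ψ) {s : Finset ℕ} {c μ : ℕ → ℝ}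
include S

/-- If all iterates of a combination have at least `q` zeros in `(0, τ]`, then so does the component
with the largest eigenvalue. -/
theorem exists_zeros_of_forall_combination {M : ℕ} (hM : M ∈ s) (hcM : c M ≠ 0) (hμM : 0 < μ M)
    (hμ : ∀ i ∈ s, i ≠ M → μ i ^ 2 < μ M ^ 2) {τ : ℝ} {q k₀ : ℕ}
    (hz : ∀ k ≥ k₀, HasZerosIoc (combination ψ s c μ k) τ q) :
    ∃ Z : Finset ℝ, Z.card = q ∧ ∀ t ∈ Z, 0 < t ∧ t ≤ τ ∧ ψ (μ M) t = 0 := by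
  have hz' : ∀ k, HasZerosIoc (combination ψ s c μ (k + k₀)) τ q := fun k => hz _ (by omega)
  choose X hXs hX using hz'
  have hmono : ∀ k, ∀ i j, i < j → j < q → X k i < X k j := by
    intro k i j hij
    induction j with
    | zero => omega
    | succ j ih =>
      intro hj
      rcases Nat.lt_succ_iff_lt_or_eq.1 hij with h | h
      · exact (ih h (by omega)).trans (hXs k j hj)
      · subst h; exact hXs k i hj
  -- Dividing the iterate of index `k + k₀` by `c M (μ M ²)^(k + k₀)` makes the leading coefficient
  -- 1. The shift `k₀` is absorbed in `a`.
  set a : ℕ → ℝ := fun i => c i / c M * (μ i ^ 2 / μ M ^ 2) ^ k₀ with ha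
  set r : ℕ → ℝ := fun i => μ i ^ 2 / μ M ^ 2 with hr
  have hμM2 : 0 < μ M ^ 2 := by positivity
  have haM : a M = 1 := by simp [ha, hcM, hμM2.ne']
  have hrM : r M = 1 := by simp [hr, hμM2.ne']
  have hr1 : ∀ i ∈ s, i ≠ M → |r i| < 1 := by
    intro i hi him
    simp only [hr]
    rw [abs_of_nonneg (by positivity), div_lt_one hμM2]
    exact hμ i hi him
  have hscale : ∀ (G : ℕ → ℝ) (k : ℕ), ∑ i ∈ s, a i * r i ^ k * G i =
      (c M * (μ M ^ 2) ^ (k + k₀))⁻¹ * ∑ i ∈ s, c i * (μ i ^ 2) ^ (k + k₀) * G i := by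
    intro G k
    rw [Finset.mul_sum]
    refine Finset.sum_congr rfl fun i _ => ?_
    simp only [ha, hr, div_pow, pow_add]
    field_simp
  have hcpt : IsCompact (Set.pi Set.univ fun _ : Fin q => Set.Icc (0 : ℝ) τ) :=
    isCompact_univ_pi fun _ => isCompact_Icc
  -- Along a subsequence the tuples of zeros converge. The limits are zeros of the dominant
  -- eigenfunction; they stay away from 0 because `ψ l 0 = 1`.
  obtain ⟨Y, hY, φ, hφ, hlim⟩ := hcpt.tendsto_subseq (x := fun k (i : Fin q) => X k i)
    (fun k i _ => ⟨(hX k i i.2).1.le, (hX k i i.2).2.1⟩)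
  have hlim' : ∀ i : Fin q, Tendsto (fun n => X (φ n) i) atTop (𝓝 (Y i)) := fun i =>
    (tendsto_pi_nhds.1 hlim) i
  have hY0 : ∀ i, ψ (μ M) (Y i) = 0 := by
    intro i
    have h1 := tendsto_sum_mul_pow (F := fun i => ψ (μ i)) (fun i => S.continuous (μ i)) hM haM hrM
      hr1 hφ.tendsto_atTop (hlim' i)
    refine tendsto_nhds_unique h1 (tendsto_const_nhds.congr fun n => ?_)
    rw [hscale]
    have := (hX (φ n) i i.2).2.2
    rw [combination] at this
    rw [this, mul_zero]
  have hYpos : ∀ i, 0 < Y i := by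
    intro i
    refine lt_of_le_of_ne (hY i trivial).1 fun h => ?_
    have := hY0 i
    rw [← h, S.zero_right] at this
    exact one_ne_zero this
  -- If two zeros merged, Rolle's theorem would supply critical points converging to the same limit,
  -- and the eigenfunction would have a double zero there.
  have hne : ∀ i j : Fin q, i < j → Y i ≠ Y j := by
    intro i j hij heq
    have hex : ∀ n, ∃ ξ, X (φ n) i < ξ ∧ ξ < X (φ n) j ∧
        deriv (combination ψ s c μ (φ n + k₀)) ξ = 0 := by
      intro n
      obtain ⟨ξ, hξ, h0⟩ := exists_hasDerivAt_eq_zero (hmono (φ n) i j hij j.2)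
        (S.continuous_combination s c μ (φ n + k₀)).continuousOn
        ((hX (φ n) i i.2).2.2.trans (hX (φ n) j j.2).2.2.symm)
        (fun t _ => S.hasDerivAt_combination s c μ (φ n + k₀) t)
      exact ⟨ξ, hξ.1, hξ.2, h0⟩
    choose ξ h1 h2 h3 using hex
    have hξ : Tendsto ξ atTop (𝓝 (Y i)) := by
      have hj := hlim' j
      rw [← heq] at hj
      exact tendsto_of_tendsto_of_tendsto_of_le_of_le (hlim' i) hj (fun n => (h1 n).le)
        (fun n => (h2 n).le)
    have h4 := tendsto_sum_mul_pow (F := fun i => deriv (ψ (μ i)))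
      (fun i => S.continuous_deriv (μ i)) hM haM hrM hr1 hφ.tendsto_atTop hξ
    have h5 : deriv (ψ (μ M)) (Y i) = 0 := by
      refine tendsto_nhds_unique h4 (tendsto_const_nhds.congr fun n => ?_)
      rw [hscale, ← S.deriv_combination s c μ, h3 n, mul_zero]
    rcases S.ne_zero_or (μ M) (Y i) (hYpos i) with h | h
    · exact h (hY0 i)
    · exact h h5
  have hinj : Function.Injective Y := by
    intro i j hij
    rcases lt_trichotomy i j with h | h | h
    · exact absurd hij (hne i j h)
    · exact h
    · exact absurd hij.symm (hne j i h)
  refine ⟨Finset.univ.image Y, ?_, ?_⟩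
  · rw [Finset.card_image_of_injective _ hinj, Finset.card_univ, Fintype.card_fin]
  · intro t ht
    obtain ⟨i, -, rfl⟩ := Finset.mem_image.1 ht
    exact ⟨hYpos i, (hY i trivial).2, hY0 i⟩

/-- A combination of eigenfunctions of the Dirichlet problem on `(0, τ)` with a zero of the largest
possible order at `τ` has no zeros in `(0, τ)`. -/
theorem combination_ne_zero_of_dirichlet {M : ℕ} (hM : M ∈ s) (hcM : c M ≠ 0) (hμM : 0 < μ M)
    (hμ : ∀ i ∈ s, i ≠ M → μ i ^ 2 < μ M ^ 2) {τ : ℝ} {n : ℕ}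
    (hτ : prufer w ψ (μ M) τ < (n + 1 + 1 / 2) * Real.pi)
    (h0 : ∀ k, combination ψ s c μ k τ = 0)
    (h0' : ∀ k < n, deriv (combination ψ s c μ k) τ = 0) {t : ℝ} (ht0 : 0 < t) (htτ : t < τ) :
    combination ψ s c μ 0 t ≠ 0 := by
  intro hzero
  have hτ0 : 0 < τ := ht0.trans htτ
  -- While the iterate has a double zero at `τ`, each step gains one interior zero; from `n` on the
  -- Dirichlet condition keeps the number.
  have h1 : ∀ k ≤ n, HasZerosIoo (combination ψ s c μ k) τ (k + 1) := by
    intro k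
    induction k with
    | zero => exact fun _ => ⟨fun _ => t, by omega, fun _ _ => ⟨ht0, htτ, hzero⟩⟩
    | succ k ih =>
      exact fun hk => S.hasZerosIoo_combination_succ_of_deriv s c μ hτ0 (h0' k hk)
        ((ih (by omega)).append hτ0 (h0 k))
  have h2 : ∀ k ≥ n, HasZerosIoo (combination ψ s c μ k) τ (n + 1) := by
    intro k hk
    induction k, hk using Nat.le_induction with
    | base => exact h1 n le_rfl
    | succ k _ ih => exact S.hasZerosIoo_combination_succ s c μ hτ0 (h0 k) ih
  obtain ⟨Z, hZ, hZ0⟩ := S.exists_zeros_of_forall_combination hM hcM hμM hμ (k₀ := n)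
    fun k hk => (h2 k hk).append hτ0 (h0 k)
  -- With `τ` itself there are `n + 2` zeros in `(0, τ]`, but the angle allows only `n + 1`.
  have := S.card_zeros_le hμM (m := n + 1) (by push_cast; exact hτ) hZ0
  omega

/-- A combination of eigenfunctions of the Neumann problem on `(0, τ)` with a zero of the largest
possible order at `τ` has no zeros in `(0, τ)`. -/
theorem combination_ne_zero_of_neumann {M : ℕ} (hM : M ∈ s) (hcM : c M ≠ 0) (hμM : 0 < μ M)
    (hμ : ∀ i ∈ s, i ≠ M → μ i ^ 2 < μ M ^ 2) {τ : ℝ} {n : ℕ}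
    (hτ : prufer w ψ (μ M) τ < (n + 1 / 2) * Real.pi)
    (h0 : ∀ k < n, combination ψ s c μ k τ = 0)
    (h0' : ∀ k, deriv (combination ψ s c μ k) τ = 0) {t : ℝ} (ht0 : 0 < t) (htτ : t < τ) :
    combination ψ s c μ 0 t ≠ 0 := by
  intro hzero
  have hτ0 : 0 < τ := ht0.trans htτ
  have h1 : ∀ k ≤ n, HasZerosIoo (combination ψ s c μ k) τ (k + 1) := by
    intro k
    induction k with
    | zero => exact fun _ => ⟨fun _ => t, by omega, fun _ _ => ⟨ht0, htτ, hzero⟩⟩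
    | succ k ih =>
      exact fun hk => S.hasZerosIoo_combination_succ_of_deriv s c μ hτ0 (h0' k)
        ((ih (by omega)).append hτ0 (h0 k hk))
  have h2 : ∀ k ≥ n, HasZerosIoo (combination ψ s c μ k) τ (n + 1) := by
    intro k hk
    induction k, hk using Nat.le_induction with
    | base => exact h1 n le_rfl
    | succ k _ ih =>
      -- The iterate need no longer vanish at `τ`; the Neumann condition alone preserves the number
      -- of zeros.
      exact S.hasZerosIoo_combination_succ_of_deriv s c μ hτ0 (h0' k) ih.hasZerosIoc
  obtain ⟨Z, hZ, hZ0⟩ := S.exists_zeros_of_forall_combination hM hcM hμM hμ (k₀ := n)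
    fun k hk => (h2 k hk).hasZerosIoc
  -- There are `n + 1` zeros against the `n` that the angle allows.
  have := S.card_zeros_le hμM (m := n) hτ hZ0
  omega

/-- The order at `τ` of a combination whose first `n` iterates have a double zero at `τ`. -/
theorem analyticOrderAt_combination_eq_add {τ : ℝ} {n : ℕ} (hτ : 0 < τ)
    (h0 : ∀ k < n, combination ψ s c μ k τ = 0)
    (h0' : ∀ k < n, deriv (combination ψ s c μ k) τ = 0) :
    analyticOrderAt (combination ψ s c μ 0) τ =
      analyticOrderAt (combination ψ s c μ n) τ + (2 * n : ℕ) := by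
  induction n with
  | zero => simp
  | succ n ih =>
    rw [ih (fun k hk => h0 k (by omega)) (fun k hk => h0' k (by omega)),
      S.analyticOrderAt_combination s c μ hτ (h0 n (by omega)) (h0' n (by omega))]
    push_cast
    ring

end SturmFamily

/-! ### The Jacobi functions form a Sturm–Liouville family -/

theorem hasDerivAt_weight (α β : ℝ) {t : ℝ} (ht : 0 < t) :
    HasDerivAt (weight α β) (drift α β t * weight α β t) t := by
  have hs := Real.sinh_pos_iff.2 ht
  have hc := Real.cosh_pos t
  have h1 := (Real.hasDerivAt_sinh t).rpow_const (p := 2 * α + 1) (Or.inl hs.ne')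
  have h2 := (Real.hasDerivAt_cosh t).rpow_const (p := 2 * β + 1) (Or.inl hc.ne')
  have h3 := (h1.const_mul ((2 : ℝ) ^ (2 * (α + β + 1)))).mul h2
  refine h3.congr_deriv ?_
  rw [drift, weight, add_sub_cancel_right, add_sub_cancel_right, Real.rpow_add hs,
    Real.rpow_add hc, Real.rpow_one, Real.rpow_one]
  field_simp

theorem weight_pos (α β : ℝ) {t : ℝ} (ht : 0 < t) : 0 < weight α β t := by
  have hs := Real.sinh_pos_iff.2 ht
  have hc := Real.cosh_pos t
  unfold weight
  positivity

theorem analyticAt_weight (α β : ℝ) {t : ℝ} (ht : 0 < t) : AnalyticAt ℝ (weight α β) t := by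
  have hs := Real.sinh_pos_iff.2 ht
  have hc := Real.cosh_pos t
  have h1 : AnalyticAt ℝ (fun t => Real.sinh t ^ (2 * α + 1)) t :=
    (Real.contDiff_sinh.contDiffAt.rpow_const_of_ne hs.ne').analyticAt
  have h2 : AnalyticAt ℝ (fun t => Real.cosh t ^ (2 * β + 1)) t :=
    (Real.contDiff_cosh.contDiffAt.rpow_const_of_ne hc.ne').analyticAt
  exact (analyticAt_const.mul h1).mul h2

section Parameters

variable {α β : ℝ} (hβ : -1 / 2 ≤ β) (hβα : β ≤ α) (hα : -1 / 2 < α)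
include hβ hβα hα

theorem jacobiPsi_mul (l t : ℝ) : jacobiPhi α β 0 t * jacobiPsi α β l t = jacobiPhi α β l t := by
  have := (jacobiPhi_zero_pos hβ hβα hα t).ne'
  rw [jacobiPsi]
  field_simp

theorem jacobiPsi_eq_zero_iff (l t : ℝ) : jacobiPsi α β l t = 0 ↔ jacobiPhi α β l t = 0 := by
  have := (jacobiPhi_zero_pos hβ hβα hα t).ne'
  simp [jacobiPsi, this]

theorem hasDerivAt_jacobiPsi (l t : ℝ) : HasDerivAt (jacobiPsi α β l)
    ((deriv (jacobiPhi α β l) t * jacobiPhi α β 0 t - jacobiPhi α β l t *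
      deriv (jacobiPhi α β 0) t) / jacobiPhi α β 0 t ^ 2) t :=
  (hasDerivAt_jacobiPhi hβ hβα hα l t).div (hasDerivAt_jacobiPhi hβ hβα hα 0 t)
    (jacobiPhi_zero_pos hβ hβα hα t).ne'

/-- Dividing by `φ_0` replaces the eigenvalue `l² + ρ²` by `l²`. The function `w ψ'` is `Δ` times
the Wronskian of `φ_l` and `φ_0`, which gives the equation. The weight vanishes at the origin
because `2α + 1 > 0`. -/
theorem sturmFamily_jacobiPsi :
    SturmFamily (fun t => weight α β t * jacobiPhi α β 0 t ^ 2) (jacobiPsi α β) where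
  continuous_weight := by
    have h1 : Continuous (weight α β) := by
      have e1 : Continuous fun t => Real.sinh t ^ (2 * α + 1) :=
        Real.continuous_sinh.rpow_const fun _ => Or.inr (by linarith)
      have e2 : Continuous fun t => Real.cosh t ^ (2 * β + 1) :=
        Real.continuous_cosh.rpow_const fun _ => Or.inr (by linarith)
      exact (continuous_const.mul e1).mul e2
    exact h1.mul ((continuous_jacobiPhi hβ hβα hα 0).pow 2)
  weight_zero := by
    have : (2 * α + 1) ≠ 0 := by linarith
    simp [weight, Real.zero_rpow this]
  weight_pos := fun t ht => mul_pos (weight_pos α β ht) (pow_pos (jacobiPhi_zero_pos hβ hβα hα t) 2)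
  analyticAt_weight := fun t ht =>
    (analyticAt_weight α β ht).mul ((analyticAt_jacobiPhi hβ hβα hα 0 t).pow 2)
  analyticAt := fun l t => (analyticAt_jacobiPhi hβ hβα hα l t).div
    (analyticAt_jacobiPhi hβ hβα hα 0 t) (jacobiPhi_zero_pos hβ hβα hα t).ne'
  continuous_uncurry := by
    have h1 := continuous_uncurry_jacobiPhi hβ hβα hα
    have h2 : Continuous fun p : ℝ × ℝ => jacobiPhi α β 0 p.2 :=
      (continuous_jacobiPhi hβ hβα hα 0).comp continuous_snd
    exact h1.div h2 fun p => (jacobiPhi_zero_pos hβ hβα hα p.2).ne'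
  continuous_uncurry_deriv := by
    have h1 := continuous_uncurry_jacobiPhi hβ hβα hα
    have h1' := continuous_uncurry_deriv_jacobiPhi hβ hβα hα
    have h2 : Continuous fun p : ℝ × ℝ => jacobiPhi α β 0 p.2 :=
      (continuous_jacobiPhi hβ hβα hα 0).comp continuous_snd
    have h3 : Continuous fun p : ℝ × ℝ => deriv (jacobiPhi α β 0) p.2 :=
      (continuous_deriv_jacobiPhi hβ hβα hα 0).comp continuous_snd
    refine (((h1'.mul h2).sub (h1.mul h3)).div (h2.pow 2) fun p =>
      (pow_pos (jacobiPhi_zero_pos hβ hβα hα p.2) 2).ne').congr fun p => ?_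
    exact (hasDerivAt_jacobiPsi hβ hβα hα p.1 p.2).deriv.symm
  ode := by
    intro l t ht
    have hfun : (fun s => weight α β s * jacobiPhi α β 0 s ^ 2 * deriv (jacobiPsi α β l) s) =
        fun s => weight α β s * (deriv (jacobiPhi α β l) s * jacobiPhi α β 0 s -
          jacobiPhi α β l s * deriv (jacobiPhi α β 0) s) := by
      funext s
      have := (jacobiPhi_zero_pos hβ hβα hα s).ne'
      rw [(hasDerivAt_jacobiPsi hβ hβα hα l s).deriv]
      field_simp
    rw [hfun]
    have h := (hasDerivAt_weight α β ht).mul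
      (((jacobiPhi_ode hβ hβα hα l ht).mul (hasDerivAt_jacobiPhi hβ hβα hα 0 t)).sub
      ((hasDerivAt_jacobiPhi hβ hβα hα l t).mul (jacobiPhi_ode hβ hβα hα 0 ht)))
    refine h.congr_deriv ?_
    have h0 := (jacobiPhi_zero_pos hβ hβα hα t).ne'
    simp only [jacobiPsi, Pi.mul_apply, Pi.sub_apply]
    field_simp
    ring
  zero_right := fun l => by simp [jacobiPsi, jacobiPhi_zero_right]
  zero_left := fun t => div_self (jacobiPhi_zero_pos hβ hβα hα t).ne'
  ne_zero_or := by
    intro l t ht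
    have h0 := (jacobiPhi_zero_pos hβ hβα hα t).ne'
    rw [(hasDerivAt_jacobiPsi hβ hβα hα l t).deriv, Ne, jacobiPsi_eq_zero_iff hβ hβα hα]
    by_cases h : jacobiPhi α β l t = 0
    · have h2 := (jacobiPhi_ne_zero_or_deriv_ne_zero hβ hβα hα l ht).resolve_left (by simp [h])
      right
      simp [h, h0, h2]
    · exact Or.inl h
  exists_zero_gt := by
    intro l hl T
    obtain ⟨t, ht, h⟩ := exists_jacobiPhi_eq_zero_gt hβ hβα hα hl T
    exact ⟨t, ht, (jacobiPsi_eq_zero_iff hβ hβα hα l t).2 h⟩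

end Parameters

/-! ### Partial fractions -/

theorem prod_sub_eq_neg_one_pow_mul {s : Finset ℕ} {i : ℕ} (hi : i ∈ s) (v : ℕ → ℝ) :
    ∏ j ∈ s.erase i, (v j - v i) = (-1) ^ (s.card - 1) * ∏ j ∈ s.erase i, (v i - v j) := by
  rw [← Finset.card_erase_of_mem hi, ← Finset.prod_const, ← Finset.prod_mul_distrib]
  exact Finset.prod_congr rfl fun j _ => by ring

/-- Up to sign and the factor `∏ z_j²`, the sum is the coefficient of degree `m - 1` in the Lagrange
interpolant of `X ^ k` at the nodes `z_i²`, and for `k < m` that interpolant is `X ^ k` itself. -/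
theorem sum_pfCoeff_mul_pow {z : ℕ → ℝ} {m : ℕ}
    (hz : Set.InjOn (fun i => z i ^ 2) (Finset.Icc 1 m)) {k : ℕ} (hk : k < m) :
    ∑ i ∈ Finset.Icc 1 m, pfCoeff z m i * (z i ^ 2) ^ k =
      (-1) ^ (m - 1) * (∏ j ∈ Finset.Icc 1 m, z j ^ 2) * if k = m - 1 then 1 else 0 := by
  have hcard : (Finset.Icc 1 m).card = m := by simp
  have h := Lagrange.coeff_eq_sum hz (P := (Polynomial.X : Polynomial ℝ) ^ k)
    (by rw [Polynomial.degree_X_pow, hcard]; exact_mod_cast hk)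
  rw [hcard, Polynomial.coeff_X_pow] at h
  have h2 : (if k = m - 1 then (1 : ℝ) else 0) = if m - 1 = k then 1 else 0 := by
    simp [eq_comm]
  rw [h2, h, Finset.mul_sum]
  refine Finset.sum_congr rfl fun i hi => ?_
  rw [pfCoeff, prod_sub_eq_neg_one_pow_mul hi fun j => z j ^ 2, hcard, Polynomial.eval_pow,
    Polynomial.eval_X]
  have hne : ∏ j ∈ (Finset.Icc 1 m).erase i, (z i ^ 2 - z j ^ 2) ≠ 0 := by
    refine Finset.prod_ne_zero_iff.2 fun j hj => sub_ne_zero.2 fun h => ?_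
    exact (Finset.ne_of_mem_erase hj) (hz (Finset.mem_of_mem_erase hj) hi h.symm)
  have hsq : ((-1 : ℝ) ^ (m - 1)) * (-1) ^ (m - 1) = 1 := by
    rw [← mul_pow]; norm_num
  have hpow : ((-1 : ℝ) ^ (m - 1)) ≠ 0 := pow_ne_zero _ (by norm_num)
  field_simp
  rw [← pow_two] at hsq
  rw [hsq, mul_one]

/-- The terms are the values at 0 of the Lagrange basis polynomials for the nodes `z_i²`, and these
polynomials add up to 1. -/
theorem sum_pfCoeff_div {z : ℕ → ℝ} {m : ℕ} (hm : 1 ≤ m) (hz0 : ∀ i ∈ Finset.Icc 1 m, z i ≠ 0)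
    (hz : Set.InjOn (fun i => z i ^ 2) (Finset.Icc 1 m)) :
    ∑ i ∈ Finset.Icc 1 m, pfCoeff z m i / z i ^ 2 = 1 := by
  have h := congrArg (Polynomial.eval 0) (Lagrange.sum_basis hz ⟨1, by simpa using hm⟩)
  rw [Polynomial.eval_finsetSum, Polynomial.eval_one] at h
  rw [← h]
  refine Finset.sum_congr rfl fun i hi => ?_
  rw [Lagrange.basis, Polynomial.eval_prod, pfCoeff, ← Finset.mul_prod_erase _ _ hi, div_div,
    mul_comm _ (z i ^ 2), mul_div_mul_left _ _ (pow_ne_zero 2 (hz0 i hi)), ← Finset.prod_div_distrib]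
  refine Finset.prod_congr rfl fun j hj => ?_
  have hne : z i ^ 2 - z j ^ 2 ≠ 0 := sub_ne_zero.2 fun h =>
    (Finset.ne_of_mem_erase hj) (hz (Finset.mem_of_mem_erase hj) hi h.symm)
  have hne' : z j ^ 2 - z i ^ 2 ≠ 0 := by rw [← neg_sub]; exact neg_ne_zero.2 hne
  simp only [Lagrange.basisDivisor, Polynomial.eval_mul, Polynomial.eval_C, Polynomial.eval_sub,
    Polynomial.eval_X]
  field_simp
  ring

/-- Exactly the `i - 1` factors with `j < i` are negative. -/
theorem pfCoeff_sign {z : ℕ → ℝ} {m : ℕ} (hz0 : ∀ i ∈ Finset.Icc 1 m, 0 < z i)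
    (hz : StrictMonoOn z (Finset.Icc 1 m)) {i : ℕ} (hi : i ∈ Finset.Icc 1 m) :
    0 < (-1) ^ (i - 1) * pfCoeff z m i := by
  obtain ⟨hi1, him⟩ := Finset.mem_Icc.1 hi
  have hsplit : (Finset.Icc 1 m).erase i = Finset.Ico 1 i ∪ Finset.Ioc i m := by
    ext j
    simp only [Finset.mem_erase, Finset.mem_Icc, Finset.mem_union, Finset.mem_Ico, Finset.mem_Ioc]
    omega
  have hdisj : Disjoint (Finset.Ico 1 i) (Finset.Ioc i m) := by
    rw [Finset.disjoint_left]
    intro j hj hj'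
    rw [Finset.mem_Ico] at hj
    rw [Finset.mem_Ioc] at hj'
    omega
  have h1 : ∏ j ∈ Finset.Ico 1 i, (z j ^ 2 - z i ^ 2) =
      (-1) ^ (i - 1) * ∏ j ∈ Finset.Ico 1 i, (z i ^ 2 - z j ^ 2) := by
    have hc : i - 1 = (Finset.Ico 1 i).card := by simp
    rw [hc, ← Finset.prod_const, ← Finset.prod_mul_distrib]
    exact Finset.prod_congr rfl fun j _ => by ring
  have h2 : 0 < ∏ j ∈ Finset.Ico 1 i, (z i ^ 2 - z j ^ 2) := by
    refine Finset.prod_pos fun j hj => ?_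
    rw [Finset.mem_Ico] at hj
    have hj' : j ∈ Finset.Icc 1 m := Finset.mem_Icc.2 ⟨hj.1, by omega⟩
    have := hz hj' hi hj.2
    nlinarith [hz0 j hj']
  have h3 : 0 < ∏ j ∈ Finset.Ioc i m, (z j ^ 2 - z i ^ 2) := by
    refine Finset.prod_pos fun j hj => ?_
    rw [Finset.mem_Ioc] at hj
    have hj' : j ∈ Finset.Icc 1 m := Finset.mem_Icc.2 ⟨by omega, hj.2⟩
    have := hz hi hj' hj.1
    nlinarith [hz0 i hi]
  have h4 : 0 < ∏ j ∈ Finset.Icc 1 m, z j ^ 2 :=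
    Finset.prod_pos fun j hj => pow_pos (hz0 j hj) 2
  rw [pfCoeff, hsplit, Finset.prod_union hdisj, h1]
  have hpow : ((-1 : ℝ) ^ (i - 1)) ≠ 0 := pow_ne_zero _ (by norm_num)
  rw [mul_assoc, ← mul_div_assoc, mul_div_mul_left _ _ hpow]
  positivity

/-! ### Integrals against the radial and angular measures -/

theorem integrableOn_of_continuous {X : Type*} [TopologicalSpace X] [MeasurableSpace X]
    [OpensMeasurableSpace X] [SecondCountableTopology X] [T2Space X] {ν : Measure X}
    [IsFiniteMeasure ν] {K : Set X} (hK : IsCompact K) {f : X → ℝ} (hf : Continuous f) :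
    IntegrableOn f K ν :=
  hf.continuousOn.integrableOn_compact hK

theorem hasDerivAt_setIntegral {X : Type*} [TopologicalSpace X] [MeasurableSpace X]
    [OpensMeasurableSpace X] [SecondCountableTopology X] [T2Space X] {ν : Measure X}
    [IsFiniteMeasure ν] {K : Set X} (hK : IsCompact K) {F F' : ℝ → X → ℝ}
    (hF : Continuous (Function.uncurry F)) (hF' : Continuous (Function.uncurry F'))
    (hd : ∀ x a, HasDerivAt (fun x => F x a) (F' x a) x) (x₀ : ℝ) :
    HasDerivAt (fun x => ∫ a in K, F x a ∂ν) (∫ a in K, F' x₀ a ∂ν) x₀ := by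
  have hFx : ∀ x, Continuous (F x) := fun x =>
    hF.comp (by fun_prop : Continuous fun a : X => (x, a))
  have hFx' : ∀ x, Continuous (F' x) := fun x =>
    hF'.comp (by fun_prop : Continuous fun a : X => (x, a))
  obtain ⟨C, hC⟩ := ((isCompact_closedBall x₀ (1 : ℝ)).prod hK).exists_bound_of_continuousOn
    hF'.continuousOn
  refine (hasDerivAt_integral_of_dominated_loc_of_deriv_le (bound := fun _ => C)
    (Metric.closedBall_mem_nhds x₀ one_pos) (Eventually.of_forall fun x =>
      (hFx x).aestronglyMeasurable) (integrableOn_of_continuous hK (hFx x₀))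
    (hFx' x₀).aestronglyMeasurable ?_ (integrable_const C) ?_).2
  · refine (ae_restrict_iff' hK.measurableSet).2 (Eventually.of_forall fun a ha x hx => ?_)
    exact hC (x, a) ⟨hx, ha⟩
  · exact Eventually.of_forall fun a x _ => hd x a

/-- Integration against an integrable density on a bounded interval. -/
theorem exists_measure_of_density {W : ℝ → ℝ} {a b : ℝ} (hab : a ≤ b) (hWm : Measurable W)
    (hW0 : ∀ x ∈ Set.Ioc a b, 0 ≤ W x) (hWi : IntervalIntegrable W volume a b) :
    ∃ ν : Measure ℝ, IsFiniteMeasure ν ∧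
      ∀ h : ℝ → ℝ, ∫ x in Set.Icc a b, h x ∂ν = ∫ x in a..b, h x * W x := by
  have hWi' : Integrable W (volume.restrict (Set.Ioc a b)) :=
    (intervalIntegrable_iff_integrableOn_Ioc_of_le hab).1 hWi
  refine ⟨(volume.restrict (Set.Ioc a b)).withDensity fun x => ENNReal.ofReal (W x), ?_, ?_⟩
  · exact isFiniteMeasure_withDensity_ofReal hWi'.2
  · intro h
    have hr : ((volume.restrict (Set.Ioc a b)).withDensity fun x => ENNReal.ofReal (W x)).restrict
        (Set.Icc a b) = (volume.restrict (Set.Ioc a b)).withDensity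
          fun x => ENNReal.ofReal (W x) := by
      rw [restrict_withDensity measurableSet_Icc, Measure.restrict_restrict measurableSet_Icc,
        Set.inter_eq_self_of_subset_right Set.Ioc_subset_Icc_self]
    rw [hr, integral_withDensity_eq_integral_toReal_smul hWm.ennreal_ofReal
      (Eventually.of_forall fun _ => ENNReal.ofReal_lt_top), intervalIntegral.integral_of_le hab]
    refine setIntegral_congr_fun measurableSet_Ioc fun x hx => ?_
    rw [smul_eq_mul, ENNReal.toReal_ofReal (hW0 x hx), mul_comm]

theorem intervalIntegrable_radial_density {p q : ℝ} (hp : -1 < p) (hq : 0 ≤ q) :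
    IntervalIntegrable (fun r : ℝ => (1 - r ^ 2) ^ p * r ^ q) volume 0 1 := by
  have h1 : IntervalIntegrable (fun r : ℝ => (1 - r) ^ p) volume 0 1 := by
    have := (intervalIntegral.intervalIntegrable_rpow' (a := 0) (b := 1) hp).comp_sub_left 1
    simpa using this.symm
  have h2 : ContinuousOn (fun r : ℝ => (1 + r) ^ p * r ^ q) (Set.uIcc 0 1) := by
    rw [Set.uIcc_of_le zero_le_one]
    refine ContinuousOn.mul ?_ ?_
    · exact (continuousOn_const.add continuousOn_id).rpow_const fun r hr =>
        Or.inl (ne_of_gt (show (0 : ℝ) < 1 + r by linarith [hr.1]))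
    · exact continuousOn_id.rpow_const fun r _ => Or.inr hq
  refine (h1.mul_continuousOn h2).congr ?_
  intro r hr
  rw [Set.uIoc_of_le zero_le_one] at hr
  simp only
  rw [← mul_assoc, ← Real.mul_rpow (by linarith [hr.2]) (by linarith [hr.1])]
  congr 2
  ring

theorem intervalIntegrable_angular_density {p : ℝ} (hp : -1 < p) :
    IntervalIntegrable (fun χ : ℝ => Real.sin χ ^ p) volume 0 Real.pi := by
  have hpi := Real.pi_pos
  have h1 : IntervalIntegrable (fun χ : ℝ => Real.sin χ ^ p) volume 0 (Real.pi / 2) := by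
    -- The constant dominates for `p ≥ 0`; for `p ≤ 0` the second term does, by Jordan's inequality
    -- `sin χ ≥ 2χ/π`. The other half of the interval follows by reflection.
    have hb : IntervalIntegrable (fun χ : ℝ => 1 + (2 / Real.pi) ^ p * χ ^ p) volume 0
        (Real.pi / 2) :=
      intervalIntegrable_const.add ((intervalIntegral.intervalIntegrable_rpow' hp).const_mul _)
    refine hb.mono_fun' (Real.measurable_sin.pow_const p).aestronglyMeasurable ?_
    refine (ae_restrict_iff' measurableSet_uIoc).2 (Eventually.of_forall fun χ hχ => ?_)
    rw [Set.uIoc_of_le (by positivity)] at hχ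
    have hs : 0 < Real.sin χ := Real.sin_pos_of_pos_of_lt_pi hχ.1 (by linarith [hχ.2])
    simp only
    rw [Real.norm_of_nonneg (Real.rpow_nonneg hs.le p), ← Real.mul_rpow (by positivity) hχ.1.le]
    rcases le_total 0 p with h0 | h0
    · have h2 := Real.rpow_le_one hs.le (Real.sin_le_one χ) h0
      have h3 : 0 ≤ (2 / Real.pi * χ) ^ p := Real.rpow_nonneg (mul_nonneg (by positivity) hχ.1.le) p
      linarith
    · have h2 := Real.mul_le_sin hχ.1.le hχ.2
      have h3 := Real.rpow_le_rpow_of_nonpos (mul_pos (by positivity) hχ.1) h2 h0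
      linarith
  have h2 : IntervalIntegrable (fun χ : ℝ => Real.sin χ ^ p) volume (Real.pi / 2) Real.pi := by
    have := (h1.comp_sub_left Real.pi).symm
    simp only [Real.sin_pi_sub, sub_zero, sub_half] at this
    exact this
  exact h1.trans h2

/-- The radial mean is the integral against a finite measure, for which integration by parts has no
boundary terms. -/
theorem exists_radial_measure {α β : ℝ} (hβ : -1 / 2 ≤ β) (hβα : β ≤ α) :
    ∃ (ν : Measure ℝ) (K : ℝ), IsFiniteMeasure ν ∧ 0 ≤ K ∧
      (∀ h : ℝ → ℝ, radialMean α β h = K * ∫ r in Set.Icc 0 1, h r ∂ν) ∧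
      ∀ κ κ' D : ℝ → ℝ, Continuous κ' → Continuous D → (∀ r, HasDerivAt κ (κ' r) r) →
        κ 0 = 0 → (∀ r ∈ Set.Ioo (0 : ℝ) 1, (2 * β + 1) * κ r = r * D r) →
        ∫ r in Set.Icc 0 1, ((1 - r ^ 2) * κ' r + (1 - r ^ 2) * D r - 2 * (α - β) * r * κ r) ∂ν
          = 0 := by
  by_cases hab : α = β
  · have hr : (Measure.dirac (1 : ℝ)).restrict (Set.Icc 0 1) = Measure.dirac 1 :=
      Measure.restrict_eq_self_of_ae_mem ((ae_dirac_iff (p := fun x => x ∈ Set.Icc (0 : ℝ) 1)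
        measurableSet_Icc).2 (by simp))
    refine ⟨Measure.dirac 1, 1, inferInstance, zero_le_one, fun h => ?_, fun κ κ' D _ _ _ _ _ => ?_⟩
    · rw [radialMean, if_pos hab, hr, integral_dirac, one_mul]
    · rw [hr, integral_dirac, hab]
      ring
  have hlt : β < α := lt_of_le_of_ne hβα (Ne.symm hab)
  have hm : Measurable fun r : ℝ => (1 - r ^ 2) ^ (α - β - 1) * r ^ (2 * β + 1) :=
    ((measurable_const.sub (measurable_id.pow_const 2)).pow_const _).mul
      (measurable_id.pow_const _)
  have hpos : ∀ r ∈ Set.Ioc (0 : ℝ) 1, 0 ≤ (1 - r ^ 2) ^ (α - β - 1) * r ^ (2 * β + 1) := by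
    intro r hr
    exact mul_nonneg (Real.rpow_nonneg (by nlinarith [hr.1, hr.2]) _) (Real.rpow_nonneg hr.1.le _)
  have hintg := intervalIntegrable_radial_density (p := α - β - 1) (q := 2 * β + 1) (by linarith)
    (by linarith)
  obtain ⟨ν, hν, hνint⟩ := exists_measure_of_density zero_le_one hm hpos hintg
  refine ⟨ν, 2 * Real.Gamma (α + 1) / (Real.Gamma (β + 1) * Real.Gamma (α - β)), hν, ?_,
    fun h => ?_, fun κ κ' D hκ' hD hd h0 hκD => ?_⟩
  · have h1 := Real.Gamma_pos_of_pos (show 0 < α + 1 by linarith)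
    have h2 := Real.Gamma_pos_of_pos (show 0 < β + 1 by linarith)
    have h3 := Real.Gamma_pos_of_pos (show 0 < α - β by linarith)
    positivity
  · rw [radialMean, if_neg hab, hνint]
  · rw [hνint]
    have hκ : Continuous κ := continuous_iff_continuousAt.2 fun r => (hd r).continuousAt
    -- The function `D` stands for `(2β + 1) κ / r`, so that nothing is divided by `r` at 0. The
    -- primitive vanishes at 1 because `α > β`, and at 0 because `κ 0 = 0`, even when `2β + 1 = 0`.
    have hFTC := intervalIntegral.integral_eq_sub_of_hasDerivAt_of_le (a := 0) (b := 1) zero_le_one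
      (f := fun r => (1 - r ^ 2) ^ (α - β) * r ^ (2 * β + 1) * κ r)
      (f' := fun r => ((1 - r ^ 2) * κ' r + (1 - r ^ 2) * D r - 2 * (α - β) * r * κ r) *
        ((1 - r ^ 2) ^ (α - β - 1) * r ^ (2 * β + 1))) ?_ ?_ ?_
    · rw [hFTC, h0]
      have h2 : α - β ≠ 0 := by linarith
      simp [Real.zero_rpow h2]
    · refine ContinuousOn.mul (ContinuousOn.mul ?_ ?_) hκ.continuousOn
      · exact ((continuous_const.sub (continuous_pow 2)).rpow_const fun _ =>
          Or.inr (by linarith)).continuousOn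
      · exact (continuous_id.rpow_const fun _ => Or.inr (by linarith)).continuousOn
    · intro r hr
      have hr1 : 0 < 1 - r ^ 2 := by nlinarith [hr.1, hr.2]
      have e1 : HasDerivAt (fun r : ℝ => 1 - r ^ 2) (-(2 * r)) r := by
        simpa using (hasDerivAt_pow 2 r).const_sub 1
      have h1 := e1.rpow_const (p := α - β) (Or.inl hr1.ne')
      have h2 := (hasDerivAt_id r).rpow_const (p := 2 * β + 1) (Or.inl hr.1.ne')
      refine ((h1.mul h2).mul (hd r)).congr_deriv ?_
      have hκr := hκD r hr
      have hκr' : D r = (2 * β + 1) * κ r / r := by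
        have := hr.1.ne'
        field_simp
        linarith
      have hpow : (1 - r ^ 2) ^ (α - β) = (1 - r ^ 2) ^ (α - β - 1) * (1 - r ^ 2) := by
        rw [Real.rpow_sub_one hr1.ne']
        field_simp
      have hpow2 : r ^ (2 * β + 1 - 1) = r ^ (2 * β + 1) / r := Real.rpow_sub_one hr.1.ne' _
      have hr0 := hr.1.ne'
      simp only [Pi.mul_apply, id]
      rw [hκr', hpow, hpow2]
      generalize (1 - r ^ 2) ^ (α - β - 1) = X
      generalize r ^ (2 * β + 1) = Y
      field_simp
      ring
    · refine (hintg.mul_continuousOn (g := fun r => ((1 - r ^ 2) * κ' r + (1 - r ^ 2) * D r -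
        2 * (α - β) * r * κ r)) (by fun_prop)).congr fun r _ => ?_
      ring

/-- The angular mean is the integral against a finite measure, for which integration by parts has no
boundary terms. -/
theorem exists_angular_measure {β : ℝ} (hβ : -1 / 2 ≤ β) :
    ∃ (ν : Measure ℝ) (K : ℝ), IsFiniteMeasure ν ∧ 0 ≤ K ∧
      (∀ h : ℝ → ℝ, angularMean β h = K * ∫ χ in Set.Icc 0 Real.pi, h χ ∂ν) ∧
      (∀ k k' : ℝ → ℝ, Continuous k' → (∀ χ, HasDerivAt k (k' χ) χ) →
        ∫ χ in Set.Icc 0 Real.pi, (Real.sin χ * k' χ + (2 * β + 1) * Real.cos χ * k χ) ∂ν = 0) ∧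
      ∫ χ in Set.Icc 0 Real.pi, Real.cos χ ∂ν = 0 := by
  have hpi := Real.pi_pos
  by_cases hb : β = -1 / 2
  · have hr : (Measure.dirac (0 : ℝ) + Measure.dirac Real.pi).restrict (Set.Icc 0 Real.pi) =
        Measure.dirac 0 + Measure.dirac Real.pi := by
      refine Measure.restrict_eq_self_of_ae_mem ?_
      rw [ae_add_measure_iff,
        ae_dirac_iff (p := fun x => x ∈ Set.Icc (0 : ℝ) Real.pi) measurableSet_Icc,
        ae_dirac_iff (p := fun x => x ∈ Set.Icc (0 : ℝ) Real.pi) measurableSet_Icc]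
      simp [hpi.le]
    have hi : ∀ h : ℝ → ℝ, ∫ χ in Set.Icc 0 Real.pi, h χ ∂(Measure.dirac 0 + Measure.dirac Real.pi)
        = h 0 + h Real.pi := by
      intro h
      rw [hr, integral_add_measure (integrable_dirac (by simp)) (integrable_dirac (by simp)), integral_dirac,
        integral_dirac]
    refine ⟨Measure.dirac 0 + Measure.dirac Real.pi, 1 / 2, inferInstance, by norm_num,
      fun h => ?_, fun k k' _ _ => ?_, ?_⟩
    · rw [angularMean, if_pos hb, hi]
      ring
    · rw [hi, hb]
      simp
      ring
    · rw [hi]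
      simp
  have hlt : -1 / 2 < β := lt_of_le_of_ne hβ (Ne.symm hb)
  have hpos : ∀ χ ∈ Set.Ioc (0 : ℝ) Real.pi, 0 ≤ Real.sin χ ^ (2 * β) := fun χ hχ =>
    Real.rpow_nonneg (Real.sin_nonneg_of_nonneg_of_le_pi hχ.1.le hχ.2) _
  have hintg := intervalIntegrable_angular_density (p := 2 * β) (by linarith)
  obtain ⟨ν, hν, hνint⟩ :=
    exists_measure_of_density hpi.le (Real.measurable_sin.pow_const (2 * β)) hpos hintg
  have hparts : ∀ k k' : ℝ → ℝ, Continuous k' → (∀ χ, HasDerivAt k (k' χ) χ) →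
      ∫ χ in Set.Icc 0 Real.pi, (Real.sin χ * k' χ + (2 * β + 1) * Real.cos χ * k χ) ∂ν = 0 := by
    intro k k' hk' hd
    rw [hνint]
    have hk : Continuous k := continuous_iff_continuousAt.2 fun r => (hd r).continuousAt
    have hFTC := intervalIntegral.integral_eq_sub_of_hasDerivAt_of_le hpi.le
      (f := fun χ => Real.sin χ ^ (2 * β + 1) * k χ)
      (f' := fun χ => (Real.sin χ * k' χ + (2 * β + 1) * Real.cos χ * k χ) *
        Real.sin χ ^ (2 * β)) ?_ ?_ ?_
    · rw [hFTC]
      have h2 : 2 * β + 1 ≠ 0 := by linarith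
      simp [Real.zero_rpow h2]
    · exact ((Real.continuous_sin.rpow_const fun _ => Or.inr (by linarith)).mul hk).continuousOn
    · intro χ hχ
      have hs := Real.sin_pos_of_pos_of_lt_pi hχ.1 hχ.2
      have h1 := (Real.hasDerivAt_sin χ).rpow_const (p := 2 * β + 1) (Or.inl hs.ne')
      refine (h1.mul (hd χ)).congr_deriv ?_
      rw [add_sub_cancel_right, Real.rpow_add_one hs.ne']
      ring
    · refine (hintg.mul_continuousOn (g := fun χ => (Real.sin χ * k' χ +
        (2 * β + 1) * Real.cos χ * k χ)) (by fun_prop)).congr fun r _ => ?_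
      ring
  refine ⟨ν, Real.Gamma (β + 1) / (Real.Gamma (1 / 2) * Real.Gamma (β + 1 / 2)), hν, ?_,
    fun h => ?_, hparts, ?_⟩
  · have h1 := Real.Gamma_pos_of_pos (show 0 < β + 1 by linarith)
    have h2 := Real.Gamma_pos_of_pos (show (0 : ℝ) < 1 / 2 by norm_num)
    have h3 := Real.Gamma_pos_of_pos (show 0 < β + 1 / 2 by linarith)
    positivity
  · rw [angularMean, if_neg hb, hνint]
  -- Integration by parts with `k = 1` gives the mean of the cosine only up to the factor `2β + 1`.
  -- For `β = -1/2` the two point masses were treated directly.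
  · have h := hparts (fun _ => 1) (fun _ => 0) continuous_const fun χ => hasDerivAt_const χ 1
    simp only [mul_zero, zero_add, mul_one] at h
    rw [integral_const_mul] at h
    have h2 : 2 * β + 1 ≠ 0 := by linarith
    exact (mul_eq_zero.1 h).resolve_left h2

/-! ### Flux identities on the parameter rectangle -/

section Flux

variable {α β : ℝ} {ν ν' : Measure ℝ} {g g' : ℝ → ℝ}
  (a b : ℝ)

/-- The squared modulus of `a + r e^{iχ} b`. -/
noncomputable def modSq (a b r χ : ℝ) : ℝ := a ^ 2 + 2 * a * b * r * Real.cos χ + b ^ 2 * r ^ 2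

theorem hasDerivAt_modSq_angle (r χ : ℝ) :
    HasDerivAt (modSq a b r) (-(2 * a * b * r * Real.sin χ)) χ := by
  have h := (((Real.hasDerivAt_cos χ).const_mul (2 * a * b * r)).const_add (a ^ 2)).add_const
    (b ^ 2 * r ^ 2)
  exact h.congr_deriv (by ring)

theorem hasDerivAt_modSq_radius (r χ : ℝ) :
    HasDerivAt (fun r => modSq a b r χ) (2 * a * b * Real.cos χ + 2 * b ^ 2 * r) r := by
  have h := ((((hasDerivAt_id r).const_mul (2 * a * b)).mul_const (Real.cos χ)).const_add
    (a ^ 2)).add ((hasDerivAt_pow 2 r).const_mul (b ^ 2))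
  refine h.congr_deriv ?_
  push_cast
  ring

theorem continuous_modSq : Continuous fun p : ℝ × ℝ => modSq a b p.1 p.2 := by
  unfold modSq
  fun_prop

variable (hg' : Continuous g') (hd : ∀ y, HasDerivAt g (g' y) y)
include hg' hd

theorem integral_angular_flux
    (hA : ∀ k k' : ℝ → ℝ, Continuous k' → (∀ χ, HasDerivAt k (k' χ) χ) →
      ∫ χ in Set.Icc 0 Real.pi, (Real.sin χ * k' χ + (2 * β + 1) * Real.cos χ * k χ) ∂ν' = 0)
    (r : ℝ) :
    ∫ χ in Set.Icc 0 Real.pi, (Real.sin χ * (g' (modSq a b r χ) * -(2 * a * b * r * Real.sin χ)) +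
      (2 * β + 1) * Real.cos χ * g (modSq a b r χ)) ∂ν' = 0 := by
  have hm : Continuous (modSq a b r) :=
    (continuous_modSq a b).comp (by fun_prop : Continuous fun χ : ℝ => (r, χ))
  refine hA (fun χ => g (modSq a b r χ)) (fun χ => g' (modSq a b r χ) *
    -(2 * a * b * r * Real.sin χ)) (by fun_prop) fun χ => ?_
  exact (hd _).comp χ (hasDerivAt_modSq_angle a b r χ)

variable [IsFiniteMeasure ν] [IsFiniteMeasure ν']

/-- This and the next two identities are divergence theorems on the half-disc of the points `r
e^{iχ}`, in the angular, radial and horizontal directions. They will be used with `g = P₁`, `g' =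
P₂`. -/
theorem integral_prod_angular_flux
    (hA : ∀ k k' : ℝ → ℝ, Continuous k' → (∀ χ, HasDerivAt k (k' χ) χ) →
      ∫ χ in Set.Icc 0 Real.pi, (Real.sin χ * k' χ + (2 * β + 1) * Real.cos χ * k χ) ∂ν' = 0) :
    ∫ p in Set.Icc 0 1 ×ˢ Set.Icc 0 Real.pi, p.1 * (Real.sin p.2 *
      (g' (modSq a b p.1 p.2) * -(2 * a * b * p.1 * Real.sin p.2)) +
      (2 * β + 1) * Real.cos p.2 * g (modSq a b p.1 p.2)) ∂(ν.prod ν') = 0 := by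
  have hm := continuous_modSq a b
  have hg : Continuous g := continuous_iff_continuousAt.2 fun y => (hd y).continuousAt
  rw [setIntegral_prod _ (integrableOn_of_continuous (isCompact_Icc.prod isCompact_Icc)
    (by fun_prop))]
  have h0 : ∀ r : ℝ, ∫ χ in Set.Icc 0 Real.pi, r * (Real.sin χ *
      (g' (modSq a b r χ) * -(2 * a * b * r * Real.sin χ)) +
      (2 * β + 1) * Real.cos χ * g (modSq a b r χ)) ∂ν' = 0 := by
    intro r
    rw [integral_const_mul, integral_angular_flux a b hg' hd hA, mul_zero]
  simp only [h0, integral_zero]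

theorem integral_prod_radial_flux
    (hR : ∀ κ κ' D : ℝ → ℝ, Continuous κ' → Continuous D → (∀ r, HasDerivAt κ (κ' r) r) →
        κ 0 = 0 → (∀ r ∈ Set.Ioo (0 : ℝ) 1, (2 * β + 1) * κ r = r * D r) →
        ∫ r in Set.Icc 0 1, ((1 - r ^ 2) * κ' r + (1 - r ^ 2) * D r - 2 * (α - β) * r * κ r) ∂ν
          = 0) :
    ∫ p in Set.Icc 0 1 ×ˢ Set.Icc 0 Real.pi, ((1 - p.1 ^ 2) * p.1 *
      (g' (modSq a b p.1 p.2) * (2 * a * b * Real.cos p.2 + 2 * b ^ 2 * p.1)) +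
      ((2 * β + 2) * (1 - p.1 ^ 2) - 2 * (α - β) * p.1 ^ 2) * g (modSq a b p.1 p.2))
      ∂(ν.prod ν') = 0 := by
  have hm := continuous_modSq a b
  have hg : Continuous g := continuous_iff_continuousAt.2 fun y => (hd y).continuousAt
  have hintg : IntegrableOn (fun p : ℝ × ℝ => (1 - p.1 ^ 2) * p.1 *
      (g' (modSq a b p.1 p.2) * (2 * a * b * Real.cos p.2 + 2 * b ^ 2 * p.1)) +
      ((2 * β + 2) * (1 - p.1 ^ 2) - 2 * (α - β) * p.1 ^ 2) * g (modSq a b p.1 p.2))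
      (Set.Icc 0 1 ×ˢ Set.Icc 0 Real.pi) (ν.prod ν') :=
    integrableOn_of_continuous (isCompact_Icc.prod isCompact_Icc) (by fun_prop)
  rw [IntegrableOn, ← Measure.prod_restrict] at hintg
  rw [← Measure.prod_restrict, integral_prod_symm _ hintg]
  have h0 : ∀ χ : ℝ, ∫ r in Set.Icc 0 1, ((1 - r ^ 2) * r *
      (g' (modSq a b r χ) * (2 * a * b * Real.cos χ + 2 * b ^ 2 * r)) +
      ((2 * β + 2) * (1 - r ^ 2) - 2 * (α - β) * r ^ 2) * g (modSq a b r χ)) ∂ν = 0 := by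
    intro χ
    have hmr : Continuous fun r => modSq a b r χ :=
      hm.comp (by fun_prop : Continuous fun r : ℝ => (r, χ))
    have h := hR (fun r => r * g (modSq a b r χ)) (fun r => g (modSq a b r χ) + r *
      (g' (modSq a b r χ) * (2 * a * b * Real.cos χ + 2 * b ^ 2 * r)))
      (fun r => (2 * β + 1) * g (modSq a b r χ)) (by fun_prop) (by fun_prop)
      (fun r => ((hasDerivAt_id r).mul ((hd _).comp r
        (hasDerivAt_modSq_radius a b r χ))).congr_deriv (by simp))
      (zero_mul _) (fun r _ => by ring)
    refine (setIntegral_congr_fun measurableSet_Icc fun r _ => ?_).trans h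
    ring
  simp only [h0, integral_zero]

/-- The derivative along the real axis mixes `∂_r` and `∂_χ`. Radial integration by parts is applied
to `κ(r) = ∫ cos χ · g`; the angular identity turns `(2β + 1) κ` into `r D`, and `κ(0) = 0` because
the cosine has mean zero. -/
theorem integral_prod_horizontal_flux
    (hR : ∀ κ κ' D : ℝ → ℝ, Continuous κ' → Continuous D → (∀ r, HasDerivAt κ (κ' r) r) →
        κ 0 = 0 → (∀ r ∈ Set.Ioo (0 : ℝ) 1, (2 * β + 1) * κ r = r * D r) →
        ∫ r in Set.Icc 0 1, ((1 - r ^ 2) * κ' r + (1 - r ^ 2) * D r - 2 * (α - β) * r * κ r) ∂ν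
          = 0)
    (hA : ∀ k k' : ℝ → ℝ, Continuous k' → (∀ χ, HasDerivAt k (k' χ) χ) →
      ∫ χ in Set.Icc 0 Real.pi, (Real.sin χ * k' χ + (2 * β + 1) * Real.cos χ * k χ) ∂ν' = 0)
    (hcos : ∫ χ in Set.Icc 0 Real.pi, Real.cos χ ∂ν' = 0) :
    ∫ p in Set.Icc 0 1 ×ˢ Set.Icc 0 Real.pi, ((1 - p.1 ^ 2) *
      (g' (modSq a b p.1 p.2) * (2 * a * b + 2 * b ^ 2 * p.1 * Real.cos p.2)) -
      2 * (α - β) * p.1 * Real.cos p.2 * g (modSq a b p.1 p.2)) ∂(ν.prod ν') = 0 := by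
  have hm := continuous_modSq a b
  have hg : Continuous g := continuous_iff_continuousAt.2 fun y => (hd y).continuousAt
  have hmr : ∀ r, Continuous (modSq a b r) := fun r =>
    hm.comp (by fun_prop : Continuous fun χ : ℝ => (r, χ))
  rw [setIntegral_prod _ (integrableOn_of_continuous (isCompact_Icc.prod isCompact_Icc)
    (by fun_prop))]
  obtain ⟨F, hF⟩ : ∃ F : ℝ → ℝ → ℝ, ∀ r χ, F r χ = Real.cos χ * g (modSq a b r χ) :=
    ⟨_, fun _ _ => rfl⟩
  obtain ⟨F', hF'⟩ : ∃ F' : ℝ → ℝ → ℝ, ∀ r χ, F' r χ = Real.cos χ * (g' (modSq a b r χ) *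
    (2 * a * b * Real.cos χ + 2 * b ^ 2 * r)) := ⟨_, fun _ _ => rfl⟩
  obtain ⟨E, hE⟩ : ∃ E : ℝ → ℝ → ℝ, ∀ r χ, E r χ = 2 * a * b * Real.sin χ ^ 2 *
    g' (modSq a b r χ) := ⟨_, fun _ _ => rfl⟩
  have cF : Continuous (Function.uncurry F) := by
    simp only [hF, Function.uncurry_def]; fun_prop
  have cF' : Continuous (Function.uncurry F') := by
    simp only [hF', Function.uncurry_def]; fun_prop
  have cE : Continuous (Function.uncurry E) := by
    simp only [hE, Function.uncurry_def]; fun_prop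
  have iF : ∀ r, IntegrableOn (F r) (Set.Icc 0 Real.pi) ν' := fun r =>
    integrableOn_of_continuous isCompact_Icc (cF.comp (by fun_prop : Continuous fun χ : ℝ => (r, χ)))
  have iF' : ∀ r, IntegrableOn (F' r) (Set.Icc 0 Real.pi) ν' := fun r =>
    integrableOn_of_continuous isCompact_Icc
      (cF'.comp (by fun_prop : Continuous fun χ : ℝ => (r, χ)))
  have iE : ∀ r, IntegrableOn (E r) (Set.Icc 0 Real.pi) ν' := fun r =>
    integrableOn_of_continuous isCompact_Icc (cE.comp (by fun_prop : Continuous fun χ : ℝ => (r, χ)))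
  have h := hR (fun r => ∫ χ in Set.Icc 0 Real.pi, F r χ ∂ν')
    (fun r => ∫ χ in Set.Icc 0 Real.pi, F' r χ ∂ν') (fun r => ∫ χ in Set.Icc 0 Real.pi, E r χ ∂ν')
    (continuous_parametric_integral_of_continuous cF' isCompact_Icc)
    (continuous_parametric_integral_of_continuous cE isCompact_Icc)
    (hasDerivAt_setIntegral isCompact_Icc cF cF' fun r χ => by
      simp only [hF, hF']
      exact ((hd (modSq a b r χ)).comp r (hasDerivAt_modSq_radius a b r χ)).const_mul (Real.cos χ))
    (by
      simp only [hF, modSq, mul_zero, zero_mul, add_zero, ne_eq, OfNat.ofNat_ne_zero,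
        not_false_eq_true, zero_pow]
      rw [integral_mul_const, hcos, zero_mul])
    (fun r _ => by
      have h1 := integral_angular_flux a b hg' hd hA r
      have h2 : ∫ χ in Set.Icc 0 Real.pi, ((2 * β + 1) * F r χ - r * E r χ) ∂ν' = 0 := by
        refine (setIntegral_congr_fun measurableSet_Icc fun χ _ => ?_).trans h1
        simp only [hF, hE]
        ring
      rw [integral_sub ((iF r).const_mul _) ((iE r).const_mul _), integral_const_mul,
        integral_const_mul] at h2
      linarith)
  refine (setIntegral_congr_fun measurableSet_Icc fun r _ => ?_).trans h
  have i1 : IntegrableOn (fun χ => (1 - r ^ 2) * F' r χ + (1 - r ^ 2) * E r χ)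
      (Set.Icc 0 Real.pi) ν' := ((iF' r).const_mul _).add ((iE r).const_mul _)
  simp only
  rw [← integral_const_mul, ← integral_const_mul, ← integral_const_mul,
    ← integral_add ((iF' r).const_mul _) ((iE r).const_mul _),
    ← integral_sub i1 ((iF r).const_mul _)]
  refine setIntegral_congr_fun measurableSet_Icc fun χ _ => ?_
  simp only [hF, hF', hE]
  have hsc := Real.sin_sq_add_cos_sq χ
  linear_combination -((1 - r ^ 2) * g' (modSq a b r χ) * (2 * a * b)) * hsc

end Flux

/-! ### The product formula -/

section Algebra

variable {c s C S r k y yx : ℝ}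

/-- With `z = sin χ`, `k = cos χ`, this compares the second order terms of the Jacobi operator in
`x` with those of the radial equation at `y`. `second_deriv_modSq_add` does the same for first order
terms. Both differences are combinations of the three fluxes with the same coefficients. -/
theorem sq_deriv_modSq_sub {z : ℝ} (hc : c ^ 2 = s ^ 2 + 1) (hC : C ^ 2 = S ^ 2 + 1)
    (hk : z ^ 2 + k ^ 2 = 1)
    (hy : y = (c * C) ^ 2 + 2 * (c * C) * (s * S) * r * k + (s * S) ^ 2 * r ^ 2)
    (hyx : yx = 2 * c ^ 2 * (C * S) + 2 * c * s * (S ^ 2 + C ^ 2) * r * k +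
      2 * s ^ 2 * (C * S) * r ^ 2) :
    yx ^ 2 - 4 * y * (y - 1) =
      -4 * c ^ 2 * s ^ 2 * C ^ 2 * (1 - r ^ 2) - 4 * c * s ^ 3 * C * S * (1 - r ^ 2) * r * k
      - 4 * c ^ 2 * s ^ 2 * r ^ 2 * z ^ 2
      - 2 * s ^ 2 * (1 - r ^ 2) * r * (2 * c * s * C * S * k + 2 * s ^ 2 * S ^ 2 * r) := by
  subst hy hyx
  grind

theorem second_deriv_modSq_add {α β yxx : ℝ} (hC0 : C ≠ 0) (hS0 : S ≠ 0) (hc : c ^ 2 = s ^ 2 + 1)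
    (hC : C ^ 2 = S ^ 2 + 1)
    (hy : y = (c * C) ^ 2 + 2 * (c * C) * (s * S) * r * k + (s * S) ^ 2 * r ^ 2)
    (hyx : yx = 2 * c ^ 2 * (C * S) + 2 * c * s * (S ^ 2 + C ^ 2) * r * k +
      2 * s ^ 2 * (C * S) * r ^ 2)
    (hyxx : yxx = 2 * c ^ 2 * (S ^ 2 + C ^ 2) + 8 * c * s * (C * S) * r * k +
      2 * s ^ 2 * (S ^ 2 + C ^ 2) * r ^ 2) :
    yxx + ((2 * α + 1) * (C / S) + (2 * β + 1) * (S / C)) * yx -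
      4 * ((α + β + 2) * y - (β + 1)) =
      -(2 * c * s * C / S) * (-(2 * (α - β) * r * k)) +
      2 * c * s * (C / S - S / C) * r * ((2 * β + 1) * k)
      - 2 * s ^ 2 * ((2 * β + 2) * (1 - r ^ 2) - 2 * (α - β) * r ^ 2) := by
  subst hy hyx hyxx
  field_simp
  grind

end Algebra

/-- The modulus is at least `A - |B|`, with `A` and `B` the products of hyperbolic cosines and
sines, and `A ± B = cosh (t ± x) ≥ 1`. -/
theorem one_le_modSq (t x χ : ℝ) {r : ℝ} (hr0 : 0 ≤ r) (hr1 : r ≤ 1) :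
    1 ≤ modSq (Real.cosh t * Real.cosh x) (Real.sinh t * Real.sinh x) r χ := by
  have h1 := Real.one_le_cosh (t - x)
  have h2 := Real.one_le_cosh (t + x)
  rw [Real.cosh_sub] at h1
  rw [Real.cosh_add] at h2
  have hA : 0 < Real.cosh t * Real.cosh x := mul_pos (Real.cosh_pos t) (Real.cosh_pos x)
  generalize Real.cosh t * Real.cosh x = A at *
  generalize Real.sinh t * Real.sinh x = B at *
  have habs : |B| ≤ A - 1 := abs_le.2 ⟨by linarith, by linarith⟩
  have h3 : -|B| ≤ B * Real.cos χ := by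
    have : |B * Real.cos χ| ≤ |B| := by
      rw [abs_mul]
      exact mul_le_of_le_one_right (abs_nonneg B) (Real.abs_cos_le_one χ)
    linarith [neg_abs_le (B * Real.cos χ)]
  have h4 : |B| * r ≤ |B| := mul_le_of_le_one_right (abs_nonneg B) hr1
  have h5 : (A - |B| * r) ^ 2 ≤ modSq A B r χ := by
    unfold modSq
    have h6 : 0 ≤ A * r * (B * Real.cos χ + |B|) :=
      mul_nonneg (mul_nonneg hA.le hr0) (by linarith)
    have h7 : |B| ^ 2 = B ^ 2 := sq_abs B
    nlinarith
  have h8 : 1 ≤ A - |B| * r := by linarith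
  nlinarith

section Parameters

variable {α β : ℝ} (hβ : -1 / 2 ≤ β) (hβα : β ≤ α) (hα : -1 / 2 < α)
include hβ hβα hα

/-- The radial form of the Jacobi function agrees on `[1, ∞)` with a function that is `C²` on the
whole line. -/
theorem exists_extension_radialPhi (l : ℝ) : ∃ P P₁ P₂ : ℝ → ℝ, Continuous P₂ ∧
    (∀ y, HasDerivAt P (P₁ y) y) ∧ (∀ y, HasDerivAt P₁ (P₂ y) y) ∧
    ∀ y, 1 ≤ y → P y = radialPhi α β l y ∧
      y * (y - 1) * P₂ y + ((α + β + 2) * y - (β + 1)) * P₁ y +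
      (l ^ 2 + (α + β + 1) ^ 2) / 4 * P y = 0 := by
  set Φ := radialPhi α β l with hΦ
  have han : ∀ y, 1 ≤ y → AnalyticAt ℝ Φ y := fun y hy =>
    analyticAt_radialPhi hβ hβα hα l (by linarith)
  -- The second derivative is frozen to the left of 1 and then integrated twice.
  set P₂ : ℝ → ℝ := fun y => deriv (deriv Φ) (max y 1) with hP₂
  have c₂ : Continuous P₂ := by
    refine continuous_iff_continuousAt.2 fun y => ?_
    exact ContinuousAt.comp (f := fun y : ℝ => max y 1)
      (han _ (le_max_right y 1)).deriv.deriv.continuousAt (by fun_prop)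
  set P₁ : ℝ → ℝ := fun y => deriv Φ 1 + ∫ u in (1 : ℝ)..y, P₂ u with hP₁
  have d₁ : ∀ y, HasDerivAt P₁ (P₂ y) y := fun y =>
    (intervalIntegral.integral_hasDerivAt_right (c₂.intervalIntegrable 1 y)
      (c₂.stronglyMeasurableAtFilter _ _) c₂.continuousAt).const_add _
  have c₁ : Continuous P₁ := continuous_iff_continuousAt.2 fun y => (d₁ y).continuousAt
  set P : ℝ → ℝ := fun y => Φ 1 + ∫ u in (1 : ℝ)..y, P₁ u with hP
  have d₀ : ∀ y, HasDerivAt P (P₁ y) y := fun y =>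
    (intervalIntegral.integral_hasDerivAt_right (c₁.intervalIntegrable 1 y)
      (c₁.stronglyMeasurableAtFilter _ _) c₁.continuousAt).const_add _
  have e₂ : ∀ y, 1 ≤ y → P₂ y = deriv (deriv Φ) y := fun y hy => by
    simp only [hP₂, max_eq_left hy]
  have e₁ : ∀ y, 1 ≤ y → P₁ y = deriv Φ y := by
    intro y hy
    have := intervalIntegral.integral_eq_sub_of_hasDerivAt (f := deriv Φ) (f' := P₂) (a := 1)
      (b := y) (fun u hu => by
        rw [Set.uIcc_of_le hy] at hu
        rw [e₂ u hu.1]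
        exact (han u hu.1).deriv.differentiableAt.hasDerivAt) (c₂.intervalIntegrable 1 y)
    simp only [hP₁, this]
    ring
  have e₀ : ∀ y, 1 ≤ y → P y = Φ y := by
    intro y hy
    have := intervalIntegral.integral_eq_sub_of_hasDerivAt (f := Φ) (f' := P₁) (a := 1)
      (b := y) (fun u hu => by
        rw [Set.uIcc_of_le hy] at hu
        rw [e₁ u hu.1]
        exact (han u hu.1).differentiableAt.hasDerivAt) (c₁.intervalIntegrable 1 y)
    simp only [hP, this]
    ring
  refine ⟨P, P₁, P₂, c₂, d₀, d₁, fun y hy => ⟨e₀ y hy, ?_⟩⟩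
  rw [e₀ y hy, e₁ y hy, e₂ y hy]
  exact radialPhi_ode hβ hβα hα l (by linarith)

/-- The product formula, up to the total mass. The left side `U(x)` satisfies the Jacobi equation in
`x`, since the defect integrates to zero by the flux identities. Its Cauchy data at 0 are those of
`M φ_l(t) φ_l(x)`, and the energy estimate gives uniqueness. -/
theorem integral_radialPhi_modSq {ν ν' : Measure ℝ} [IsFiniteMeasure ν] [IsFiniteMeasure ν']
    (hR : ∀ κ κ' D : ℝ → ℝ, Continuous κ' → Continuous D → (∀ r, HasDerivAt κ (κ' r) r) →
        κ 0 = 0 → (∀ r ∈ Set.Ioo (0 : ℝ) 1, (2 * β + 1) * κ r = r * D r) →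
        ∫ r in Set.Icc 0 1, ((1 - r ^ 2) * κ' r + (1 - r ^ 2) * D r - 2 * (α - β) * r * κ r) ∂ν
          = 0)
    (hA : ∀ k k' : ℝ → ℝ, Continuous k' → (∀ χ, HasDerivAt k (k' χ) χ) →
      ∫ χ in Set.Icc 0 Real.pi, (Real.sin χ * k' χ + (2 * β + 1) * Real.cos χ * k χ) ∂ν' = 0)
    (hcos : ∫ χ in Set.Icc 0 Real.pi, Real.cos χ ∂ν' = 0)
    (l t : ℝ) {P P₁ P₂ : ℝ → ℝ} (c₂ : Continuous P₂) (d₀ : ∀ y, HasDerivAt P (P₁ y) y)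
    (d₁ : ∀ y, HasDerivAt P₁ (P₂ y) y)
    (hP : ∀ y, 1 ≤ y → P y = radialPhi α β l y ∧
      y * (y - 1) * P₂ y + ((α + β + 2) * y - (β + 1)) * P₁ y +
      (l ^ 2 + (α + β + 1) ^ 2) / 4 * P y = 0) {x : ℝ} (hx : 0 ≤ x) :
    ∫ p in Set.Icc 0 1 ×ˢ Set.Icc 0 Real.pi,
      P (modSq (Real.cosh t * Real.cosh x) (Real.sinh t * Real.sinh x) p.1 p.2) ∂(ν.prod ν') =
      (ν.prod ν').real (Set.Icc 0 1 ×ˢ Set.Icc 0 Real.pi) *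
        (jacobiPhi α β l t * jacobiPhi α β l x) := by
  have c₁ : Continuous P₁ := continuous_iff_continuousAt.2 fun y => (d₁ y).continuousAt
  have c₀ : Continuous P := continuous_iff_continuousAt.2 fun y => (d₀ y).continuousAt
  set K : Set (ℝ × ℝ) := Set.Icc 0 1 ×ˢ Set.Icc 0 Real.pi with hKdef
  have hK : IsCompact K := isCompact_Icc.prod isCompact_Icc
  set c := Real.cosh t with hc
  set s := Real.sinh t with hs
  have hcs : c ^ 2 = s ^ 2 + 1 := Real.cosh_sq t
  obtain ⟨Y, hY⟩ : ∃ Y : ℝ → ℝ × ℝ → ℝ, ∀ x p, Y x p =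
      modSq (c * Real.cosh x) (s * Real.sinh x) p.1 p.2 := ⟨_, fun _ _ => rfl⟩
  obtain ⟨Yx, hYx⟩ : ∃ Yx : ℝ → ℝ × ℝ → ℝ, ∀ x p, Yx x p =
      2 * c ^ 2 * (Real.cosh x * Real.sinh x) +
      2 * c * s * (Real.sinh x ^ 2 + Real.cosh x ^ 2) * p.1 * Real.cos p.2 +
      2 * s ^ 2 * (Real.cosh x * Real.sinh x) * p.1 ^ 2 := ⟨_, fun _ _ => rfl⟩
  obtain ⟨Yxx, hYxx⟩ : ∃ Yxx : ℝ → ℝ × ℝ → ℝ, ∀ x p, Yxx x p =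
      2 * c ^ 2 * (Real.sinh x ^ 2 + Real.cosh x ^ 2) +
      8 * c * s * (Real.cosh x * Real.sinh x) * p.1 * Real.cos p.2 +
      2 * s ^ 2 * (Real.sinh x ^ 2 + Real.cosh x ^ 2) * p.1 ^ 2 := ⟨_, fun _ _ => rfl⟩
  have cY : Continuous (Function.uncurry Y) := by
    simp only [Function.uncurry_def, hY, modSq]; fun_prop
  have cYx : Continuous (Function.uncurry Yx) := by
    simp only [Function.uncurry_def, hYx]; fun_prop
  have cYxx : Continuous (Function.uncurry Yxx) := by
    simp only [Function.uncurry_def, hYxx]; fun_prop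
  have hcd := fun x => Real.hasDerivAt_cosh x
  have hsd := fun x => Real.hasDerivAt_sinh x
  have dY : ∀ x p, HasDerivAt (fun x => Y x p) (Yx x p) x := by
    intro x p
    simp only [hY, hYx, modSq]
    have h := (((((hcd x).const_mul c).pow 2).add (((((hcd x).const_mul c).const_mul 2).mul
      ((hsd x).const_mul s)).mul_const p.1 |>.mul_const (Real.cos p.2)))).add
      ((((hsd x).const_mul s).pow 2).mul_const (p.1 ^ 2))
    refine h.congr_deriv ?_
    push_cast
    ring
  have dYx : ∀ x p, HasDerivAt (fun x => Yx x p) (Yxx x p) x := by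
    intro x p
    simp only [hYx, hYxx]
    have h1 := (hcd x).mul (hsd x)
    have h2 := (((hsd x).pow 2).add ((hcd x).pow 2)).const_mul (2 * c * s)
    have h := ((h1.const_mul (2 * c ^ 2)).add ((h2.mul_const p.1).mul_const (Real.cos p.2))).add
      ((h1.const_mul (2 * s ^ 2)).mul_const (p.1 ^ 2))
    refine h.congr_deriv ?_
    push_cast
    ring
  have cU : Continuous (Function.uncurry fun x p => P (Y x p)) := c₀.comp cY
  have cU' : Continuous (Function.uncurry fun x p => P₁ (Y x p) * Yx x p) :=
    (c₁.comp cY).mul cYx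
  have cU'' : Continuous (Function.uncurry fun x p =>
      P₂ (Y x p) * Yx x p * Yx x p + P₁ (Y x p) * Yxx x p) :=
    (((c₂.comp cY).mul cYx).mul cYx).add ((c₁.comp cY).mul cYxx)
  have dU := hasDerivAt_setIntegral (ν := ν.prod ν') hK cU cU' fun x p => (d₀ _).comp x (dY x p)
  have dU' := hasDerivAt_setIntegral (ν := ν.prod ν') hK cU' cU'' fun x p =>
    ((d₁ _).comp x (dY x p)).mul (dYx x p)
  set M := (ν.prod ν').real K with hM
  set U : ℝ → ℝ := fun x => ∫ p in K, P (Y x p) ∂(ν.prod ν') with hU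
  set U' : ℝ → ℝ := fun x => ∫ p in K, P₁ (Y x p) * Yx x p ∂(ν.prod ν') with hU'
  have hode : ∀ x, 0 < x → ∫ p in K, (P₂ (Y x p) * Yx x p * Yx x p + P₁ (Y x p) * Yxx x p)
      ∂(ν.prod ν') = -drift α β x * U' x - (l ^ 2 + (α + β + 1) ^ 2) * U x := by
    intro x hx
    have hS := (Real.sinh_pos_iff.2 hx).ne'
    have hC := (Real.cosh_pos x).ne'
    have hCS : Real.cosh x ^ 2 = Real.sinh x ^ 2 + 1 := Real.cosh_sq x
    have f1 := integral_prod_angular_flux (ν := ν) (c * Real.cosh x) (s * Real.sinh x) c₂ d₁ hA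
    have f2 := integral_prod_radial_flux (ν' := ν') (c * Real.cosh x) (s * Real.sinh x) c₂ d₁ hR
    have f3 := integral_prod_horizontal_flux (c * Real.cosh x) (s * Real.sinh x) c₂ d₁ hR hA hcos
    have hYc : Continuous fun p : ℝ × ℝ =>
        modSq (c * Real.cosh x) (s * Real.sinh x) p.1 p.2 := continuous_modSq _ _
    -- The three multipliers depend only on `t` and `x`; they are the coefficients for which the
    -- combined fluxes equal the defect of the Jacobi equation.
    have hsum := congrArg₂ (· + ·) (congrArg₂ (· + ·)
      (congrArg (fun z => (2 * c * s * (Real.cosh x / Real.sinh x - Real.sinh x / Real.cosh x)) * z)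
        f1) (congrArg (fun z => (-2 * s ^ 2) * z) f2))
      (congrArg (fun z => (-(2 * c * s * Real.cosh x / Real.sinh x)) * z) f3)
    simp only [mul_zero, add_zero] at hsum
    rw [← integral_const_mul, ← integral_const_mul, ← integral_const_mul,
      ← integral_add (integrableOn_of_continuous hK (by fun_prop))
        (integrableOn_of_continuous hK (by fun_prop)),
      ← integral_add (integrableOn_of_continuous hK (by fun_prop))
        (integrableOn_of_continuous hK (by fun_prop))] at hsum
    have cYi : Continuous (Y x) := cY.comp (by fun_prop : Continuous fun p : ℝ × ℝ => (x, p))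
    have cYxi : Continuous (Yx x) := cYx.comp (by fun_prop : Continuous fun p : ℝ × ℝ => (x, p))
    have cYxxi : Continuous (Yxx x) :=
      cYxx.comp (by fun_prop : Continuous fun p : ℝ × ℝ => (x, p))
    have hgoal : ∫ p in K, ((P₂ (Y x p) * Yx x p * Yx x p + P₁ (Y x p) * Yxx x p) +
        drift α β x * (P₁ (Y x p) * Yx x p) +
        (l ^ 2 + (α + β + 1) ^ 2) * P (Y x p)) ∂(ν.prod ν') = 0 := by
      refine (setIntegral_congr_fun hK.measurableSet fun p hp => ?_).trans hsum
      have hYp := hY x p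
      have h1 : 1 ≤ Y x p := by
        rw [hYp]; exact one_le_modSq t x p.2 hp.1.1 hp.1.2
      have hPp := (hP _ h1).2
      rw [modSq] at hYp
      have A2 := sq_deriv_modSq_sub hcs hCS (Real.sin_sq_add_cos_sq p.2) hYp (hYx x p)
      have A1 := second_deriv_modSq_add (α := α) (β := β) hC hS hcs hCS hYp (hYx x p) (hYxx x p)
      simp only [← hY x p, drift]
      generalize P₂ (Y x p) = p2 at *
      generalize P₁ (Y x p) = p1 at *
      generalize P (Y x p) = p0 at *
      have B2 : Yx x p ^ 2 - 4 * Y x p * (Y x p - 1) =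
          2 * c * s * (Real.cosh x / Real.sinh x - Real.sinh x / Real.cosh x) * (p.1 *
          (Real.sin p.2 * -(2 * (c * Real.cosh x) * (s * Real.sinh x) * p.1 * Real.sin p.2))) +
          -2 * s ^ 2 * ((1 - p.1 ^ 2) * p.1 * (2 * (c * Real.cosh x) * (s * Real.sinh x) *
            Real.cos p.2 + 2 * (s * Real.sinh x) ^ 2 * p.1)) +
          -(2 * c * s * Real.cosh x / Real.sinh x) * ((1 - p.1 ^ 2) * (2 * (c * Real.cosh x) *
            (s * Real.sinh x) + 2 * (s * Real.sinh x) ^ 2 * p.1 * Real.cos p.2)) := by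
        rw [A2]
        field_simp
        linear_combination (4 * c ^ 2 * s ^ 2 * p.1 ^ 2 * Real.sin p.2 ^ 2) * hCS
      linear_combination p2 * B2 + p1 * A1 + 4 * hPp
    rw [integral_add (integrableOn_of_continuous hK (by fun_prop))
        (integrableOn_of_continuous hK (by fun_prop)),
      integral_add (integrableOn_of_continuous hK (by fun_prop))
        (integrableOn_of_continuous hK (by fun_prop)), integral_const_mul,
      integral_const_mul] at hgoal
    linarith
  have hY0 : ∀ p, Y 0 p = c ^ 2 := by intro p; simp [hY, modSq]
  have hU0 : U 0 = M * jacobiPhi α β l t := by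
    have hP1 := (hP (c ^ 2) (by nlinarith [Real.one_le_cosh t])).1
    simp only [hU, hY0, setIntegral_const, smul_eq_mul]
    rw [hP1, jacobiPhi_eq_radialPhi]
  have hU'0 : U' 0 = 0 := by
    have hi : ∫ p in K, p.1 * Real.cos p.2 ∂(ν.prod ν') = 0 := by
      rw [hKdef, setIntegral_prod_mul (fun r : ℝ => r) (fun χ : ℝ => Real.cos χ), hcos, mul_zero]
    simp only [hU', hY0, hYx]
    have e : ∀ p : ℝ × ℝ, P₁ (c ^ 2) * (2 * c ^ 2 * (Real.cosh 0 * Real.sinh 0) +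
        2 * c * s * (Real.sinh 0 ^ 2 + Real.cosh 0 ^ 2) * p.1 * Real.cos p.2 +
        2 * s ^ 2 * (Real.cosh 0 * Real.sinh 0) * p.1 ^ 2) =
        (P₁ (c ^ 2) * (2 * c * s)) * (p.1 * Real.cos p.2) := by
      intro p
      simp
      ring
    simp only [e]
    rw [integral_const_mul, hi, mul_zero]
  have hκ : 0 < l ^ 2 + (α + β + 1) ^ 2 := by
    have : 0 < α + β + 1 := by linarith
    positivity
  have cUx : Continuous U := continuous_iff_continuousAt.2 fun x => (dU x).continuousAt
  have cUx' : Continuous U' := continuous_iff_continuousAt.2 fun x => (dU' x).continuousAt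
  have hφc := continuous_jacobiPhi hβ hβα hα l
  have hφc' := continuous_deriv_jacobiPhi hβ hβα hα l
  have hen := energy_le (q := drift α β) (f := 0) (δ := 0) (T := x) hκ.le
    (u := fun x => U x - M * jacobiPhi α β l t * jacobiPhi α β l x)
    (u' := fun x => U' x - M * jacobiPhi α β l t * deriv (jacobiPhi α β l) x)
    (fun u hu => drift_nonneg hβ hα hu.1) (by simp) (by fun_prop) (by fun_prop)
    (fun u hu => (dU u).sub ((hasDerivAt_jacobiPhi hβ hβα hα l u).const_mul _))
    (fun u hu => ((dU' u).sub ((jacobiPhi_ode hβ hβα hα l hu.1).const_mul _)).congr_deriv (by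
      rw [hode u hu.1]
      simp only [Pi.zero_apply]
      ring)) (t := x) ⟨hx, le_rfl⟩
  simp only [hU0, hU'0, deriv_jacobiPhi_zero_right hβ hβα hα, jacobiPhi_zero_right] at hen
  have hz : U x - M * jacobiPhi α β l t * jacobiPhi α β l x = 0 := by
    have h1 : (l ^ 2 + (α + β + 1) ^ 2) *
        (U x - M * jacobiPhi α β l t * jacobiPhi α β l x) ^ 2 ≤ 0 := by
      nlinarith [sq_nonneg (U' x - M * jacobiPhi α β l t * deriv (jacobiPhi α β l) x)]
    have h2 : (U x - M * jacobiPhi α β l t * jacobiPhi α β l x) ^ 2 ≤ 0 := by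
      by_contra hneg
      push Not at hneg
      linarith [mul_pos hκ hneg]
    exact pow_eq_zero_iff two_ne_zero |>.1 (le_antisymm h2 (sq_nonneg _))
  have hfin : U x = M * (jacobiPhi α β l t * jacobiPhi α β l x) := by linarith
  rw [← hfin]
  simp only [hU, hY]

end Parameters

/-! ### Nonnegative combinations of Jacobi functions -/

section PosDef

variable {α β : ℝ} (hβ : -1 / 2 ≤ β) (hβα : β ≤ α) (hα : -1 / 2 < α)

theorem norm_add_mul_exp_sq (a b r χ : ℝ) :
    ‖(a : ℂ) + (r : ℂ) * Complex.exp (Complex.I * χ) * (b : ℂ)‖ ^ 2 = modSq a b r χ := by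
  rw [mul_comm Complex.I, Complex.exp_mul_I, ← Complex.normSq_eq_norm_sq, Complex.normSq_apply,
    ← Complex.ofReal_cos, ← Complex.ofReal_sin]
  simp only [Complex.add_re, Complex.mul_re, Complex.ofReal_re, Complex.ofReal_im, Complex.add_im,
    Complex.mul_im, Complex.I_re, Complex.I_im, modSq]
  have := Real.sin_sq_add_cos_sq χ
  linear_combination b ^ 2 * r ^ 2 * this

theorem jacobiPhi_arcosh_norm (l t x : ℝ) {r χ : ℝ} (hr0 : 0 ≤ r) (hr1 : r ≤ 1) :
    jacobiPhi α β l (Real.arcosh ‖((Real.cosh t * Real.cosh x : ℝ) : ℂ) +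
      (r : ℂ) * Complex.exp (Complex.I * χ) * ((Real.sinh t * Real.sinh x : ℝ) : ℂ)‖) =
    radialPhi α β l (modSq (Real.cosh t * Real.cosh x) (Real.sinh t * Real.sinh x) r χ) := by
  have h1 := one_le_modSq t x χ hr0 hr1
  rw [← norm_add_mul_exp_sq] at h1 ⊢
  rw [jacobiPhi_eq_radialPhi, Real.cosh_arcosh]
  exact (one_le_sq_iff₀ (norm_nonneg _)).1 h1

include hβ hβα hα

/-- The constant `K` collects the normalisations of the two means. Its sign suffices for positive
definiteness, so its value is left open. -/
theorem exists_translation_sum (s : Finset ℕ) (c μ : ℕ → ℝ) :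
    ∃ K : ℝ, 0 ≤ K ∧ ∀ t x : ℝ, 0 ≤ x →
      translation α β t (fun y => ∑ i ∈ s, c i * jacobiPhi α β (μ i) y) x =
        K * ∑ i ∈ s, c i * (jacobiPhi α β (μ i) t * jacobiPhi α β (μ i) x) := by
  obtain ⟨ν, K, _, hK, hrad, hR⟩ := exists_radial_measure hβ hβα
  obtain ⟨ν', K', _, hK', hang, hA, hcos⟩ := exists_angular_measure hβ
  refine ⟨K * K' * (ν.prod ν').real (Set.Icc 0 1 ×ˢ Set.Icc 0 Real.pi), by positivity,
    fun t x hx => ?_⟩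
  have hcomp : IsCompact (Set.Icc (0 : ℝ) 1 ×ˢ Set.Icc 0 Real.pi) :=
    isCompact_Icc.prod isCompact_Icc
  choose P P₁ P₂ c₂ d₀ d₁ hP using fun l => exists_extension_radialPhi hβ hβα hα l
  have cP : ∀ l, Continuous (P l) := fun l =>
    continuous_iff_continuousAt.2 fun y => (d₀ l y).continuousAt
  set a := Real.cosh t * Real.cosh x with ha
  set b := Real.sinh t * Real.sinh x with hb
  have cF : ∀ l, Continuous fun p : ℝ × ℝ => P l (modSq a b p.1 p.2) := fun l =>
    (cP l).comp (continuous_modSq a b)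
  have key : ∀ r ∈ Set.Icc (0 : ℝ) 1, (∫ χ in Set.Icc 0 Real.pi,
      ∑ i ∈ s, c i * jacobiPhi α β (μ i) (Real.arcosh ‖((a : ℝ) : ℂ) +
        (r : ℂ) * Complex.exp (Complex.I * χ) * ((b : ℝ) : ℂ)‖) ∂ν') =
      ∫ χ in Set.Icc 0 Real.pi, ∑ i ∈ s, c i * P (μ i) (modSq a b r χ) ∂ν' := by
    intro r hr
    refine setIntegral_congr_fun measurableSet_Icc fun χ _ => Finset.sum_congr rfl fun i _ => ?_
    rw [ha, hb, jacobiPhi_arcosh_norm _ t x hr.1 hr.2, (hP (μ i) _ (one_le_modSq t x χ hr.1 hr.2)).1]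
  have cS : Continuous fun p : ℝ × ℝ => ∑ i ∈ s, c i * P (μ i) (modSq a b p.1 p.2) :=
    continuous_finsetSum _ fun i _ => (cF (μ i)).const_mul (c i)
  have h1 : translation α β t (fun y => ∑ i ∈ s, c i * jacobiPhi α β (μ i) y) x =
      K * (K' * ∫ p in Set.Icc 0 1 ×ˢ Set.Icc 0 Real.pi,
        ∑ i ∈ s, c i * P (μ i) (modSq a b p.1 p.2) ∂(ν.prod ν')) := by
    rw [translation, hrad, setIntegral_prod _ (integrableOn_of_continuous hcomp cS),
      ← integral_const_mul K']
    refine congrArg (K * ·) (setIntegral_congr_fun (measurableSet_Icc (α := ℝ)) fun r hr => ?_)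
    simp only [hang]
    rw [← key r hr]
  rw [h1, integral_finsetSum _ fun i _ =>
    (integrableOn_of_continuous hcomp (cF (μ i))).const_mul (c i)]
  simp only [integral_const_mul]
  rw [Finset.sum_congr rfl fun i _ => by
    rw [integral_radialPhi_modSq hβ hβα hα hR hA hcos (μ i) t (c₂ _) (d₀ _) (d₁ _) (hP _) hx]]
  rw [Finset.mul_sum, Finset.mul_sum, Finset.mul_sum]
  exact Finset.sum_congr rfl fun i _ => by ring

open scoped ComplexOrder in
-- By the product formula the form equals `K ∑ c_k |∑ b_i φ_{μ_k}(x_i)|²`.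
theorem isPosDef_sum (s : Finset ℕ) {c : ℕ → ℝ} (hc : ∀ i ∈ s, 0 ≤ c i) (μ : ℕ → ℝ) :
    IsPosDef α β fun t => ∑ i ∈ s, c i * jacobiPhi α β (μ i) t := by
  refine ⟨continuous_finsetSum _ fun i _ => (continuous_jacobiPhi hβ hβα hα (μ i)).const_mul _,
    fun t => by simp only [jacobiPhi_neg], fun N b x hx => ?_⟩
  obtain ⟨K, hK, hT⟩ := exists_translation_sum hβ hβα hα s c μ
  have key : ∑ i, ∑ j, b i * (starRingEnd ℂ) (b j) * ((translation α β (x i)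
      (fun t => ∑ i ∈ s, c i * jacobiPhi α β (μ i) t) (x j) : ℝ) : ℂ) =
      ((K * ∑ k ∈ s, c k * ‖∑ i, b i * (jacobiPhi α β (μ k) (x i) : ℂ)‖ ^ 2 : ℝ) : ℂ) := by
    push_cast
    simp only [← Complex.mul_conj', map_sum, map_mul, Complex.conj_ofReal,
      Finset.sum_mul_sum]
    simp only [Finset.mul_sum]
    simp only [hT _ _ (hx _)]
    push_cast
    simp only [Finset.mul_sum]
    rw [Finset.sum_congr rfl fun i _ => Finset.sum_comm, Finset.sum_comm]
    exact Finset.sum_congr rfl fun k _ => Finset.sum_congr rfl fun i _ =>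
      Finset.sum_congr rfl fun j _ => by ring
  rw [key]
  exact_mod_cast mul_nonneg hK (Finset.sum_nonneg fun k hk => mul_nonneg (hc k hk) (by positivity))

omit hβ hβα hα in
theorem sum_mem_classL {γ : ℝ} {s : Finset ℕ} {c μ : ℕ → ℝ} (hc : ∀ i ∈ s, 0 < c i)
    (hs : s.Nonempty) (hμ : ∀ i ∈ s, μ i ∈ Set.Icc 0 γ) :
    (fun t => ∑ i ∈ s, c i * jacobiPhi α β (μ i) t) ∈ classL α β γ := by
  refine ⟨⟨∑ i ∈ s, ENNReal.ofReal (c i) • Measure.dirac (μ i), ?_, fun t => ?_⟩, ?_⟩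
  · refine ⟨?_⟩
    rw [Measure.finsetSum_apply]
    exact ENNReal.sum_lt_top.2 fun i _ => by simp
  · have hr : (∑ i ∈ s, ENNReal.ofReal (c i) • Measure.dirac (μ i)).restrict (Set.Icc 0 γ) =
        ∑ i ∈ s, ENNReal.ofReal (c i) • Measure.dirac (μ i) := by
      refine Measure.restrict_eq_self_of_ae_mem ?_
      rw [ae_iff, Measure.finsetSum_apply]
      refine Finset.sum_eq_zero fun i hi => ?_
      rw [Measure.smul_apply, Measure.dirac_apply' _ (by exact measurableSet_Icc.compl)]
      simp [Set.mem_Icc.1 (hμ i hi)]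
    rw [hr, integral_finsetSum_measure fun i _ => ?_]
    · refine Finset.sum_congr rfl fun i hi => ?_
      rw [integral_smul_measure, integral_dirac, ENNReal.toReal_ofReal (hc i hi).le, smul_eq_mul]
    · exact (integrable_dirac (by simp)).smul_measure ENNReal.ofReal_ne_top
  · simp only [jacobiPhi_zero_right, mul_one]
    exact Finset.sum_pos hc hs

end PosDef

/-! ### Shortest intervals -/

theorem shortestLength_eq {g : ℝ → ℝ} {θ : ℝ} {n : ℕ} (hn : 1 ≤ n) (hθ : 0 < θ)
    (hg : ∀ t ∈ Set.Icc 0 θ, g t = 0 ↔ t = θ) (ho : analyticOrderAt g θ = n) :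
    shortestLength g n = ENNReal.ofReal θ := by
  refine le_antisymm ?_ ?_
  · refine iInf₂_le θ ⟨hθ, ?_⟩
    refine le_iSup₂_of_le {θ} (by simpa using hθ.le) ?_
    simp [ho]
  · refine le_iInf₂ fun L hL => ENNReal.ofReal_le_ofReal ?_
    by_contra! hlt
    have h0 : numZeros g (Set.Icc 0 L) = 0 := by
      refine le_antisymm (iSup₂_le fun s hs => ?_) bot_le
      refine (Finset.sum_eq_zero fun t ht => ?_).le
      have ht' := hs ht
      by_contra hne
      have := (hg t ⟨ht'.1, ht'.2.trans hlt.le⟩).1 (analyticOrderAt_ne_zero.1 hne).2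
      linarith [ht'.2]
    rw [h0] at hL
    have := hL.2
    simp at this
    omega

/-! ### Zeros in the spectral parameter -/

theorem isNthPosZero_congr {f g : ℝ → ℝ} (h : ∀ x, f x = 0 ↔ g x = 0) (k : ℕ) (x : ℝ) :
    IsNthPosZero f k x ↔ IsNthPosZero g k x := by
  simp only [IsNthPosZero, h]

namespace SturmFamily

variable {w : ℝ → ℝ} {ψ : ℝ → ℝ → ℝ} (S : SturmFamily w ψ)

include S

theorem existsUnique_prufer_eq {l x : ℝ} (hl : 0 < l) (hx : 0 < x) :
    ∃ θ, 0 < θ ∧ ∀ t, 0 < t ∧ prufer w ψ l t = x ↔ t = θ := by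
  obtain ⟨θ, hθ, h⟩ := S.exists_prufer_eq hl hx
  refine ⟨θ, hθ, fun t => ⟨fun ht => ?_, ?_⟩⟩
  · exact (S.strictMonoOn_prufer_right hl).injOn (Set.mem_Ici.2 ht.1.le) (Set.mem_Ici.2 hθ.le)
      (ht.2.trans h.symm)
  · rintro rfl
    exact ⟨hθ, h⟩

/-- A level not above the angle of `l` is reached at a frequency not above `l`. This keeps the
frequencies of the extremal functions in `[0, γ]`. -/
theorem nthPosZero_spec {f : ℝ → ℝ} {k : ℕ} {l t x : ℝ} (hl : 0 < l) (ht : 0 < t) (hx : 0 < x)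
    (hxl : x ≤ prufer w ψ l t) (h : ∀ μ, IsNthPosZero f k μ ↔ 0 < μ ∧ prufer w ψ μ t = x) :
    0 < nthPosZero f k ∧ nthPosZero f k ≤ l ∧ prufer w ψ (nthPosZero f k) t = x := by
  obtain ⟨μ, hμ, hμl, hμx⟩ := S.exists_prufer_left_eq hl hx hxl
  have : nthPosZero f k = μ := by
    refine nthPosZero_eq fun y => (h y).trans ⟨fun hy => ?_, ?_⟩
    · exact (S.strictMonoOn_prufer_left ht).injOn (Set.mem_Ici.2 hy.1.le) (Set.mem_Ici.2 hμ.le)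
        (hy.2.trans hμx.symm)
    · rintro rfl
      exact ⟨hμ, hμx⟩
  rw [this]
  exact ⟨hμ, hμl, hμx⟩

theorem strictMonoOn_of_prufer {z x : ℕ → ℝ} {s : Set ℕ} {t : ℝ} (ht : 0 < t)
    (hz : ∀ i ∈ s, 0 ≤ z i) (hzx : ∀ i ∈ s, prufer w ψ (z i) t = x i) (hx : StrictMonoOn x s) :
    StrictMonoOn z s := fun i hi j hj hij => by
  refine ((S.strictMonoOn_prufer_left ht).lt_iff_lt (Set.mem_Ici.2 (hz i hi))
    (Set.mem_Ici.2 (hz j hj))).1 ?_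
  simpa only [hzx i hi, hzx j hj] using hx hi hj hij

theorem sign_deriv_of_prufer {l t : ℝ} {k : ℕ} (ht : 0 ≤ t) (hw : 0 < w t)
    (h : prufer w ψ l t = (k + 1 / 2) * Real.pi) :
    ψ l t = 0 ∧ (-1) ^ k * deriv (ψ l) t < 0 := by
  obtain ⟨R, hR, h1, h2⟩ := S.polar l ht
  have e : ((k : ℝ) + 1 / 2) * Real.pi = k * Real.pi + Real.pi / 2 := by ring
  rw [h, e, Real.cos_add_pi_div_two, Real.sin_nat_mul_pi] at h1
  rw [h, e, Real.sin_add_pi_div_two, Real.cos_nat_mul_pi] at h2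
  refine ⟨by simpa using h1, ?_⟩
  have h3 : w t * ((-1) ^ k * deriv (ψ l) t) = -R := by
    have : ((-1 : ℝ) ^ k) * (-1) ^ k = 1 := by rw [← mul_pow]; simp
    linear_combination (-1) ^ k * h2 - R * this
  exact (pos_iff_neg_of_mul_neg (by linarith)).1 hw

theorem sign_of_prufer {l t : ℝ} {k : ℕ} (ht : 0 ≤ t) (hw : 0 < w t)
    (h : prufer w ψ l t = k * Real.pi) :
    0 < (-1) ^ k * ψ l t ∧ deriv (ψ l) t = 0 := by
  obtain ⟨R, hR, h1, h2⟩ := S.polar l ht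
  rw [h, Real.cos_nat_mul_pi] at h1
  rw [h, Real.sin_nat_mul_pi] at h2
  refine ⟨?_, ?_⟩
  · have : ((-1 : ℝ) ^ k) * (-1) ^ k = 1 := by rw [← mul_pow]; simp
    rw [h1]
    nlinarith
  · have : w t * deriv (ψ l) t = 0 := by simpa using h2
    exact (mul_eq_zero.1 this).resolve_left hw.ne'

end SturmFamily

section Extremal

variable {α β : ℝ} (hβ : -1 / 2 ≤ β) (hβα : β ≤ α) (hα : -1 / 2 < α)

include hβ hβα hα

/-- A positive combination `φ_0 h` of Jacobi functions, where `h` does not vanish on `(0, θ)` and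
has a zero of order `n` at `θ`, is extremal. -/
theorem isExtremal_of_combination {γ θ : ℝ} {n : ℕ} {s : Finset ℕ} {c μ : ℕ → ℝ} {G : ℝ → ℝ}
    (hn : 1 ≤ n) (hθ : 0 < θ) (hc : ∀ i ∈ s, 0 < c i) (hs : s.Nonempty)
    (hμ : ∀ i ∈ s, μ i ∈ Set.Icc 0 γ)
    (hG : ∀ t, G t = ∑ i ∈ s, c i * jacobiPhi α β (μ i) t)
    (h0 : ∀ t, 0 < t → t < θ → combination (jacobiPsi α β) s c μ 0 t ≠ 0)
    (ho : analyticOrderAt (combination (jacobiPsi α β) s c μ 0) θ = n) :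
    IsExtremal α β γ n θ G := by
  have hGeq : G = jacobiPhi α β 0 * combination (jacobiPsi α β) s c μ 0 := by
    funext t
    rw [hG, Pi.mul_apply, combination, Finset.mul_sum]
    refine Finset.sum_congr rfl fun i _ => ?_
    rw [← jacobiPsi_mul hβ hβα hα]
    ring
  have hord : analyticOrderAt G θ = n := by
    rw [hGeq, analyticOrderAt_mul (analyticAt_jacobiPhi hβ hβα hα 0 θ)
      ((sturmFamily_jacobiPsi hβ hβα hα).analyticAt_combination s c μ 0 θ), ho,
      (analyticAt_jacobiPhi hβ hβα hα 0 θ).analyticOrderAt_eq_zero.2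
        (jacobiPhi_zero_pos hβ hβα hα θ).ne', zero_add]
  have hmem : G ∈ classL α β γ := by
    rw [funext hG]
    exact sum_mem_classL hc hs hμ
  have hzero : ∀ t ∈ Set.Icc 0 θ, G t = 0 ↔ t = θ := by
    refine fun t ht => ⟨fun h => ?_, ?_⟩
    · by_contra hne
      rcases ht.1.eq_or_lt with rfl | ht0
      · exact hmem.2.ne' h
      · rw [hGeq, Pi.mul_apply] at h
        exact (mul_ne_zero (jacobiPhi_zero_pos hβ hβα hα t).ne'
          (h0 t ht0 (lt_of_le_of_ne ht.2 hne))) h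
    · rintro rfl
      refine apply_eq_zero_of_analyticOrderAt_ne_zero ?_
      rw [hord]
      exact_mod_cast (by omega : n ≠ 0)
  refine ⟨hmem, ?_, shortestLength_eq hn hθ hzero hord, hzero, hord⟩
  rw [funext hG]
  exact isPosDef_sum hβ hβα hα s (fun i hi => (hc i hi).le) μ

theorem isNthPosZero_jacobiPhi {t : ℝ} (ht : 0 < t) {k : ℕ} (hk : 1 ≤ k) (l : ℝ) :
    IsNthPosZero (fun μ => jacobiPhi α β μ t) k l ↔ 0 < l ∧
      prufer (fun t => weight α β t * jacobiPhi α β 0 t ^ 2) (jacobiPsi α β) l t =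
        (((k - 1 : ℕ) : ℝ) + 1 / 2) * Real.pi := by
  obtain ⟨k, rfl⟩ := Nat.exists_eq_add_of_le' hk
  rw [Nat.add_sub_cancel, ← (sturmFamily_jacobiPsi hβ hβα hα).isNthPosZero_left ht]
  exact isNthPosZero_congr (fun x => (jacobiPsi_eq_zero_iff hβ hβα hα x t).symm) _ _

theorem isNthPosZero_jacobiPsiDeriv {t : ℝ} (ht : 0 < t) {k : ℕ} (hk : 1 ≤ k) (l : ℝ) :
    IsNthPosZero (fun μ => jacobiPsiDeriv α β μ t) k l ↔ 0 < l ∧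
      prufer (fun t => weight α β t * jacobiPhi α β 0 t ^ 2) (jacobiPsi α β) l t =
        k * Real.pi := by
  obtain ⟨k, rfl⟩ := Nat.exists_eq_add_of_le' hk
  push_cast
  exact (sturmFamily_jacobiPsi hβ hβα hα).isNthPosZero_deriv_left ht k l

theorem exists_isExtremal_odd {γ : ℝ} (hγ : 0 < γ) {m : ℕ} (hm : 1 ≤ m) :
    ∃ θ : ℝ, (∀ t, IsT α β m γ t ↔ t = θ) ∧
      (∀ i ∈ Finset.Icc 1 m, 0 < coeffB α β m θ i) ∧
      IsExtremal α β γ (2 * m - 1) θ (extremalOdd α β m θ) := by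
  have S := sturmFamily_jacobiPsi hβ hβα hα
  have hpi := Real.pi_pos
  -- The angle of `ψ_γ` at `θ` is `(m - 1/2)π`, so `γ` is the `m`-th frequency at `θ`.
  obtain ⟨θ, hθ, huniq⟩ := S.existsUnique_prufer_eq hγ
    (x := (((m - 1 : ℕ) : ℝ) + 1 / 2) * Real.pi) (by positivity)
  have hγθ := ((huniq θ).2 rfl).2
  have hw : 0 < weight α β θ := weight_pos α β hθ
  have hφ := jacobiPhi_zero_pos hβ hβα hα θ
  have hz : ∀ i ∈ Finset.Icc 1 m, 0 < lam α β i θ ∧ lam α β i θ ≤ γ ∧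
      prufer (fun t => weight α β t * jacobiPhi α β 0 t ^ 2) (jacobiPsi α β) (lam α β i θ) θ =
        (((i - 1 : ℕ) : ℝ) + 1 / 2) * Real.pi := fun i hi => by
    obtain ⟨hi1, him⟩ := Finset.mem_Icc.1 hi
    refine S.nthPosZero_spec hγ hθ (by positivity) ?_
      (isNthPosZero_jacobiPhi hβ hβα hα hθ hi1)
    rw [hγθ]
    have : ((i - 1 : ℕ) : ℝ) ≤ (m - 1 : ℕ) := by exact_mod_cast Nat.sub_le_sub_right him 1
    gcongr
  have hmono : StrictMonoOn (fun i => lam α β i θ) (Finset.Icc 1 m) := by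
    refine S.strictMonoOn_of_prufer hθ (fun i hi => (hz i hi).1.le) (fun i hi => (hz i hi).2.2)
      fun i hi j hj hij => ?_
    have : ((i - 1 : ℕ) : ℝ) < (j - 1 : ℕ) := by
      exact_mod_cast (by have := (Finset.mem_Icc.1 hi).1; omega : i - 1 < j - 1)
    gcongr
  have hsq : StrictMonoOn (fun i => lam α β i θ ^ 2) (Finset.Icc 1 m) := fun i hi j hj hij =>
    pow_lt_pow_left₀ (hmono hi hj hij) (hz i hi).1.le two_ne_zero
  have hsign := fun i (hi : i ∈ Finset.Icc 1 m) => S.sign_deriv_of_prufer hθ.le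
    (mul_pos hw (pow_pos hφ 2)) (hz i hi).2.2
  have hderiv : ∀ i ∈ Finset.Icc 1 m, deriv (jacobiPsi α β (lam α β i θ)) θ =
      deriv (jacobiPhi α β (lam α β i θ)) θ / jacobiPhi α β 0 θ := fun i hi => by
    rw [(hasDerivAt_jacobiPsi hβ hβα hα _ θ).deriv,
      (jacobiPsi_eq_zero_iff hβ hβα hα _ θ).1 (hsign i hi).1]
    field_simp
    ring
  have hB : ∀ i ∈ Finset.Icc 1 m, 0 < coeffB α β m θ i := fun i hi => by
    have h1 := pfCoeff_sign (z := fun j => lam α β j θ) (fun j hj => (hz j hj).1) hmono hi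
    have h2 := (hsign i hi).2
    rw [hderiv i hi, ← mul_div_assoc, div_lt_iff₀ hφ, zero_mul] at h2
    rw [coeffB]
    rcases neg_one_pow_eq_or ℝ (i - 1) with h | h <;> rw [h] at h1 h2
    · exact div_pos_of_neg_of_neg (by linarith) (mul_neg_of_pos_of_neg hw (by linarith))
    · exact div_pos (by linarith) (mul_pos hw (by linarith))
  refine ⟨θ, fun t => ?_, hB, ?_⟩
  · rw [← huniq t, IsT]
    constructor
    · exact fun h => ⟨h.1, ((isNthPosZero_jacobiPhi hβ hβα hα h.1 hm γ).1 h.2).2⟩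
    · exact fun h => ⟨h.1, (isNthPosZero_jacobiPhi hβ hβα hα h.1 hm γ).2 ⟨hγ, h.2⟩⟩
  have hmm : m ∈ Finset.Icc 1 m := Finset.mem_Icc.2 ⟨hm, le_rfl⟩
  set c := coeffB α β m θ with hc
  set μ := fun i => lam α β i θ with hμ
  have h0 : ∀ k, combination (jacobiPsi α β) (Finset.Icc 1 m) c μ k θ = 0 := fun k =>
    Finset.sum_eq_zero fun i hi => by rw [(hsign i hi).1, mul_zero]
  -- Since `φ_{λ_i}(θ) = 0`, one has `ψ'_{λ_i} = φ'_{λ_i} / φ_0` there, so `B_i ψ'_{λ_i}(θ) = -A_i /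
  -- (Δ φ_0)` and a power sum of the `A_i` remains.
  have h1 : ∀ k < m, deriv (combination (jacobiPsi α β) (Finset.Icc 1 m) c μ k) θ =
      -((-1) ^ (m - 1) * (∏ j ∈ Finset.Icc 1 m, μ j ^ 2) * if k = m - 1 then 1 else 0) /
        (weight α β θ * jacobiPhi α β 0 θ) := fun k hk => by
    rw [S.deriv_combination, ← sum_pfCoeff_mul_pow hsq.injOn hk, neg_div, Finset.sum_div,
      ← Finset.sum_neg_distrib]
    refine Finset.sum_congr rfl fun i hi => ?_
    have hne : deriv (jacobiPhi α β (lam α β i θ)) θ ≠ 0 := fun h => by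
      have := (hsign i hi).2
      rw [hderiv i hi, h] at this
      simp at this
    rw [hderiv i hi, hc, coeffB]
    simp only [hμ]
    field_simp
  refine isExtremal_of_combination hβ hβα hα (μ := μ) (by omega) hθ hB ⟨m, hmm⟩
    (fun i hi => ⟨(hz i hi).1.le, (hz i hi).2.1⟩) (fun t => rfl) (fun t ht0 htθ => ?_) ?_
  · refine S.combination_ne_zero_of_dirichlet (c := c) (μ := μ) (n := m - 1) hmm (hB m hmm).ne' (hz m hmm).1
      (fun i hi him => hsq hi hmm (lt_of_le_of_ne (Finset.mem_Icc.1 hi).2 him)) ?_ h0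
      (fun k hk => ?_) ht0 htθ
    · rw [(hz m hmm).2.2]
      linarith
    · rw [h1 k (by omega), if_neg (by omega)]
      simp
  -- The first `m - 1` iterates have double zeros at `θ`, and the next one has a simple zero.
  · rw [S.analyticOrderAt_combination_eq_add (n := m - 1) hθ (fun k _ => h0 k) fun k hk => by
      rw [h1 k (by omega), if_neg (by omega)]; simp,
      (S.analyticAt_combination _ c μ (m - 1) θ).analyticOrderAt_eq_one_of_zero_deriv_ne_zero
        (h0 _) ?_]
    · rw [show 2 * m - 1 = 1 + 2 * (m - 1) by omega, Nat.cast_add, Nat.cast_one]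
    · rw [h1 (m - 1) (by omega), if_pos rfl, mul_one]
      refine div_ne_zero (neg_ne_zero.2 (mul_ne_zero (by simp) ?_)) (mul_pos hw hφ).ne'
      exact Finset.prod_ne_zero_iff.2 fun j hj => (pow_pos (hz j hj).1 2).ne'

theorem exists_isExtremal_even {γ : ℝ} (hγ : 0 < γ) {m : ℕ} (hm : 1 ≤ m) :
    ∃ θ : ℝ, (∀ t, IsTStar α β m γ t ↔ t = θ) ∧
      (∀ i ∈ Finset.Icc 1 m, 0 < coeffBStar α β m θ i) ∧
      IsExtremal α β γ (2 * m) θ (extremalEven α β m θ) := by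
  have S := sturmFamily_jacobiPsi hβ hβα hα
  have hpi := Real.pi_pos
  have hm0 : (0 : ℝ) < m := by exact_mod_cast hm
  obtain ⟨θ, hθ, huniq⟩ := S.existsUnique_prufer_eq hγ (x := m * Real.pi) (by positivity)
  have hγθ := ((huniq θ).2 rfl).2
  have hφ := jacobiPhi_zero_pos hβ hβα hα θ
  have hw : 0 < weight α β θ * jacobiPhi α β 0 θ ^ 2 :=
    mul_pos (weight_pos α β hθ) (pow_pos hφ 2)
  have hz : ∀ i ∈ Finset.Icc 1 m, 0 < lamStar α β i θ ∧ lamStar α β i θ ≤ γ ∧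
      prufer (fun t => weight α β t * jacobiPhi α β 0 t ^ 2) (jacobiPsi α β) (lamStar α β i θ) θ =
        i * Real.pi := fun i hi => by
    obtain ⟨hi1, him⟩ := Finset.mem_Icc.1 hi
    have hi0 : (0 : ℝ) < i := by exact_mod_cast hi1
    refine S.nthPosZero_spec hγ hθ (by positivity) ?_
      (isNthPosZero_jacobiPsiDeriv hβ hβα hα hθ hi1)
    rw [hγθ]
    gcongr
  have hmono : StrictMonoOn (fun i => lamStar α β i θ) (Finset.Icc 1 m) := by
    refine S.strictMonoOn_of_prufer hθ (fun i hi => (hz i hi).1.le) (fun i hi => (hz i hi).2.2)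
      fun i _ j _ hij => ?_
    gcongr
  have hsq : StrictMonoOn (fun i => lamStar α β i θ ^ 2) (Finset.Icc 1 m) :=
    fun i hi j hj hij => pow_lt_pow_left₀ (hmono hi hj hij) (hz i hi).1.le two_ne_zero
  have hsign := fun i (hi : i ∈ Finset.Icc 1 m) => S.sign_of_prufer hθ.le hw (hz i hi).2.2
  have hB : ∀ i ∈ Finset.Icc 1 m, 0 < coeffBStar α β m θ i := fun i hi => by
    have h1 := pfCoeff_sign (z := fun j => lamStar α β j θ) (fun j hj => (hz j hj).1) hmono hi
    have h2 := (hsign i hi).1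
    have h3 := pow_pos (hz i hi).1 2
    rw [← Nat.sub_add_cancel (Finset.mem_Icc.1 hi).1, pow_succ,
      Nat.sub_add_cancel (Finset.mem_Icc.1 hi).1] at h2
    rw [coeffBStar]
    rcases neg_one_pow_eq_or ℝ (i - 1) with h | h <;> rw [h] at h1 h2
    · exact div_pos_of_neg_of_neg (by linarith) (mul_neg_of_pos_of_neg h3 (by linarith))
    · exact div_pos (by linarith) (mul_pos h3 (by linarith))
  refine ⟨θ, fun t => ?_, hB, ?_⟩
  · rw [← huniq t, IsTStar]
    constructor
    · exact fun h => ⟨h.1, ((isNthPosZero_jacobiPsiDeriv hβ hβα hα h.1 hm γ).1 h.2).2⟩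
    · exact fun h => ⟨h.1, (isNthPosZero_jacobiPsiDeriv hβ hβα hα h.1 hm γ).2 ⟨hγ, h.2⟩⟩
  have hmm : m ∈ Finset.Icc 1 m := Finset.mem_Icc.2 ⟨hm, le_rfl⟩
  -- Index 0 carries the term `φ_0`, with frequency 0 and coefficient 1.
  set s := insert 0 (Finset.Icc 1 m) with hs
  set c : ℕ → ℝ := fun i => if i = 0 then 1 else coeffBStar α β m θ i with hc
  set μ : ℕ → ℝ := fun i => if i = 0 then 0 else lamStar α β i θ with hμ
  have hi0 : ∀ i ∈ Finset.Icc 1 m, i ≠ 0 := fun i hi => by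
    have := (Finset.mem_Icc.1 hi).1
    omega
  have hci : ∀ i ∈ Finset.Icc 1 m, c i = coeffBStar α β m θ i := fun i hi => if_neg (hi0 i hi)
  have hμi : ∀ i ∈ Finset.Icc 1 m, μ i = lamStar α β i θ := fun i hi => if_neg (hi0 i hi)
  have hc0 : c 0 = 1 := if_pos rfl
  have hμ0 : μ 0 = 0 := if_pos rfl
  have hsum : ∀ f : ℕ → ℝ, ∑ i ∈ s, f i = f 0 + ∑ i ∈ Finset.Icc 1 m, f i := fun f =>
    Finset.sum_insert (by simp)
  have hcpos : ∀ i ∈ s, 0 < c i := fun i hi => by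
    rcases Finset.mem_insert.1 hi with rfl | hi
    · rw [hc0]
      exact one_pos
    · rw [hci i hi]
      exact hB i hi
  have h1 : ∀ k, deriv (combination (jacobiPsi α β) s c μ k) θ = 0 := fun k => by
    rw [S.deriv_combination]
    refine Finset.sum_eq_zero fun i hi => ?_
    have : deriv (jacobiPsi α β (μ i)) θ = 0 := by
      rcases Finset.mem_insert.1 hi with rfl | hi
      · refine (S.sign_of_prufer (k := 0) hθ.le hw ?_).2
        rw [hμ0, S.prufer_zero_left]
        simp
      · rw [hμi i hi]
        exact (hsign i hi).2
    rw [this, mul_zero]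
  have hψ0 : jacobiPsi α β 0 θ = 1 := div_self hφ.ne'
  have hterm : ∀ i ∈ Finset.Icc 1 m, ∀ k, c i * (μ i ^ 2) ^ k * jacobiPsi α β (μ i) θ =
      -(pfCoeff (fun j => lamStar α β j θ) m i / lamStar α β i θ ^ 2 *
        (lamStar α β i θ ^ 2) ^ k) := fun i hi k => by
    have hne : jacobiPsi α β (lamStar α β i θ) θ ≠ 0 := fun h => by
      have := (hsign i hi).1
      rw [h, mul_zero] at this
      exact this.false
    have := (hz i hi).1.ne'
    rw [hci i hi, hμi i hi, coeffBStar]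
    field_simp
  -- The term `φ_0` contributes 1 (with the convention `0 ^ 0 = 1`), and the others contribute `-∑
  -- A_i^* / λ_i^{*2} = -1`.
  have h0 : combination (jacobiPsi α β) s c μ 0 θ = 0 := by
    rw [combination, hsum, Finset.sum_congr rfl fun i hi => hterm i hi 0, Finset.sum_neg_distrib,
      hc0, hμ0, hψ0]
    simp only [pow_zero, mul_one]
    rw [sum_pfCoeff_div hm (fun i hi => (hz i hi).1.ne') hsq.injOn, add_neg_cancel]
  -- From the first iterate on, the term of frequency 0 drops out.
  have hsucc : ∀ k < m, combination (jacobiPsi α β) s c μ (k + 1) θ =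
      -((-1) ^ (m - 1) * (∏ j ∈ Finset.Icc 1 m, lamStar α β j θ ^ 2) *
        if k = m - 1 then 1 else 0) := fun k hk => by
    rw [combination, hsum, Finset.sum_congr rfl fun i hi => hterm i hi (k + 1),
      Finset.sum_neg_distrib, hμ0, ← sum_pfCoeff_mul_pow hsq.injOn hk]
    rw [zero_pow two_ne_zero, zero_pow (Nat.succ_ne_zero k), mul_zero, zero_mul, zero_add]
    refine congrArg Neg.neg (Finset.sum_congr rfl fun i hi => ?_)
    have := (hz i hi).1.ne'
    field_simp
    ring
  have hlow : ∀ k < m, combination (jacobiPsi α β) s c μ k θ = 0 := fun k hk => by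
    rcases k with _ | k
    · exact h0
    · rw [hsucc k (by omega), if_neg (by omega)]
      simp
  refine isExtremal_of_combination hβ hβα hα (s := s) (c := c) (μ := μ) (by omega) hθ hcpos
    ⟨m, Finset.mem_insert_of_mem hmm⟩ (fun i hi => ?_) (fun t => ?_) (fun t ht0 htθ => ?_) ?_
  · rcases Finset.mem_insert.1 hi with rfl | hi
    · rw [hμ0]
      exact ⟨le_rfl, hγ.le⟩
    · rw [hμi i hi]
      exact ⟨(hz i hi).1.le, (hz i hi).2.1⟩
  · rw [extremalEven, hsum, hc0, hμ0, one_mul]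
    congr 1
    exact Finset.sum_congr rfl fun i hi => by rw [hci i hi, hμi i hi]
  · refine S.combination_ne_zero_of_neumann (n := m) (Finset.mem_insert_of_mem hmm)
      (hcpos m (Finset.mem_insert_of_mem hmm)).ne' ?_ (fun i hi him => ?_) ?_ hlow
      (fun k => h1 k) ht0 htθ
    · rw [hμi m hmm]
      exact (hz m hmm).1
    · rw [hμi m hmm]
      rcases Finset.mem_insert.1 hi with rfl | hi
      · rw [hμ0, zero_pow two_ne_zero]
        exact pow_pos (hz m hmm).1 2
      · rw [hμi i hi]
        exact hsq hi hmm (lt_of_le_of_ne (Finset.mem_Icc.1 hi).2 him)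
    · rw [hμi m hmm, (hz m hmm).2.2]
      linarith
  -- The first `m` iterates have double zeros at `θ`, and the `m`-th iterate of the operator does
  -- not vanish there.
  · rw [S.analyticOrderAt_combination_eq_add (n := m) hθ hlow fun k _ => h1 k,
      (S.analyticAt_combination s c μ m θ).analyticOrderAt_eq_zero.2 ?_, zero_add]
    obtain ⟨k, rfl⟩ := Nat.exists_eq_add_of_le' hm
    rw [hsucc k (by omega), if_pos (by omega), mul_one]
    refine neg_ne_zero.2 (mul_ne_zero (by simp) ?_)
    exact Finset.prod_ne_zero_iff.2 fun j hj => (pow_pos (hz j hj).1 2).ne'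

end Extremal

end JacobiZeros

/-! ### The theorem. -/

open JacobiZeros in
theorem theorem2 (α β γ : ℝ) (hβ : -1 / 2 ≤ β) (hβα : β ≤ α) (hα : -1 / 2 < α) (hγ : 0 < γ)
    (m : ℕ) (hm : 1 ≤ m) :
    (∃ θ : ℝ, (∀ t, IsT α β m γ t ↔ t = θ) ∧
      (⨅ g ∈ classL α β γ, shortestLength g (2 * m - 1)) ≤ ENNReal.ofReal θ ∧
      (∀ i ∈ Finset.Icc 1 m, 0 < coeffB α β m θ i) ∧
      IsExtremal α β γ (2 * m - 1) θ (extremalOdd α β m θ)) ∧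
    (∃ θ : ℝ, (∀ t, IsTStar α β m γ t ↔ t = θ) ∧
      (⨅ g ∈ classL α β γ, shortestLength g (2 * m)) ≤ ENNReal.ofReal θ ∧
      (∀ i ∈ Finset.Icc 1 m, 0 < coeffBStar α β m θ i) ∧
      IsExtremal α β γ (2 * m) θ (extremalEven α β m θ)) := by
  obtain ⟨θ, h1, h2, h3⟩ := exists_isExtremal_odd hβ hβα hα hγ hm
  obtain ⟨θ', h1', h2', h3'⟩ := exists_isExtremal_even hβ hβα hα hγ hm
  exact ⟨⟨θ, h1, (iInf₂_le _ h3.1).trans h3.2.2.1.le, h2, h3⟩,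
    ⟨θ', h1', (iInf₂_le _ h3'.1).trans h3'.2.2.1.le, h2', h3'⟩⟩
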